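/- **Conventions.** For nonempty graphs $G,H$ with equally many vertices, a bijection $\pi:V(G)\to V(H)$ is an $\alpha$-isomorphism if $|\{e\in E(G):\pi(e)\in E(H)\}|\ge\alpha\cdot\max\{|E(G)|,|E(H)|\}$, and $G,H$ are $\alpha$-isomorphic if there is one. An algorithm solves RobustGiso if for some $r:[0,1]\to[0,1]$ with $r(\epsilon)\to0$ as $\epsilon\to0^+$ it outputs, on every pair of nonempty graphs that is $(1-\epsilon)$-isomorphic, a $(1-r(\epsilon))$-isomorphism between them. A 3XOR instance with $n$ variables and $m$ constraints is a sequence of $m$ equations $x_i+x_j+x_k=b$ over $\mathbb Z_2$, each in three distinct variables out of $n$; it is $\alpha$-satisfiable if some assignment satisfies at least $\alpha m$ of them. "Almost all" instances means probability $1-o(1)$ as $n\to\infty$ when the $m$ sets of three variables are distinct and uniformly random and the right-hand sides are uniform and independent. Algorithms are unit-cost random access machines with addition and subtraction, graphs are given by edge lists, and running times are up to constant factors, with $t:\mathbb N\to\mathbb N$, $t(n)\ge n$. *Feige's R3XOR Hypothesis:* for every fixed $\epsilon>0$ and $\Delta\in\mathbb Z^+$ there is no polynomial-time algorithm which outputs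 "typical" on almost all 3XOR instances with $n$ variables and $\Delta n$ constraints, but never outputs "typical" on such an instance that is $(1-\epsilon)$-satisfiable. **Theorem.** (1) There are universal constants $\epsilon_0>0$, $\Delta\in\mathbb Z^+$, $c>0$ and $K,b\in\mathbb N$ such that for every $\epsilon>0$ and every $t$ the following holds. Suppose that there is a $t(n)$-time algorithm which, on pairs of $n$-vertex, $m$-edge graphs with $1\le m\le Kn$, distinguishes the $(1-\epsilon)$-isomorphic pairs from the pairs that are not $(1-\epsilon_0)$-isomorphic. Then there is a $t(bn)$-time algorithm which outputs "typical" for almost all 3XOR instances with $n$ variables and $\Delta n$ constraints, yet never outputs "typical" on such an instance that is $(1-c\epsilon)$-satisfiable. Consequently, with the same $\epsilon_0$ and $K$, under Feige's R3XOR Hypothesis no polynomial-time algorithm distinguishes these two kinds of pairs, for any $\epsilon>0$. (2) Under Feige's R3XOR Hypothesis there is no polynomial-time algorithm for RobustGiso. -/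

import Mathlib

open Filter Topology

namespace RobustGI

/-! ### Random access machines with unit cost

The store consists of registers (addressed directly by the program) and of a memory (addressed
indirectly, through the content of a register); all cells hold natural numbers.  The elementary
instructions are constants, copying, addition, truncated subtraction, reading and writing of the
memory, each of cost 1; control flow is by tests of a register against zero, each of cost 1.  There
is no multiplication instruction, so that polynomial time on this machine is polynomial time on a
Turing machine. -/

/-- The content of the registers and of the memory. -/
structure Store where
  reg : ℕ → ℕ
  mem : ℕ → ℕ

/-- Programs of the random access machine. -/
inductive Prog where
  /-- `R[d] := v` -/
  | const (d v : ℕ)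
  /-- `R[d] := R[a]` -/
  | copy (d a : ℕ)
  /-- `R[d] := R[a] + R[b]` -/
  | add (d a b : ℕ)
  /-- `R[d] := max (R[a] - R[b], 0)` -/
  | sub (d a b : ℕ)
  /-- `R[d] := M[R[a]]` -/
  | load (d a : ℕ)
  /-- `M[R[a]] := R[s]` -/
  | store (a s : ℕ)
  /-- first `p`, then `q` -/
  | seq (p q : Prog)
  /-- if `R[a] ≠ 0` then `p` else `q` -/
  | cond (a : ℕ) (p q : Prog)
  /-- while `R[a] ≠ 0` do `p` -/
  | loop (a : ℕ) (p : Prog)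

/-- The store after `R[d] := v`. -/
def Store.setReg (s : Store) (d v : ℕ) : Store :=
  { s with reg := Function.update s.reg d v }

/-- The store after `M[a] := v`. -/
def Store.setMem (s : Store) (a v : ℕ) : Store :=
  { s with mem := Function.update s.mem a v }

/-- `Run p s k s'`: started in the store `s`, the program `p` halts after exactly `k` steps, and the
store is then `s'`. -/
inductive Run : Prog → Store → ℕ → Store → Prop where
  | const (d v : ℕ) (s : Store) : Run (.const d v) s 1 (s.setReg d v)
  | copy (d a : ℕ) (s : Store) : Run (.copy d a) s 1 (s.setReg d (s.reg a))
  | add (d a b : ℕ) (s : Store) : Run (.add d a b) s 1 (s.setReg d (s.reg a + s.reg b))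
  | sub (d a b : ℕ) (s : Store) : Run (.sub d a b) s 1 (s.setReg d (s.reg a - s.reg b))
  | load (d a : ℕ) (s : Store) : Run (.load d a) s 1 (s.setReg d (s.mem (s.reg a)))
  | store (a r : ℕ) (s : Store) : Run (.store a r) s 1 (s.setMem (s.reg a) (s.reg r))
  | seq {p q : Prog} {s s' s'' : Store} {k l : ℕ} (hp : Run p s k s') (hq : Run q s' l s'') :
      Run (.seq p q) s (k + l) s''
  | condTrue {a : ℕ} {p q : Prog} {s s' : Store} {k : ℕ} (ha : s.reg a ≠ 0) (hp : Run p s k s') :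
      Run (.cond a p q) s (k + 1) s'
  | condFalse {a : ℕ} {p q : Prog} {s s' : Store} {k : ℕ} (ha : s.reg a = 0) (hq : Run q s k s') :
      Run (.cond a p q) s (k + 1) s'
  | loopStep {a : ℕ} {p : Prog} {s s' s'' : Store} {k l : ℕ} (ha : s.reg a ≠ 0)
      (hp : Run p s k s') (hl : Run (.loop a p) s' l s'') : Run (.loop a p) s (k + l + 1) s''
  | loopEnd {a : ℕ} {p : Prog} {s : Store} (ha : s.reg a = 0) : Run (.loop a p) s 1 s

/-- The initial store on the input `x`: the words of `x` are in the memory cells `0, 1, 2, …`, the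
number of words is in register `0`, and everything else is zero. -/
def inputStore (x : List ℕ) : Store where
  reg := fun i => if i = 0 then x.length else 0
  mem := fun i => x.getD i 0

/-- On input `x` the program `p` halts after at most `T` steps. -/
def HaltsWithin (p : Prog) (x : List ℕ) (T : ℕ) : Prop :=
  ∃ k ≤ T, ∃ s, Run p (inputStore x) k s

/-- On input `x` the program `p` halts with the answer `1` (in register `0`). -/
def AnswersOne (p : Prog) (x : List ℕ) : Prop :=
  ∃ k s, Run p (inputStore x) k s ∧ s.reg 0 = 1

/-! ### Approximate isomorphism of graphs -/

/-- The bijection `π` is an `α`-isomorphism between `G` and `H`: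
`|{e ∈ E(G) : π(e) ∈ E(H)}| / max {|E(G)|, |E(H)|} ≥ α`. -/
def IsApproxIso {V W : Type*} (α : ℝ) (G : SimpleGraph V) (H : SimpleGraph W) (π : V ≃ W) : Prop :=
  α ≤ ({e ∈ G.edgeSet | e.map π ∈ H.edgeSet}.ncard : ℝ) /
    (max G.edgeSet.ncard H.edgeSet.ncard : ℕ)

/-- `G` and `H` are `α`-isomorphic. -/
def ApproxIsomorphic {V W : Type*} (α : ℝ) (G : SimpleGraph V) (H : SimpleGraph W) : Prop :=
  ∃ π : V ≃ W, IsApproxIso α G H π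

/-- `l` lists the edges of `G`, each once and with the smaller endpoint first, in any order. -/
def IsEdgeList {n : ℕ} (l : List (Fin n × Fin n)) (G : SimpleGraph (Fin n)) : Prop :=
  l.Nodup ∧ ∀ u v : Fin n, (u, v) ∈ l ↔ G.Adj u v ∧ u < v

/-- A pair of graphs on `n` vertices, given by lists of edges, as the input of a program: the number
of vertices, the two numbers of edges, and the two lists. -/
def encodePair {n : ℕ} (lG lH : List (Fin n × Fin n)) : List ℕ :=
  [n, lG.length, lH.length] ++ lG.flatMap (fun e => [(e.1 : ℕ), (e.2 : ℕ)]) ++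
    lH.flatMap (fun e => [(e.1 : ℕ), (e.2 : ℕ)])

/-- The program `A` distinguishes, in time `O(t(n))`, the `(1 - ε)`-isomorphic pairs of `n`-vertex,
`m`-edge graphs from the pairs that are not `(1 - ε₀)`-isomorphic, where `1 ≤ m ≤ K n`.
(On the remaining pairs of such graphs only the running time is restricted.) -/
def Distinguishes (A : Prog) (K : ℕ) (ε ε₀ : ℝ) (t : ℕ → ℕ) : Prop :=
  ∃ a : ℕ, ∀ (n : ℕ) (G H : SimpleGraph (Fin n)) (lG lH : List (Fin n × Fin n)),
    IsEdgeList lG G → IsEdgeList lH H →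
    0 < lG.length → lG.length = lH.length → lG.length ≤ K * n →
      HaltsWithin A (encodePair lG lH) (a * (t n + 1)) ∧
      (ApproxIsomorphic (1 - ε) G H → AnswersOne A (encodePair lG lH)) ∧
      (¬ ApproxIsomorphic (1 - ε₀) G H → ¬ AnswersOne A (encodePair lG lH))

/-- The program `A` solves the robust graph isomorphism problem: for some `r : [0,1] → [0,1]` with
`r(ε) → 0` as `ε → 0⁺`, on every pair of nonempty graphs that is `(1 - ε)`-isomorphic it outputs
(in the memory cells `0, …, n - 1`) a `(1 - r(ε))`-isomorphism. -/
def SolvesRobustGiso (A : Prog) : Prop :=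
  ∃ r : ℝ → ℝ, (∀ ε ∈ Set.Icc (0 : ℝ) 1, r ε ∈ Set.Icc (0 : ℝ) 1) ∧
    Tendsto r (𝓝[>] 0) (𝓝 0) ∧
    ∀ ε ∈ Set.Icc (0 : ℝ) 1,
      ∀ (n : ℕ) (G H : SimpleGraph (Fin n)) (lG lH : List (Fin n × Fin n)),
        IsEdgeList lG G → IsEdgeList lH H → 0 < lG.length → 0 < lH.length →
        ApproxIsomorphic (1 - ε) G H →
          ∃ k s, Run A (inputStore (encodePair lG lH)) k s ∧
            ∃ π : Fin n ≃ Fin n, IsApproxIso (1 - r ε) G H π ∧ ∀ i : Fin n, s.mem i = (π i : ℕ)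

/-- On pairs of nonempty `n`-vertex graphs the program `A` runs in time polynomial in `n`. -/
def PolyTimeOnPairs (A : Prog) : Prop :=
  ∃ a d : ℕ, ∀ (n : ℕ) (G H : SimpleGraph (Fin n)) (lG lH : List (Fin n × Fin n)),
    IsEdgeList lG G → IsEdgeList lH H → 0 < lG.length → 0 < lH.length →
      HaltsWithin A (encodePair lG lH) (a * (n ^ d + 1))

/-! ### 3XOR -/

/-- A 3XOR constraint `x + y + z = b` on `n` variables: the set `{x, y, z}` of three distinct
variables, and the right-hand side. -/
abbrev XorConstraint (n : ℕ) : Type := {T : Finset (Fin n) // T.card = 3} × ZMod 2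

/-- A 3XOR instance: a sequence of `m` constraints on `n` variables. -/
abbrev XorInstance (n m : ℕ) : Type := Fin m → XorConstraint n

/-- Some assignment satisfies at least `α m` of the `m` constraints. -/
def XorSatisfiable {n m : ℕ} (α : ℝ) (C : XorInstance n m) : Prop :=
  ∃ τ : Fin n → ZMod 2, α * m ≤ ({i | ∑ x ∈ (C i).1.1, τ x = (C i).2}.ncard : ℝ)

/-- A 3XOR instance as the input of a program: the numbers of variables and of constraints, and then
for every constraint its variables in increasing order and its right-hand side. -/
def encodeXor {n m : ℕ} (C : XorInstance n m) : List ℕ :=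
  [n, m] ++ (List.ofFn C).flatMap
    (fun c => (c.1.1.sort (· ≤ ·)).map (fun x => (x : ℕ)) ++ [c.2.val])

/-- The instances among which a random instance is drawn uniformly: the sets of variables of the `m`
constraints are distinct (they are `m` out of the `n.choose 3` sets of three variables). -/
def IsSimple {n m : ℕ} (C : XorInstance n m) : Prop :=
  Function.Injective (fun i => (C i).1)

/-- The program `B` answers "typical" (that is, `1`) on almost all instances with `n` variables and
`Δ n` constraints: with probability `1 - o(1)` on a uniformly random instance. -/
def TypicalOnAlmostAll (B : Prog) (Δ : ℕ) : Prop :=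
  Tendsto (fun n : ℕ =>
      ({C : XorInstance n (Δ * n) | IsSimple C ∧ AnswersOne B (encodeXor C)}.ncard : ℝ) /
        ({C : XorInstance n (Δ * n) | IsSimple C}.ncard : ℝ))
    atTop (𝓝 1)

/-- On instances with `n` variables and `Δ n` constraints, the program `B` runs in time `O(t(n))`,
answers "typical" on almost all of them, and never answers "typical" on one that has an assignment
satisfying at least `(1 - ε) Δ n` constraints. -/
def CertifiesXor (B : Prog) (Δ : ℕ) (ε : ℝ) (t : ℕ → ℕ) : Prop :=
  (∃ a : ℕ, ∀ (n : ℕ) (C : XorInstance n (Δ * n)),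
      HaltsWithin B (encodeXor C) (a * (t n + 1))) ∧
    TypicalOnAlmostAll B Δ ∧
    ∀ (n : ℕ) (C : XorInstance n (Δ * n)),
      XorSatisfiable (1 - ε) C → ¬ AnswersOne B (encodeXor C)

/-- Feige's R3XOR Hypothesis: for all fixed `ε > 0` and `Δ ∈ ℤ⁺` there is no polynomial-time algorithm
that answers "typical" on almost all 3XOR instances with `n` variables and `Δ n` constraints, but
never on an instance with an assignment satisfying at least `(1 - ε) Δ n` constraints. -/
def R3XORHypothesis : Prop :=
  ∀ ε : ℝ, 0 < ε → ∀ Δ : ℕ, 0 < Δ → ¬ ∃ (B : Prog) (d : ℕ), CertifiesXor B Δ ε (fun n => n ^ d)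

end RobustGI

/-!
The reduction turns a 3XOR instance with `n` variables and `m = 300 n` constraints into two graphs on
`3 n + 4 m` vertices with `16 m` edges each. There are two literals `x^0`, `x^1` for every variable `x`,
four vertices `c(i, p, q)` for the `i`-th constraint `x + y + z = b`, and a hub. The vertex `c(i, p, q)`
stands for the solution `x = p`, `y = q`, `z = p + q + b`; it is adjacent to the three literals true in
this solution and to the hub. The second graph belongs to the homogeneous system, with `b = 0`.

*Completeness.* Adding an assignment `τ` to all literals and to all solutions is a bijection between
the two graphs which preserves the sixteen edges of every constraint satisfied by `τ`
(`respects_shift`, `approxIsomorphic_of_xorSatisfiable`). So the constant `c` of the theorem is `1`.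

*Soundness.* Let a bijection `π` preserve all but a fraction `1 / 256` of the edges. Since every edge
belongs to one constraint, `π` preserves all sixteen edges of at least `15 m / 16` constraints. The hub
is the only vertex of degree above `2 m + 4`, so it is fixed (`map_hub`). Consequently the vertices
`c(i, p, q)` of these constraints go to vertices `c(j, p', q')`, and their literals go to literals. If
always `j = i`, then the six literals of the constraint are permuted, and a parity computation shows
that the signs of the images of the literals `x^0` satisfy it (`sum_litMap_eq_rhs`); the images of the
variables play no role here. If `j ≠ i`, then the variables of the constraint `j` are obtained from
those of the constraint `i` through the map that `π` induces on literals. Hence either one assignment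
satisfies `4 m / 5` constraints, or a matching argument yields `3 n` constraints whose variables are
determined by those of `3 n` others and a single map on `2 n` literals (`exists_sat_or_hasOverlap`).

Both are unlikely for a random instance. The first is excluded by an exponential moment bound and the
`2 ^ n` choices of an assignment (`tendsto_density_exists_sat`). For the second, the numbers of choices
are `n ^ (2 n)` for the map and `m ^ (6 n)` for the places, whereas the probability of coincidence is
`(n.choose 3) ^ (-3 n)`, about `n ^ (-9 n)` up to a factor `O(1) ^ n` (`tendsto_density_hasOverlap`). It suffices to count
sequences of constraints which are not necessarily distinct, because almost all of these are simple.

*Programs.* The reduction is carried out in place and in linear time by an explicit program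
(`triple_reduction`), after which the given algorithm is run and its answer is negated.

An algorithm for robust isomorphism is turned into one that distinguishes by verifying its output.
To keep the input, the memory of the given program is relocated to the even addresses (`Run.dbl`); the
verification counts the vertices that are attained and the edges that are preserved
(`triple_verify`). This gives the second part of the theorem from the first one.
-/

namespace RobustGI

/-! ### Executions of programs -/

theorem Store.ext' {s s' : Store} (h : ∀ i, s.reg i = s'.reg i) (h' : ∀ i, s.mem i = s'.mem i) :
    s = s' := by
  cases s; cases s'
  simp only [Store.mk.injEq]
  exact ⟨funext h, funext h'⟩

/-- The machine is deterministic. -/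
theorem Run.unique {p : Prog} {s s₁ s₂ : Store} {k₁ k₂ : ℕ} (h₁ : Run p s k₁ s₁)
    (h₂ : Run p s k₂ s₂) : k₁ = k₂ ∧ s₁ = s₂ := by
  induction h₁ generalizing k₂ s₂ with
  | const | copy | add | sub | load | store => cases h₂; exact ⟨rfl, rfl⟩
  | seq _ _ ihp ihq =>
    cases h₂ with
    | seq hp hq =>
      obtain ⟨rfl, rfl⟩ := ihp hp
      obtain ⟨rfl, rfl⟩ := ihq hq
      exact ⟨rfl, rfl⟩
  | condTrue ha _ ih =>
    cases h₂ with
    | condTrue _ hp => obtain ⟨rfl, rfl⟩ := ih hp; exact ⟨rfl, rfl⟩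
    | condFalse ha' => exact absurd ha' ha
  | condFalse ha _ ih =>
    cases h₂ with
    | condTrue ha' => exact absurd ha ha'
    | condFalse _ hp => obtain ⟨rfl, rfl⟩ := ih hp; exact ⟨rfl, rfl⟩
  | loopStep ha _ _ ihp ihl =>
    cases h₂ with
    | loopStep _ hp hl =>
      obtain ⟨rfl, rfl⟩ := ihp hp
      obtain ⟨rfl, rfl⟩ := ihl hl
      exact ⟨rfl, rfl⟩
    | loopEnd ha' => exact absurd ha' ha
  | loopEnd ha =>
    cases h₂ with
    | loopStep ha' => exact absurd ha ha'
    | loopEnd => exact ⟨rfl, rfl⟩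

/-- Total correctness with a time bound: from every store satisfying `P`, the program halts after at
most `T` steps in a store satisfying `Q`. -/
def Triple (P : Store → Prop) (p : Prog) (T : ℕ) (Q : Store → Prop) : Prop :=
  ∀ s, P s → ∃ k ≤ T, ∃ s', Run p s k s' ∧ Q s'

theorem Triple.seq {P Q R : Store → Prop} {p q : Prog} {T U : ℕ} (hp : Triple P p T Q)
    (hq : Triple Q q U R) : Triple P (.seq p q) (T + U) R := by
  intro s hs
  obtain ⟨k, hk, s', h, hs'⟩ := hp s hs
  obtain ⟨l, hl, s'', h', hs''⟩ := hq s' hs'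
  exact ⟨k + l, by omega, s'', .seq h h', hs''⟩

theorem Triple.weaken {P P' Q Q' : Store → Prop} {p : Prog} {T T' : ℕ} (h : Triple P p T Q)
    (hP : ∀ s, P' s → P s) (hQ : ∀ s, Q s → Q' s) (hT : T ≤ T') : Triple P' p T' Q' := by
  intro s hs
  obtain ⟨k, hk, s', h, hs'⟩ := h s (hP s hs)
  exact ⟨k, by omega, s', h, hQ _ hs'⟩

/-- The rule for loops: `I j` holds after `j` rounds, and there are exactly `N` rounds. -/
theorem Triple.loop {a : ℕ} {p : Prog} {T : ℕ} (I : ℕ → Store → Prop) (N : ℕ)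
    (hreg : ∀ j ≤ N, ∀ s, I j s → (s.reg a = 0 ↔ j = N))
    (hstep : ∀ j < N, Triple (I j) p T (I (j + 1))) :
    Triple (I 0) (.loop a p) (N * (T + 1) + 1) (I N) := by
  have key : ∀ d j, j + d = N → Triple (I j) (.loop a p) (d * (T + 1) + 1) (I N) := by
    intro d
    induction d with
    | zero =>
      rintro j rfl s hs
      exact ⟨1, by simp, s, .loopEnd ((hreg j le_rfl s hs).2 rfl), hs⟩
    | succ d ih =>
      intro j hj s hs
      have ha : s.reg a ≠ 0 := fun h => by
        have := (hreg j (by omega) s hs).1 h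
        omega
      obtain ⟨k, hk, s', h, hs'⟩ := hstep j (by omega) s hs
      obtain ⟨l, hl, s'', h', hs''⟩ := ih (j + 1) (by omega) s' hs'
      refine ⟨k + l + 1, ?_, s'', .loopStep ha h h', hs''⟩
      rw [Nat.add_mul]
      omega
  exact key N 0 (by simp)

/-- The program does not contain a loop. -/
def LoopFree : Prog → Prop
  | .seq p q => LoopFree p ∧ LoopFree q
  | .cond _ p q => LoopFree p ∧ LoopFree q
  | .loop _ _ => False
  | _ => True

/-- The store in which a loop-free program halts. -/
def ev : Prog → Store → Store
  | .const d v, s => s.setReg d v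
  | .copy d a, s => s.setReg d (s.reg a)
  | .add d a b, s => s.setReg d (s.reg a + s.reg b)
  | .sub d a b, s => s.setReg d (s.reg a - s.reg b)
  | .load d a, s => s.setReg d (s.mem (s.reg a))
  | .store a r, s => s.setMem (s.reg a) (s.reg r)
  | .seq p q, s => ev q (ev p s)
  | .cond a p q, s => if s.reg a = 0 then ev q s else ev p s
  | .loop _ _, s => s

/-- The number of instructions and tests in a program, which bounds the running time of a loop-free
program. -/
def size : Prog → ℕ
  | .seq p q => size p + size q
  | .cond _ p q => size p + size q + 1
  | _ => 1

theorem LoopFree.run {p : Prog} (hp : LoopFree p) (s : Store) :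
    ∃ k ≤ size p, Run p s k (ev p s) := by
  induction p generalizing s with
  | const | copy | add | sub | load | store => exact ⟨1, le_rfl, by constructor⟩
  | seq p q ihp ihq =>
    obtain ⟨k, hk, h⟩ := ihp hp.1 s
    obtain ⟨l, hl, h'⟩ := ihq hp.2 (ev p s)
    exact ⟨k + l, by simp only [size]; omega, .seq h h'⟩
  | cond a p q ihp ihq =>
    by_cases ha : s.reg a = 0
    · obtain ⟨k, hk, h⟩ := ihq hp.2 s
      refine ⟨k + 1, by simp only [size]; omega, ?_⟩
      simp only [ev, ha, if_true]
      exact .condFalse ha h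
    · obtain ⟨k, hk, h⟩ := ihp hp.1 s
      refine ⟨k + 1, by simp only [size]; omega, ?_⟩
      simp only [ev, ha, if_false]
      exact .condTrue ha h
  | loop => exact hp.elim

theorem Triple.of_ev {P Q : Store → Prop} {p : Prog} (hp : LoopFree p)
    (h : ∀ s, P s → Q (ev p s)) : Triple P p (size p) Q := by
  intro s hs
  obtain ⟨k, hk, hr⟩ := hp.run s
  exact ⟨k, hk, _, hr, h s hs⟩

/-- Sequential composition of a list of programs; it ends with a dummy instruction that changes
nothing. -/
def seqs : List Prog → Prog
  | [] => .copy 0 0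
  | p :: l => .seq p (seqs l)

theorem ev_copy_self (a : ℕ) (s : Store) : ev (.copy a a) s = s := by
  simp [ev, Store.setReg]

theorem ev_seqs_cons (p : Prog) (l : List Prog) (s : Store) :
    ev (seqs (p :: l)) s = ev (seqs l) (ev p s) := rfl

theorem ev_seqs_nil (s : Store) : ev (seqs []) s = s := ev_copy_self 0 s

/-- Write the contents of the registers in the list `l` to consecutive memory cells, starting with
the address in register `t`; register `1` is supposed to contain `1`. -/
def writeRegs (t : ℕ) (l : List ℕ) : Prog :=
  seqs (l.map fun r => .seq (.store t r) (.add t t 1))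

theorem loopFree_writeRegs (t : ℕ) (l : List ℕ) : LoopFree (writeRegs t l) := by
  induction l with
  | nil => trivial
  | cons r l ih => exact ⟨⟨trivial, trivial⟩, ih⟩

theorem ev_writeRegs_reg {t : ℕ} (ht : t ≠ 1) (l : List ℕ) (s : Store) (h1 : s.reg 1 = 1) :
    (ev (writeRegs t l) s).reg = Function.update s.reg t (s.reg t + l.length) := by
  induction l generalizing s with
  | nil => simp [writeRegs, seqs, ev_copy_self]
  | cons r l ih =>
    have := ih (ev (.seq (.store t r) (.add t t 1)) s)
      (by simp [ev, Store.setReg, Store.setMem, ht.symm, h1])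
    simp only [writeRegs, List.map_cons, seqs] at this ⊢
    rw [ev, this]
    simp [ev, Store.setReg, Store.setMem, h1]
    ring_nf

theorem ev_writeRegs_mem {t : ℕ} (ht : t ≠ 1) (l : List ℕ) (hl : t ∉ l) (s : Store)
    (h1 : s.reg 1 = 1) (x : ℕ) :
    (ev (writeRegs t l) s).mem x =
      if s.reg t ≤ x ∧ x < s.reg t + l.length then s.reg (l.getD (x - s.reg t) 0)
      else s.mem x := by
  induction l generalizing s with
  | nil =>
    rw [if_neg (by simp)]
    simp [writeRegs, seqs, ev_copy_self]
  | cons r l ih =>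
    have hr : t ≠ r := fun h => hl (by simp [h])
    have := ih (fun h => hl (by simp [h])) (ev (.seq (.store t r) (.add t t 1)) s)
      (by simp [ev, Store.setReg, Store.setMem, ht.symm, h1])
    simp only [writeRegs, List.map_cons, seqs] at this ⊢
    rw [ev, this]
    simp only [ev, Store.setReg, Store.setMem, Function.update_self, h1, List.length_cons]
    rcases lt_trichotomy x (s.reg t) with h | h | h
    · rw [if_neg (by omega), if_neg (by omega), Function.update_of_ne (by omega)]
    · subst h
      rw [if_neg (by omega), if_pos (by omega)]
      simp
    · by_cases h' : x < s.reg t + 1 + l.length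
      · rw [if_pos (by omega), if_pos (by omega)]
        obtain ⟨d, rfl⟩ := Nat.exists_eq_add_of_lt h
        have e1 : s.reg t + d + 1 - (s.reg t + 1) = d := by omega
        have e2 : s.reg t + d + 1 - s.reg t = d + 1 := by omega
        rw [e1, e2, List.getD_cons_succ, Function.update_of_ne]
        intro h0
        by_cases hd : d < l.length
        · rw [List.getD_eq_getElem _ _ hd] at h0
          exact hl (by rw [← h0]; simp)
        · omega
      · rw [if_neg (by omega), if_neg (by omega), Function.update_of_ne (by omega)]

/-! ### Simulation with a doubled memory -/

/-- All registers mentioned in the program have a number below `regBound`. -/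
def regBound : Prog → ℕ
  | .const d _ => d + 1
  | .copy d a => max d a + 1
  | .add d a b => max d (max a b) + 1
  | .sub d a b => max d (max a b) + 1
  | .load d a => max d a + 1
  | .store a s => max a s + 1
  | .seq p q => max (regBound p) (regBound q)
  | .cond a p q => max (a + 1) (max (regBound p) (regBound q))
  | .loop a p => max (a + 1) (regBound p)

/-- The program `p` with its memory cell `x` relocated to the address `2 x`, so that it does not touch
the odd addresses. Register `t` is used for the computation of addresses. -/
def dbl (t : ℕ) : Prog → Prog
  | .load d a => .seq (.add t a a) (.load d t)
  | .store a s => .seq (.add t a a) (.store t s)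
  | .seq p q => .seq (dbl t p) (dbl t q)
  | .cond a p q => .cond a (dbl t p) (dbl t q)
  | .loop a p => .loop a (dbl t p)
  | p => p

/-- The store `S` contains the store `s` in its registers below `t` and its even memory cells. -/
def Simulates (t : ℕ) (s S : Store) : Prop :=
  (∀ i < t, S.reg i = s.reg i) ∧ ∀ x, S.mem (2 * x) = s.mem x

/-- The stores agree outside of the part that a relocated program may use. -/
def SameRest (t : ℕ) (S S' : Store) : Prop :=
  (∀ i, t < i → S'.reg i = S.reg i) ∧ ∀ x, S'.mem (2 * x + 1) = S.mem (2 * x + 1)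

theorem SameRest.trans {t : ℕ} {S S' S'' : Store} (h : SameRest t S S') (h' : SameRest t S' S'') :
    SameRest t S S'' :=
  ⟨fun i hi => (h'.1 i hi).trans (h.1 i hi), fun x => (h'.2 x).trans (h.2 x)⟩

theorem Simulates.setReg {t d : ℕ} {s S : Store} (h : Simulates t s S) (v : ℕ) :
    Simulates t (s.setReg d v) (S.setReg d v) := by
  refine ⟨fun i hi => ?_, h.2⟩
  simp only [Store.setReg, Function.update_apply]
  split_ifs
  · rfl
  · exact h.1 i hi

theorem sameRest_setReg {t d : ℕ} (hd : d < t + 1) (S : Store) (v : ℕ) :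
    SameRest t S (S.setReg d v) :=
  ⟨fun i hi => by simp [Store.setReg, Function.update_of_ne (show i ≠ d by omega)], fun _ => rfl⟩

/-- The relocated program simulates the original one with at most twice as many steps, and respects
the part of the store that is not its own. -/
theorem Run.dbl {p : Prog} {s s' : Store} {k t : ℕ} (h : Run p s k s') (ht : regBound p ≤ t)
    {S : Store} (hS : Simulates t s S) :
    ∃ K ≤ 2 * k, ∃ S', Run (dbl t p) S K S' ∧ Simulates t s' S' ∧ SameRest t S S' := by
  induction h generalizing S with
  | const d v s =>
    simp only [regBound] at ht
    exact ⟨1, by omega, _, .const d v S, hS.setReg v, sameRest_setReg (by omega) _ _⟩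
  | copy d a s =>
    simp only [regBound] at ht
    refine ⟨1, by omega, _, .copy d a S, ?_, sameRest_setReg (by omega) _ _⟩
    rw [hS.1 a (by omega)]
    exact hS.setReg _
  | add d a b s =>
    simp only [regBound] at ht
    refine ⟨1, by omega, _, .add d a b S, ?_, sameRest_setReg (by omega) _ _⟩
    rw [hS.1 a (by omega), hS.1 b (by omega)]
    exact hS.setReg _
  | sub d a b s =>
    simp only [regBound] at ht
    refine ⟨1, by omega, _, .sub d a b S, ?_, sameRest_setReg (by omega) _ _⟩
    rw [hS.1 a (by omega), hS.1 b (by omega)]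
    exact hS.setReg _
  | load d a s =>
    simp only [regBound] at ht
    refine ⟨1 + 1, by omega, _, .seq (.add t a a S) (.load d t _), ?_,
      (sameRest_setReg (by omega) _ _).trans (sameRest_setReg (by omega) _ _)⟩
    have h1 : Simulates t s (S.setReg t (S.reg a + S.reg a)) :=
      ⟨fun i hi => by
        simp [Store.setReg, Function.update_of_ne (show i ≠ t by omega), hS.1 i hi], hS.2⟩
    have h2 : (S.setReg t (S.reg a + S.reg a)).mem
        ((S.setReg t (S.reg a + S.reg a)).reg t) = s.mem (s.reg a) := by
      simp only [Store.setReg, Function.update_self]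
      rw [hS.1 a (by omega), ← two_mul, hS.2]
    rw [h2]
    exact h1.setReg _
  | store a r s =>
    simp only [regBound] at ht
    refine ⟨1 + 1, by omega, _, .seq (.add t a a S) (.store t r _), ⟨fun i hi => ?_, fun x => ?_⟩,
      fun i hi => ?_, fun x => ?_⟩
    · simp [Store.setReg, Store.setMem, Function.update_of_ne (show i ≠ t by omega), hS.1 i hi]
    · simp only [Store.setReg, Store.setMem, Function.update_self,
        Function.update_of_ne (show r ≠ t by omega), hS.1 a (by omega), hS.1 r (by omega),
        Function.update_apply, ← hS.2 x]
      by_cases hx : x = s.reg a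
      · rw [if_pos (by omega), if_pos hx]
      · rw [if_neg (by omega), if_neg hx]
    · simp [Store.setReg, Store.setMem, Function.update_of_ne (show i ≠ t by omega)]
    · simp only [Store.setReg, Store.setMem, Function.update_self]
      rw [Function.update_of_ne (by omega)]
  | seq _ _ ihp ihq =>
    simp only [regBound] at ht
    obtain ⟨K, hK, S', h, hs, hr⟩ := ihp (by omega) hS
    obtain ⟨L, hL, S'', h', hs', hr'⟩ := ihq (by omega) hs
    exact ⟨K + L, by omega, S'', .seq h h', hs', hr.trans hr'⟩
  | condTrue ha _ ih =>
    simp only [regBound] at ht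
    obtain ⟨K, hK, S', h, hs, hr⟩ := ih (by omega) hS
    exact ⟨K + 1, by omega, S', .condTrue (by rwa [hS.1 _ (by omega)]) h, hs, hr⟩
  | condFalse ha _ ih =>
    simp only [regBound] at ht
    obtain ⟨K, hK, S', h, hs, hr⟩ := ih (by omega) hS
    exact ⟨K + 1, by omega, S', .condFalse (by rwa [hS.1 _ (by omega)]) h, hs, hr⟩
  | loopStep ha _ _ ihp ihl =>
    have ht' := ht
    simp only [regBound] at ht
    obtain ⟨K, hK, S', h, hs, hr⟩ := ihp (by omega) hS
    obtain ⟨L, hL, S'', h', hs', hr'⟩ := ihl ht' hs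
    exact ⟨K + L + 1, by omega, S'', .loopStep (by rwa [hS.1 _ (by omega)]) h h', hs',
      hr.trans hr'⟩
  | loopEnd ha =>
    simp only [regBound] at ht
    exact ⟨1, by omega, S, .loopEnd (by rwa [hS.1 _ (by omega)]), hS, fun _ _ => rfl, fun _ => rfl⟩

/-! ### Counting 3XOR instances -/

/-- The three variables of a constraint, in increasing order. -/
def var {n : ℕ} (T : {T : Finset (Fin n) // T.card = 3}) : Fin 3 → Fin n :=
  T.1.orderEmbOfFin T.2

theorem var_injective {n : ℕ} (T : {T : Finset (Fin n) // T.card = 3}) :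
    Function.Injective (var T) :=
  (T.1.orderEmbOfFin T.2).injective

theorem image_var {n : ℕ} (T : {T : Finset (Fin n) // T.card = 3}) :
    Finset.univ.image (var T) = T.1 := by
  apply Finset.coe_injective
  simp [var]

theorem sum_eq_sum_var {n : ℕ} {M : Type*} [AddCommMonoid M]
    (T : {T : Finset (Fin n) // T.card = 3}) (f : Fin n → M) :
    ∑ x ∈ T.1, f x = ∑ a, f (var T a) := by
  conv_lhs => rw [← image_var T]
  exact Finset.sum_image fun _ _ _ _ h => var_injective T h

/-- The first components of a sequence of pairs at the `k` places `ι₂ l` are determined by those at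
other places, so that only a fraction `|α| ^ (-k)` of all sequences is of this form. -/
theorem card_determined {α β γ : Type*} [Fintype α] [Fintype β] {m k : ℕ}
    {ι₁ ι₂ : Fin k → Fin m} (hinj : Function.Injective ι₂) (hne : ∀ l l', ι₂ l ≠ ι₁ l')
    {v : α → γ} (hv : Function.Injective v) (Φ : Fin k → α → γ) :
    {C : Fin m → α × β | ∀ l, v (C (ι₂ l)).1 = Φ l (C (ι₁ l)).1}.ncard * Fintype.card α ^ k ≤
      (Fintype.card α * Fintype.card β) ^ m := by
  classical
  set S := {C : Fin m → α × β | ∀ l, v (C (ι₂ l)).1 = Φ l (C (ι₁ l)).1} with hS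
  let F : S × (Fin k → α) → (Fin m → α × β) := fun D j =>
    if h : ∃ l, ι₂ l = j then (D.2 h.choose, (D.1.1 j).2) else D.1.1 j
  have hF1 : ∀ D l, F D (ι₂ l) = (D.2 l, (D.1.1 (ι₂ l)).2) := by
    intro D l
    have h : ∃ l', ι₂ l' = ι₂ l := ⟨l, rfl⟩
    simp only [F, dif_pos h, hinj h.choose_spec]
  have hF2 : ∀ D j, (∀ l, ι₂ l ≠ j) → F D j = D.1.1 j := by
    intro D j h
    simp only [F, dif_neg (not_exists.2 h)]
  have hFinj : Function.Injective F := by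
    rintro ⟨⟨C, hC⟩, w⟩ ⟨⟨C', hC'⟩, w'⟩ h
    have hout : ∀ j, (∀ l, ι₂ l ≠ j) → C j = C' j := by
      intro j hj
      have := congrFun h j
      rwa [hF2 _ _ hj, hF2 _ _ hj] at this
    have hin : ∀ l, w l = w' l ∧ (C (ι₂ l)).2 = (C' (ι₂ l)).2 := by
      intro l
      have := congrFun h (ι₂ l)
      rw [hF1, hF1] at this
      exact Prod.ext_iff.1 this
    have hC2 : C = C' := by
      funext j
      by_cases hj : ∃ l, ι₂ l = j
      · obtain ⟨l, rfl⟩ := hj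
        refine Prod.ext (hv ?_) (hin l).2
        rw [hC l, hC' l, hout (ι₁ l) fun l' => hne l' l]
      · exact hout j (not_exists.1 hj)
    subst hC2
    have : w = w' := funext fun l => (hin l).1
    subst this
    rfl
  have := Nat.card_le_card_of_injective F hFinj
  rw [Nat.card_prod, Nat.card_coe_set_eq] at this
  simpa [Nat.card_eq_fintype_card] using this

theorem card_tri (n : ℕ) : Fintype.card {T : Finset (Fin n) // T.card = 3} = n.choose 3 := by
  simp

/-- The event that `k` of the constraints have variable sets that are obtained from those of other
constraints through a map `g` from literals to variables. -/
def HasOverlap {n m : ℕ} (k : ℕ) (C : XorInstance n m) : Prop :=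
  ∃ (g : Fin n × ZMod 2 → Fin n) (ι₁ ι₂ : Fin k → Fin m) (s : Fin k → Fin 3 → ZMod 2),
    Function.Injective ι₂ ∧ (∀ l l', ι₂ l ≠ ι₁ l') ∧
      ∀ l, (C (ι₂ l)).1.1 = Finset.univ.image fun a => g (var (C (ι₁ l)).1 a, s l a)

theorem ncard_hasOverlap (n m k : ℕ) :
    {C : XorInstance n m | HasOverlap k C}.ncard * n.choose 3 ^ k ≤
      n ^ (2 * n) * m ^ (2 * k) * 8 ^ k * (n.choose 3 * 2) ^ m := by
  classical
  let I := (Fin n × ZMod 2 → Fin n) × (Fin k → Fin m) × (Fin k → Fin m) ×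
    (Fin k → Fin 3 → ZMod 2)
  let A : I → Set (XorInstance n m) := fun i =>
    {C | (Function.Injective i.2.2.1 ∧ ∀ l l', i.2.2.1 l ≠ i.2.1 l') ∧
      ∀ l, (C (i.2.2.1 l)).1.1 =
        Finset.univ.image fun a => i.1 (var (C (i.2.1 l)).1 a, i.2.2.2 l a)}
  have hsub : {C : XorInstance n m | HasOverlap k C} ⊆ ⋃ i ∈ (Finset.univ : Finset I), A i := by
    rintro C ⟨g, ι₁, ι₂, s, h1, h2, h3⟩
    simp only [Set.mem_iUnion]
    exact ⟨(g, ι₁, ι₂, s), Finset.mem_univ _, ⟨h1, h2⟩, h3⟩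
  have hA : ∀ i, (A i).ncard * n.choose 3 ^ k ≤ (n.choose 3 * 2) ^ m := by
    rintro ⟨g, ι₁, ι₂, s⟩
    by_cases hi : Function.Injective ι₂ ∧ ∀ l l', ι₂ l ≠ ι₁ l'
    · have := card_determined (β := ZMod 2) hi.1 hi.2
        (v := fun T : {T : Finset (Fin n) // T.card = 3} => T.1) Subtype.val_injective
        (fun l T => Finset.univ.image fun a => g (var T a, s l a))
      simp only [card_tri, ZMod.card] at this
      simpa [A, hi] using this
    · have : A (g, ι₁, ι₂, s) = ∅ := by
        ext C
        simp only [A, Set.mem_ofPred_eq, Set.mem_empty_iff_false, iff_false]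
        exact fun h => hi h.1
      simp [this]
  have hcardI : Fintype.card I = n ^ (2 * n) * m ^ (2 * k) * 8 ^ k := by
    simp only [I, Fintype.card_prod, Fintype.card_fun, Fintype.card_fin, ZMod.card]
    norm_num
    ring
  calc {C : XorInstance n m | HasOverlap k C}.ncard * n.choose 3 ^ k
      ≤ (∑ i : I, (A i).ncard) * n.choose 3 ^ k := by
        gcongr
        refine (Set.ncard_le_ncard hsub (Set.toFinite _)).trans ?_
        exact Finset.set_ncard_biUnion_le _ _
    _ = ∑ i : I, (A i).ncard * n.choose 3 ^ k := Finset.sum_mul _ _ _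
    _ ≤ ∑ _i : I, (n.choose 3 * 2) ^ m := Finset.sum_le_sum fun i _ => hA i
    _ = _ := by rw [Finset.sum_const, Finset.card_univ, hcardI, smul_eq_mul]

theorem ncard_not_isSimple (n m : ℕ) :
    {C : XorInstance n m | ¬ IsSimple C}.ncard * n.choose 3 ≤ m ^ 2 * (n.choose 3 * 2) ^ m := by
  classical
  let A : Fin m × Fin m → Set (XorInstance n m) := fun i =>
    {C | i.1 ≠ i.2 ∧ (C i.2).1 = (C i.1).1}
  have hsub : {C : XorInstance n m | ¬ IsSimple C} ⊆
      ⋃ i ∈ (Finset.univ : Finset (Fin m × Fin m)), A i := by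
    intro C hC
    simp only [IsSimple, Function.Injective, Set.mem_ofPred_eq, not_forall] at hC
    obtain ⟨i, j, h, hij⟩ := hC
    simp only [Set.mem_iUnion]
    exact ⟨(i, j), Finset.mem_univ _, hij, h.symm⟩
  have hA : ∀ i, (A i).ncard * n.choose 3 ≤ (n.choose 3 * 2) ^ m := by
    rintro ⟨i, j⟩
    by_cases hij : i = j
    · have : A (i, j) = ∅ := by
        ext C
        simp [A, hij]
      simp [this]
    · have := card_determined (β := ZMod 2) (k := 1) (ι₁ := fun _ => i) (ι₂ := fun _ => j)
        (Function.injective_of_subsingleton _) (fun _ _ => Ne.symm hij)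
        (v := fun T : {T : Finset (Fin n) // T.card = 3} => T) Function.injective_id
        (fun _ T => T)
      simp only [card_tri, ZMod.card] at this
      simpa [A, hij] using this
  calc {C : XorInstance n m | ¬ IsSimple C}.ncard * n.choose 3
      ≤ (∑ i, (A i).ncard) * n.choose 3 := by
        gcongr
        refine (Set.ncard_le_ncard hsub (Set.toFinite _)).trans ?_
        exact Finset.set_ncard_biUnion_le _ _
    _ = ∑ i, (A i).ncard * n.choose 3 := Finset.sum_mul _ _ _
    _ ≤ ∑ _i : Fin m × Fin m, (n.choose 3 * 2) ^ m := Finset.sum_le_sum fun i _ => hA i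
    _ = _ := by simp [sq]

/-- The constraint `c` is satisfied by the assignment `τ`. -/
def Sat {n : ℕ} (τ : Fin n → ZMod 2) (c : XorConstraint n) : Prop :=
  ∑ x ∈ c.1.1, τ x = c.2

/-- Markov's inequality for `3 ^ (number of satisfied constraints)`, whose mean is `2 ^ m` for every
single assignment. -/
theorem ncard_exists_sat (n m s : ℕ) :
    {C : XorInstance n m | ∃ τ, s ≤ {i | Sat τ (C i)}.ncard}.ncard * 3 ^ s ≤
      2 ^ n * (n.choose 3 * 4) ^ m := by
  classical
  let A : (Fin n → ZMod 2) → Finset (XorInstance n m) := fun τ =>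
    Finset.univ.filter fun C => s ≤ {i | Sat τ (C i)}.ncard
  have hsub : {C : XorInstance n m | ∃ τ, s ≤ {i | Sat τ (C i)}.ncard} ⊆
      ((Finset.univ.biUnion A : Finset _) : Set (XorInstance n m)) := by
    rintro C ⟨τ, h⟩
    simp only [A, Finset.coe_biUnion, Set.mem_iUnion]
    exact ⟨τ, by simp, by simpa using h⟩
  have hA : ∀ τ, (A τ).card * 3 ^ s ≤ (n.choose 3 * 4) ^ m := by
    intro τ
    have hsum : ∑ c : XorConstraint n, (if Sat τ c then 3 else 1) = n.choose 3 * 4 := by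
      rw [Fintype.sum_prod_type]
      have : ∀ T : {T : Finset (Fin n) // T.card = 3},
          ∑ b : ZMod 2, (if Sat τ (T, b) then 3 else 1) = 4 := by
        intro T
        have h4 : ∀ y : ZMod 2, ∑ b : ZMod 2, (if y = b then 3 else 1) = 4 := by decide
        convert h4 (∑ x ∈ T.1, τ x)
        rfl
      simp only [this, Finset.sum_const, Finset.card_univ, card_tri, smul_eq_mul]
    have hC : ∀ C : XorInstance n m,
        ∏ i, (if Sat τ (C i) then 3 else 1) = 3 ^ {i | Sat τ (C i)}.ncard := by
      intro C
      rw [Finset.prod_ite, Finset.prod_const, Finset.prod_const_one, mul_one,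
        Set.ncard_eq_toFinset_card']
      simp
    rw [← hsum, Fintype.sum_pow, ← smul_eq_mul, ← Finset.sum_const]
    refine (Finset.sum_le_sum fun C hCA => ?_).trans
      (Finset.sum_le_sum_of_subset (Finset.subset_univ (A τ)))
    rw [hC]
    exact Nat.pow_le_pow_right (by norm_num) (by simpa [A] using hCA)
  calc {C : XorInstance n m | ∃ τ, s ≤ {i | Sat τ (C i)}.ncard}.ncard * 3 ^ s
      ≤ (∑ τ, (A τ).card) * 3 ^ s := by
        gcongr
        refine (Set.ncard_le_ncard hsub (Set.toFinite _)).trans ?_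
        rw [Set.ncard_coe_finset]
        exact Finset.card_biUnion_le
    _ = ∑ τ, (A τ).card * 3 ^ s := Finset.sum_mul _ _ _
    _ ≤ ∑ _τ : Fin n → ZMod 2, (n.choose 3 * 4) ^ m := Finset.sum_le_sum fun τ _ => hA τ
    _ = _ := by simp

theorem cube_le_choose {n : ℕ} (hn : 4 ≤ n) : (n : ℝ) ^ 3 ≤ 24 * (n.choose 3 : ℝ) := by
  obtain ⟨d, rfl⟩ := Nat.exists_eq_add_of_le hn
  have h : (4 + d).choose 3 * 6 = (4 + d) * (3 + d) * (2 + d) := by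
    have := Nat.descFactorial_eq_factorial_mul_choose (4 + d) 3
    simp only [Nat.descFactorial_succ, Nat.descFactorial_zero, Nat.factorial] at this
    have e1 : 4 + d - 2 = 2 + d := by omega
    have e2 : 4 + d - 1 = 3 + d := by omega
    rw [e1, e2] at this
    simp only [Nat.sub_zero] at this
    nlinarith
  have h' : ((4 + d).choose 3 : ℝ) * 6 = (4 + d) * (3 + d) * (2 + d) := by exact_mod_cast h
  push_cast
  have hd : (0 : ℝ) ≤ d := Nat.cast_nonneg d
  nlinarith [mul_nonneg hd hd, mul_nonneg hd (mul_nonneg hd hd)]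

/-- The fraction of the instances with `n` variables and `Δ n` constraints that are in `E n`. -/
noncomputable def density (Δ : ℕ) (E : ∀ n, Set (XorInstance n (Δ * n))) (n : ℕ) : ℝ :=
  ((E n).ncard : ℝ) / ((n.choose 3 * 2 : ℕ) : ℝ) ^ (Δ * n)

theorem total_pos {n : ℕ} (hn : 4 ≤ n) (m : ℕ) : (0 : ℝ) < ((n.choose 3 * 2 : ℕ) : ℝ) ^ m := by
  have : 0 < n.choose 3 := Nat.choose_pos (by omega)
  positivity

theorem density_nonneg (Δ : ℕ) (E : ∀ n, Set (XorInstance n (Δ * n))) (n : ℕ) :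
    0 ≤ density Δ E n := by
  unfold density
  positivity

theorem tendsto_density_not_isSimple (Δ : ℕ) :
    Tendsto (density Δ fun _ => {C | ¬ IsSimple C}) atTop (𝓝 0) := by
  have hlim : Tendsto (fun n : ℕ => (24 * Δ ^ 2 : ℝ) / n) atTop (𝓝 0) :=
    tendsto_const_div_atTop_nhds_zero_nat _
  refine tendsto_of_tendsto_of_tendsto_of_le_of_le' tendsto_const_nhds hlim
    (Eventually.of_forall fun n => density_nonneg _ _ _) ?_
  filter_upwards [eventually_ge_atTop 4] with n hn
  have hM := total_pos hn (Δ * n)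
  have hn0 : (0 : ℝ) < n := by positivity
  have hN : (0 : ℝ) < n.choose 3 := by
    have : 0 < n.choose 3 := Nat.choose_pos (by omega)
    exact_mod_cast this
  have h := ncard_not_isSimple n (Δ * n)
  have h' : (({C : XorInstance n (Δ * n) | ¬ IsSimple C}.ncard : ℕ) : ℝ) * n.choose 3 ≤
      (Δ * n) ^ 2 * ((n.choose 3 * 2 : ℕ) : ℝ) ^ (Δ * n) := by exact_mod_cast h
  unfold density
  rw [div_le_div_iff₀ hM hn0]
  set M := ((n.choose 3 * 2 : ℕ) : ℝ) ^ (Δ * n)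
  set X := (({C : XorInstance n (Δ * n) | ¬ IsSimple C}.ncard : ℕ) : ℝ)
  have hX : 0 ≤ X := by positivity
  have hc := cube_le_choose hn
  have h3 : X * n * (n : ℝ) ^ 2 ≤ 24 * Δ ^ 2 * M * (n : ℝ) ^ 2 := by
    calc X * n * (n : ℝ) ^ 2 = X * (n : ℝ) ^ 3 := by ring
      _ ≤ X * (24 * n.choose 3) := by gcongr
      _ = 24 * (X * n.choose 3) := by ring
      _ ≤ 24 * ((Δ * n) ^ 2 * M) := by gcongr
      _ = _ := by ring
  exact le_of_mul_le_mul_right h3 (by positivity)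

theorem tendsto_half_pow : Tendsto (fun n : ℕ => (1 / 2 : ℝ) ^ n) atTop (𝓝 0) :=
  tendsto_pow_atTop_nhds_zero_of_lt_one (by norm_num) (by norm_num)

theorem tendsto_density_hasOverlap (Δ : ℕ) :
    Tendsto (density Δ fun n => {C | HasOverlap (3 * n) C}) atTop (𝓝 0) := by
  refine tendsto_of_tendsto_of_tendsto_of_le_of_le' tendsto_const_nhds tendsto_half_pow
    (Eventually.of_forall fun n => density_nonneg _ _ _) ?_
  filter_upwards [eventually_ge_atTop 4,
    eventually_ge_atTop (2 * (Δ ^ 6 * 192 ^ 3))] with n hn hn2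
  have hM := total_pos hn (Δ * n)
  have hn0 : (0 : ℝ) < n := by positivity
  have hN : (0 : ℝ) < n.choose 3 := by
    have : 0 < n.choose 3 := Nat.choose_pos (by omega)
    exact_mod_cast this
  have h := ncard_hasOverlap n (Δ * n) (3 * n)
  have h' : (({C : XorInstance n (Δ * n) | HasOverlap (3 * n) C}.ncard : ℕ) : ℝ) *
      n.choose 3 ^ (3 * n) ≤ n ^ (2 * n) * (Δ * n) ^ (2 * (3 * n)) * 8 ^ (3 * n) *
        ((n.choose 3 * 2 : ℕ) : ℝ) ^ (Δ * n) := by exact_mod_cast h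
  unfold density
  rw [div_le_iff₀ hM]
  set M := ((n.choose 3 * 2 : ℕ) : ℝ) ^ (Δ * n)
  set X := (({C : XorInstance n (Δ * n) | HasOverlap (3 * n) C}.ncard : ℕ) : ℝ)
  have hX : 0 ≤ X := by positivity
  have hc := cube_le_choose hn
  have hn2' : (2 * (Δ ^ 6 * 192 ^ 3) : ℝ) ≤ n := by exact_mod_cast hn2
  have h3 : X * (((n : ℝ) ^ 9) ^ n) ≤ (1 / 2) ^ n * M * (((n : ℝ) ^ 9) ^ n) := by
    calc X * (((n : ℝ) ^ 9) ^ n) = X * ((n : ℝ) ^ 3) ^ (3 * n) := by ring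
      _ ≤ X * (24 * n.choose 3) ^ (3 * n) := by gcongr
      _ = 24 ^ (3 * n) * (X * n.choose 3 ^ (3 * n)) := by rw [mul_pow]; ring
      _ ≤ 24 ^ (3 * n) * (n ^ (2 * n) * (Δ * n) ^ (2 * (3 * n)) * 8 ^ (3 * n) * M) := by gcongr
      _ = ((24 ^ 3) * (n ^ 2 * ((Δ * n) ^ 2) ^ 3 * 8 ^ 3)) ^ n * M := by
        simp only [mul_pow, ← pow_mul]
        ring_nf
      _ = ((2 * (Δ ^ 6 * 192 ^ 3)) * (1 / 2 * (n : ℝ) ^ 8)) ^ n * M := by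
        congr 2
        ring
      _ ≤ ((n : ℝ) * (1 / 2 * (n : ℝ) ^ 8)) ^ n * M := by gcongr
      _ = _ := by
        rw [show (n : ℝ) * (1 / 2 * (n : ℝ) ^ 8) = 1 / 2 * (n : ℝ) ^ 9 by ring, mul_pow]
        ring
  exact le_of_mul_le_mul_right h3 (by positivity)

/-- With `300` constraints per variable, an assignment satisfying four fifths of them is unlikely,
because `2 * 2 ^ 300 < 3 ^ 240`. -/
theorem tendsto_density_exists_sat :
    Tendsto (density 300 fun n => {C | ∃ τ, 240 * n ≤ {i | Sat τ (C i)}.ncard}) atTop (𝓝 0) := by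
  refine tendsto_of_tendsto_of_tendsto_of_le_of_le' tendsto_const_nhds tendsto_half_pow
    (Eventually.of_forall fun n => density_nonneg _ _ _) ?_
  filter_upwards [eventually_ge_atTop 4] with n hn
  have hM := total_pos hn (300 * n)
  have h := ncard_exists_sat n (300 * n) (240 * n)
  have h' : (({C : XorInstance n (300 * n) |
      ∃ τ, 240 * n ≤ {i | Sat τ (C i)}.ncard}.ncard : ℕ) : ℝ) * 3 ^ (240 * n) ≤
        2 ^ n * ((n.choose 3 * 4 : ℕ) : ℝ) ^ (300 * n) := by exact_mod_cast h
  unfold density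
  rw [div_le_iff₀ hM]
  have h4 : ((n.choose 3 * 4 : ℕ) : ℝ) = 2 * ((n.choose 3 * 2 : ℕ) : ℝ) := by
    push_cast
    ring
  rw [h4, mul_pow] at h'
  set M := ((n.choose 3 * 2 : ℕ) : ℝ) ^ (300 * n)
  set X := (({C : XorInstance n (300 * n) |
    ∃ τ, 240 * n ≤ {i | Sat τ (C i)}.ncard}.ncard : ℕ) : ℝ)
  have h3 : X * (3 ^ 240) ^ n ≤ (1 / 2) ^ n * M * (3 ^ 240) ^ n := by
    calc X * (3 ^ 240) ^ n = X * 3 ^ (240 * n) := by rw [pow_mul]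
      _ ≤ 2 ^ n * (2 ^ (300 * n) * M) := h'
      _ = (2 * (2 ^ 5) ^ 60) ^ n * M := by
        rw [show 300 * n = 5 * (60 * n) by ring, pow_mul, pow_mul, mul_pow, mul_assoc]
      _ ≤ (1 / 2 * 3 ^ 240) ^ n * M := by
        have h5 : (3 : ℝ) ^ 240 = (3 ^ 4) ^ 60 := pow_mul 3 4 60
        rw [h5]
        gcongr ?_ ^ n * M
        norm_num
      _ = _ := by rw [mul_pow]; ring
  exact le_of_mul_le_mul_right h3 (by positivity)

/-- If the program answers `1` on every simple instance with many variables outside of a set of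
density tending to zero, then it answers `1` on almost all instances. -/
theorem typicalOnAlmostAll_of_density {Δ : ℕ} {B : Prog}
    {E : ∀ n, Set (XorInstance n (Δ * n))} (hE : Tendsto (density Δ E) atTop (𝓝 0))
    (hB : ∀ᶠ n in atTop, ∀ C : XorInstance n (Δ * n), C ∉ E n → AnswersOne B (encodeXor C)) :
    TypicalOnAlmostAll B Δ := by
  have h0 := tendsto_density_not_isSimple Δ
  have hlim : Tendsto (fun n => 1 - density Δ E n / (1 - density Δ (fun _ => {C | ¬ IsSimple C}) n))
      atTop (𝓝 1) := by
    have := (tendsto_const_nhds (x := (1 : ℝ))).sub (hE.div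
      ((tendsto_const_nhds (x := (1 : ℝ))).sub h0) (by norm_num))
    simpa using this
  refine tendsto_of_tendsto_of_tendsto_of_le_of_le' hlim tendsto_const_nhds ?_ ?_
  · filter_upwards [eventually_ge_atTop 4, hB, h0.eventually_lt_const one_pos] with n hn hBn hlt
    have hM := total_pos hn (Δ * n)
    set s : Set (XorInstance n (Δ * n)) := {C | IsSimple C}
    have htot : Nat.card (XorInstance n (Δ * n)) = (n.choose 3 * 2) ^ (Δ * n) := by
      simp [Nat.card_eq_fintype_card]
    have hs : (s.ncard : ℝ) + ({C : XorInstance n (Δ * n) | ¬ IsSimple C}.ncard : ℝ) =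
        ((n.choose 3 * 2 : ℕ) : ℝ) ^ (Δ * n) := by
      have := Set.ncard_add_ncard_compl s
      rw [htot] at this
      exact_mod_cast this
    have hle : s.ncard ≤ {C : XorInstance n (Δ * n) | IsSimple C ∧ AnswersOne B (encodeXor C)}.ncard + (E n).ncard := by
      refine (Set.ncard_le_ncard ?_ (Set.toFinite _)).trans (Set.ncard_union_le _ _)
      intro C hC
      by_cases hCE : C ∈ E n
      · exact Or.inr hCE
      · exact Or.inl ⟨hC, hBn C hCE⟩
    have hle' : (s.ncard : ℝ) ≤
        ({C : XorInstance n (Δ * n) | IsSimple C ∧ AnswersOne B (encodeXor C)}.ncard : ℝ) +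
          ((E n).ncard : ℝ) := by
      exact_mod_cast hle
    unfold density at hlt ⊢
    set M := ((n.choose 3 * 2 : ℕ) : ℝ) ^ (Δ * n)
    have h1 : 1 - ({C : XorInstance n (Δ * n) | ¬ IsSimple C}.ncard : ℝ) / M = s.ncard / M := by
      rw [eq_sub_of_add_eq' hs, sub_div, div_self hM.ne', sub_sub_cancel]
    have hspos : (0 : ℝ) < s.ncard := by
      have : 0 < (s.ncard : ℝ) / M := by rw [← h1]; linarith
      exact (div_pos_iff_of_pos_right hM).1 this
    rw [h1, div_div_div_cancel_right₀ hM.ne', le_div_iff₀ hspos, sub_mul,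
      div_mul_cancel₀ _ hspos.ne']
    linarith
  · refine Eventually.of_forall fun n => div_le_one_of_le₀ ?_ (by positivity)
    have hsub : {C : XorInstance n (Δ * n) | IsSimple C ∧ AnswersOne B (encodeXor C)} ⊆
      {C | IsSimple C} := fun C hC => hC.1
    exact_mod_cast Set.ncard_le_ncard hsub (Set.toFinite _)

theorem density_union_le (Δ : ℕ) (E F : ∀ n, Set (XorInstance n (Δ * n))) (n : ℕ) :
    density Δ (fun n => E n ∪ F n) n ≤ density Δ E n + density Δ F n := by
  unfold density
  rw [← add_div]
  gcongr
  exact_mod_cast Set.ncard_union_le _ _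

theorem tendsto_density_union {Δ : ℕ} {E F : ∀ n, Set (XorInstance n (Δ * n))}
    (hE : Tendsto (density Δ E) atTop (𝓝 0)) (hF : Tendsto (density Δ F) atTop (𝓝 0)) :
    Tendsto (density Δ fun n => E n ∪ F n) atTop (𝓝 0) :=
  squeeze_zero (density_nonneg _ _) (density_union_le _ _ _) (by simpa using hE.add hF)

/-! ### Graphs given by edge lists -/

theorem card_edges_filter {n : ℕ} {l : List (Fin n × Fin n)} {G : SimpleGraph (Fin n)}
    (h : IsEdgeList l G) (P : Sym2 (Fin n) → Prop) [DecidablePred P] :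
    {e ∈ G.edgeSet | P e}.ncard = (l.toFinset.filter fun p => P s(p.1, p.2)).card := by
  have himg : {e ∈ G.edgeSet | P e} = (fun p : Fin n × Fin n => s(p.1, p.2)) ''
      ((l.toFinset.filter fun p => P s(p.1, p.2) : Finset _) : Set (Fin n × Fin n)) := by
    ext e
    induction e with | _ u v
    simp only [Set.mem_ofPred_eq, SimpleGraph.mem_edgeSet, Finset.coe_filter, List.mem_toFinset,
      Set.mem_image, Prod.exists]
    constructor
    · rintro ⟨ha, hP⟩
      rcases lt_or_gt_of_ne ha.ne with huv | huv
      · exact ⟨u, v, ⟨(h.2 u v).2 ⟨ha, huv⟩, hP⟩, rfl⟩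
      · exact ⟨v, u, ⟨(h.2 v u).2 ⟨ha.symm, huv⟩, by rwa [Sym2.eq_swap]⟩, Sym2.eq_swap⟩
    · rintro ⟨a, b, ⟨hab, hP⟩, he⟩
      rw [← he]
      refine ⟨?_, hP⟩
      have := ((h.2 a b).1 hab).1
      rw [← SimpleGraph.mem_edgeSet, he] at this
      simpa using this
  rw [himg, Set.InjOn.ncard_image, Set.ncard_coe_finset]
  rintro ⟨a, b⟩ hab ⟨c, d⟩ hcd he
  simp only [Finset.coe_filter, List.mem_toFinset, Set.mem_ofPred_eq] at hab hcd
  have h1 := ((h.2 a b).1 hab.1).2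
  have h2 := ((h.2 c d).1 hcd.1).2
  rcases Sym2.eq_iff.1 he with ⟨rfl, rfl⟩ | ⟨rfl, rfl⟩
  · rfl
  · exact absurd h1 (lt_asymm h2)

theorem ncard_edgeSet {n : ℕ} {l : List (Fin n × Fin n)} {G : SimpleGraph (Fin n)}
    (h : IsEdgeList l G) : G.edgeSet.ncard = l.length := by
  have := card_edges_filter h fun _ => True
  simpa [List.toFinset_card_of_nodup h.1] using this

/-- The number of edges in the list `l` that are mapped to edges of `H` by `π`. -/
noncomputable def preserved {n : ℕ} (l : List (Fin n × Fin n)) (H : SimpleGraph (Fin n))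
    (π : Fin n → Fin n) : ℕ :=
  {p | p ∈ l ∧ H.Adj (π p.1) (π p.2)}.ncard

theorem isApproxIso_iff {n : ℕ} {lG lH : List (Fin n × Fin n)} {G H : SimpleGraph (Fin n)}
    (hG : IsEdgeList lG G) (hH : IsEdgeList lH H) (hlen : lG.length = lH.length)
    (hpos : 0 < lG.length) (α : ℝ) (π : Fin n ≃ Fin n) :
    IsApproxIso α G H π ↔ α * lG.length ≤ preserved lG H π := by
  classical
  have h1 : {e ∈ G.edgeSet | e.map π ∈ H.edgeSet}.ncard = preserved lG H π := by
    rw [card_edges_filter hG, preserved, ← Set.ncard_coe_finset]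
    congr 1
    ext p
    simp
  rw [IsApproxIso, h1, ncard_edgeSet hG, ncard_edgeSet hH, ← hlen, max_self, le_div_iff₀]
  exact_mod_cast hpos

/-! ### The graph of a system of equations -/

/-- The vertices of the graph of `m` equations in `n` variables: the literals `x^0` and `x^1`, four
vertices `c(i, p, q)` for the `i`-th equation, and `n` further vertices, of which the first is the
hub and the others are isolated. -/
abbrev Vtx (n m : ℕ) : Type := (Fin n × ZMod 2) ⊕ (Fin m × (ZMod 2 × ZMod 2)) ⊕ Fin n

/-- A set of three variables. -/
abbrev Tri (n : ℕ) : Type := {T : Finset (Fin n) // T.card = 3}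

/-- The solutions of `x + y + z = b`, parametrized by the values of `x` and `y`. -/
def bits (b : ZMod 2) (p : ZMod 2 × ZMod 2) : Fin 3 → ZMod 2 := ![p.1, p.2, p.1 + p.2 + b]

section Gadget

variable {n m : ℕ}

/-- The three literals adjacent to `c(i, p, q)`: those that are true in the solution of the `i`-th
equation that assigns `p` and `q` to the first two variables. -/
def lits (T : Fin m → Tri n) (b : Fin m → ZMod 2) (c : Fin m × (ZMod 2 × ZMod 2)) (a : Fin 3) :
    Fin n × ZMod 2 :=
  (var (T c.1) a, bits (b c.1) c.2 a)

theorem lits_injective (T : Fin m → Tri n) (b : Fin m → ZMod 2)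
    (c : Fin m × (ZMod 2 × ZMod 2)) : Function.Injective (lits T b c) :=
  fun _ _ h => var_injective _ (congrArg Prod.fst h)

/-- The map on literals induced by `π` (with a junk value for literals that are not mapped to
literals). -/
def litMap (π : Vtx n m ≃ Vtx n m) (l : Fin n × ZMod 2) : Fin n × ZMod 2 :=
  match π (.inl l) with
  | .inl l' => l'
  | .inr _ => l

theorem litMap_eq {π : Vtx n m ≃ Vtx n m} {l l' : Fin n × ZMod 2} (h : π (.inl l) = .inl l') : litMap π l = l' := by
  rw [litMap, h]

/-- The bijection given by an assignment `τ`: it adds `τ x` to the signs of the literals of `x`, and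
changes the vertices of the constraints accordingly. -/
def shift (T : Fin m → Tri n) (τ : Fin n → ZMod 2) : Vtx n m → Vtx n m
  | .inl (x, s) => .inl (x, s + τ x)
  | .inr (.inl (i, p)) => .inr (.inl (i, (p.1 + τ (var (T i) 0), p.2 + τ (var (T i) 1))))
  | .inr (.inr k) => .inr (.inr k)

theorem shift_involutive (T : Fin m → Tri n) (τ : Fin n → ZMod 2) :
    Function.Involutive (shift T τ) := by
  rintro (⟨x, s⟩ | ⟨i, p⟩ | k) <;> simp [shift, add_assoc, CharTwo.add_self_eq_zero]

variable [NeZero n]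

/-- The hub, which is adjacent to all vertices `c(i, p, q)`. -/
abbrev hub : Vtx n m := .inr (.inr 0)

/-- The four neighbours of `c(i, p, q)`. -/
def nb (T : Fin m → Tri n) (b : Fin m → ZMod 2) (c : Fin m × (ZMod 2 × ZMod 2)) :
    Option (Fin 3) → Vtx n m
  | some a => .inl (lits T b c a)
  | none => hub

theorem nb_injective (T : Fin m → Tri n) (b : Fin m → ZMod 2)
    (c : Fin m × (ZMod 2 × ZMod 2)) : Function.Injective (nb T b c) := by
  rintro (_ | a) (_ | a') h
  · rfl
  · simp [nb] at h
  · simp [nb] at h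
  · rw [lits_injective T b c (Sum.inl_injective h)]

theorem nb_ne_con (T : Fin m → Tri n) (b : Fin m → ZMod 2)
    (c c' : Fin m × (ZMod 2 × ZMod 2)) (o : Option (Fin 3)) : nb T b c o ≠ .inr (.inl c') := by
  rcases o with _ | a <;> simp [nb]

/-- The graph of the system of equations with the sets of variables `T i` and the right-hand sides
`b i`. -/
def sysGraph (T : Fin m → Tri n) (b : Fin m → ZMod 2) : SimpleGraph (Vtx n m) where
  Adj u v := ∃ c o, (u = .inr (.inl c) ∧ v = nb T b c o) ∨ (v = .inr (.inl c) ∧ u = nb T b c o)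
  symm := ⟨by
    rintro u v ⟨c, o, h⟩
    exact ⟨c, o, h.symm⟩⟩
  loopless := ⟨by
    rintro u ⟨c, o, ⟨h, h'⟩ | ⟨h, h'⟩⟩ <;> exact nb_ne_con T b c c o (h'.symm.trans h)⟩

theorem adj_nb (T : Fin m → Tri n) (b : Fin m → ZMod 2) (c : Fin m × (ZMod 2 × ZMod 2))
    (o : Option (Fin 3)) : (sysGraph T b).Adj (.inr (.inl c)) (nb T b c o) :=
  ⟨c, o, .inl ⟨rfl, rfl⟩⟩

theorem adj_con_iff {T : Fin m → Tri n} {b : Fin m → ZMod 2} {c : Fin m × (ZMod 2 × ZMod 2)}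
    {v : Vtx n m} : (sysGraph T b).Adj (.inr (.inl c)) v ↔ ∃ o, v = nb T b c o := by
  constructor
  · rintro ⟨c', o, ⟨h, h'⟩ | ⟨h, h'⟩⟩
    · obtain rfl : c = c' := by simpa using h
      exact ⟨o, h'⟩
    · exact absurd h'.symm (nb_ne_con T b c' c o)
  · rintro ⟨o, rfl⟩
    exact adj_nb T b c o

theorem exists_con_of_adj {T : Fin m → Tri n} {b : Fin m → ZMod 2} {u v : Vtx n m}
    (h : (sysGraph T b).Adj u v) (hv : ∀ c, v ≠ .inr (.inl c)) :
    ∃ c o, u = .inr (.inl c) ∧ v = nb T b c o := by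
  obtain ⟨c, o, h | ⟨h, h'⟩⟩ := h
  · exact ⟨c, o, h⟩
  · exact absurd h (hv c)

theorem card_bits_eq : ∀ (b s : ZMod 2) (a : Fin 3),
    (Finset.univ.filter fun p => bits b p a = s).card ≤ 2 := by
  decide

/-- Apart from the hub, all vertices have a degree of at most `2 m + 4`. -/
theorem exists_neighbors (T : Fin m → Tri n) (b : Fin m → ZMod 2) {v : Vtx n m} (hv : v ≠ hub) :
    ∃ F : Finset (Vtx n m), (∀ u, (sysGraph T b).Adj u v → u ∈ F) ∧ F.card ≤ 2 * m + 4 := by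
  classical
  rcases v with ⟨x, s⟩ | c | k
  · let S : Finset (Fin m × (ZMod 2 × ZMod 2)) := Finset.univ.filter fun c =>
      ∃ a, lits T b c a = (x, s)
    refine ⟨S.image fun c => .inr (.inl c), ?_, ?_⟩
    · intro u hu
      obtain ⟨c, o, rfl, h⟩ := exists_con_of_adj hu (by simp)
      rcases o with _ | a
      · simp [nb] at h
      · simp only [nb, Sum.inl.injEq] at h
        simpa [S] using ⟨a, h.symm⟩
    · refine Finset.card_image_le.trans ?_
      have h1 : S.card ≤ 2 * (S.image Prod.fst).card := by
        refine Finset.card_le_mul_card_image S 2 fun j _ => ?_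
        by_cases hx : ∃ a, var (T j) a = x
        · obtain ⟨a, ha⟩ := hx
          refine le_trans ?_ (card_bits_eq (b j) s a)
          refine Finset.card_le_card_of_injOn Prod.snd ?_ ?_
          · rintro ⟨j', p⟩ hp
            simp only [S, lits, Finset.coe_filter, Finset.mem_filter, Finset.mem_univ, true_and,
              Set.mem_ofPred_eq, Prod.mk.injEq] at hp ⊢
            obtain ⟨⟨a', h1, h2⟩, rfl⟩ := hp
            rwa [var_injective _ (ha.trans h1.symm)]
          · rintro ⟨j', p⟩ hp ⟨j'', p'⟩ hp' h
            simp only [Finset.coe_filter, Set.mem_ofPred_eq] at hp hp'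
            exact Prod.ext (hp.2.trans hp'.2.symm) h
        · rw [Finset.card_eq_zero.2]
          · omega
          · rw [Finset.eq_empty_iff_forall_notMem]
            rintro ⟨j', p⟩ hp
            simp only [S, lits, Finset.mem_filter, Finset.mem_univ, true_and,
              Prod.mk.injEq] at hp
            obtain ⟨⟨a', h1, h2⟩, rfl⟩ := hp
            exact hx ⟨a', h1⟩
      have h2 : (S.image Prod.fst).card ≤ m := by
        simpa using Finset.card_le_univ (S.image Prod.fst)
      omega
  · refine ⟨Finset.univ.image (nb T b c), ?_, ?_⟩
    · intro u hu
      obtain ⟨o, rfl⟩ := adj_con_iff.1 hu.symm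
      simp
    · refine Finset.card_image_le.trans ?_
      simp
  · refine ⟨∅, ?_, by simp⟩
    intro u hu
    obtain ⟨c, o, -, h⟩ := exists_con_of_adj hu (by simp)
    rcases o with _ | a
    · exact absurd h hv
    · simp [nb] at h

/-! ### Soundness -/

/-- The constraint `i` is respected by `π` if all of its sixteen edges are mapped to edges of the
graph of the homogeneous system. -/
def Respects (T : Fin m → Tri n) (b : Fin m → ZMod 2) (π : Vtx n m ≃ Vtx n m) (i : Fin m) : Prop :=
  ∀ p o, (sysGraph T 0).Adj (π (.inr (.inl (i, p)))) (π (nb T b (i, p) o))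

variable {T : Fin m → Tri n} {b : Fin m → ZMod 2} {π : Vtx n m ≃ Vtx n m}

theorem map_hub {D : Finset (Fin m)} (hD : ∀ i ∈ D, Respects T b π i)
    (hcard : 2 * m + 4 < 4 * D.card) : π hub = hub := by
  classical
  by_contra hne
  obtain ⟨F, hF, hFcard⟩ := exists_neighbors T 0 hne
  have : (D ×ˢ (Finset.univ : Finset (ZMod 2 × ZMod 2))).card ≤ F.card := by
    refine Finset.card_le_card_of_injOn (fun c => π (.inr (.inl c))) ?_ ?_
    · rintro ⟨i, p⟩ hi
      simp only [Finset.coe_product, Set.mem_prod, Finset.mem_coe] at hi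
      exact hF _ (hD i hi.1 p none)
    · intro c _ c' _ h
      simpa using h
  rw [Finset.card_product, Finset.card_univ] at this
  simp at this
  omega

theorem map_con (hhub : π hub = hub) {i : Fin m} (hi : Respects T b π i) (p : ZMod 2 × ZMod 2) :
    ∃ c, π (.inr (.inl (i, p))) = .inr (.inl c) := by
  have h := hi p none
  simp only [nb, hhub] at h
  obtain ⟨c, -, h, -⟩ := exists_con_of_adj h (by simp)
  exact ⟨c, h⟩

theorem map_lits (hhub : π hub = hub) {i : Fin m} (hi : Respects T b π i) {p : ZMod 2 × ZMod 2}
    {c : Fin m × (ZMod 2 × ZMod 2)} (hc : π (.inr (.inl (i, p))) = .inr (.inl c)) (a : Fin 3) :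
    ∃ a', π (.inl (lits T b (i, p) a)) = .inl (lits T 0 c a') := by
  have h := hi p (some a)
  rw [hc] at h
  obtain ⟨_ | a', h⟩ := adj_con_iff.1 h
  · exact absurd (π.injective (h.trans hhub.symm)) (by simp [nb])
  · exact ⟨a', h⟩

theorem exists_perm_lits (hhub : π hub = hub) {i : Fin m} (hi : Respects T b π i)
    {p : ZMod 2 × ZMod 2} {c : Fin m × (ZMod 2 × ZMod 2)}
    (hc : π (.inr (.inl (i, p))) = .inr (.inl c)) :
    ∃ σ : Fin 3 ≃ Fin 3, ∀ a, π (.inl (lits T b (i, p) a)) = .inl (lits T 0 c (σ a)) := by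
  choose σ hσ using map_lits hhub hi hc
  have hinj : Function.Injective σ := by
    intro a a' h
    apply lits_injective T b (i, p)
    apply Sum.inl_injective (β := (Fin m × (ZMod 2 × ZMod 2)) ⊕ Fin n)
    apply π.injective
    rw [hσ, hσ, h]
  exact ⟨Equiv.ofBijective σ (Finite.injective_iff_bijective.1 hinj), hσ⟩

/-- If `c(i, p)` is mapped to a vertex of the constraint `c.1`, then the variables of that constraint
are determined by those of the constraint `i` and the map on literals. -/
theorem image_litMap (hhub : π hub = hub) {i : Fin m} (hi : Respects T b π i)
    {p : ZMod 2 × ZMod 2} {c : Fin m × (ZMod 2 × ZMod 2)}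
    (hc : π (.inr (.inl (i, p))) = .inr (.inl c)) :
    (T c.1).1 = Finset.univ.image fun a => (litMap π (lits T b (i, p) a)).1 := by
  classical
  obtain ⟨σ, hσ⟩ := exists_perm_lits hhub hi hc
  have : (fun a => (litMap π (lits T b (i, p) a)).1) = var (T c.1) ∘ σ := by
    funext a
    rw [litMap_eq (hσ a)]
    rfl
  rw [this, ← Finset.image_image, Finset.image_univ_equiv, image_var]

theorem sum_bits : ∀ p : ZMod 2 × ZMod 2, ∑ a, bits 0 p a = 0 := by decide

/-- The true literals of a solution are mapped to those of a solution of a homogeneous equation, so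
their signs add up to zero. -/
theorem sum_litMap (hhub : π hub = hub) {i : Fin m} (hi : Respects T b π i)
    {p : ZMod 2 × ZMod 2} {c : Fin m × (ZMod 2 × ZMod 2)}
    (hc : π (.inr (.inl (i, p))) = .inr (.inl c)) :
    ∑ a, (litMap π (lits T b (i, p) a)).2 = 0 := by
  obtain ⟨σ, hσ⟩ := exists_perm_lits hhub hi hc
  have : ∀ a, (litMap π (lits T b (i, p) a)).2 = bits 0 c.2 (σ a) := by
    intro a
    rw [litMap_eq (hσ a)]
    rfl
  simp only [this]
  rw [Equiv.sum_comp σ (bits 0 c.2), sum_bits]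

theorem parity_aux {b x x' y y' z z' : ZMod 2} (h : x + x' + (y + y') + (z + z') = 1)
    (h0 : b = 0 → x + y + z = 0)
    (h1 : b = 1 → x + y + z' = 0 ∧ x + y' + z = 0 ∧ x' + y + z = 0) : x + y + z = b := by
  have hb : ∀ b : ZMod 2, b = 0 ∨ b = 1 := by decide
  have h2 : (2 : ZMod 2) = 0 := by decide
  rcases hb b with rfl | rfl
  · exact h0 rfl
  · obtain ⟨e1, e2, e3⟩ := h1 rfl
    linear_combination h - e1 - e2 - e3 + (x + y + z) * h2

/-- If the four vertices of a respected constraint are permuted by `π`, then so are its six literals,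
and the literals `x^0` are mapped to literals whose signs satisfy the constraint. -/
theorem sum_litMap_eq_rhs (hhub : π hub = hub) {i : Fin m} (hi : Respects T b π i)
    (hself : ∀ p c, π (.inr (.inl (i, p))) = .inr (.inl c) → c.1 = i) :
    ∑ a, (litMap π (var (T i) a, 0)).2 = b i := by
  have hlit : ∀ y : Fin 3 × ZMod 2, ∃ p, (var (T i) y.1, y.2) = lits T b (i, p) y.1 := by
    rintro ⟨a, s⟩
    have : ∀ (b s : ZMod 2) (a : Fin 3), ∃ p, s = bits b p a := by decide
    obtain ⟨p, hp⟩ := this (b i) s a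
    exact ⟨p, by simp [lits, ← hp]⟩
  have hex : ∀ y : Fin 3 × ZMod 2, ∃ y' : Fin 3 × ZMod 2,
      π (.inl (var (T i) y.1, y.2)) = .inl (var (T i) y'.1, y'.2) := by
    intro y
    obtain ⟨p, hp⟩ := hlit y
    obtain ⟨⟨j, p'⟩, hc⟩ := map_con hhub hi p
    obtain rfl : j = i := hself p _ hc
    obtain ⟨a', ha'⟩ := map_lits hhub hi hc y.1
    exact ⟨(a', bits 0 p' a'), by rw [hp, ha']; rfl⟩
  choose h hh using hex
  have hinj : Function.Injective h := by
    intro y y' e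
    have h1 := hh y
    rw [e, ← hh y', π.injective.eq_iff, Sum.inl.injEq, Prod.mk.injEq] at h1
    exact Prod.ext (var_injective _ h1.1) h1.2
  have hsum : ∑ y, (h y).2 = 1 := by
    have h1 := Equiv.sum_comp (Equiv.ofBijective h (Finite.injective_iff_bijective.1 hinj))
      fun y : Fin 3 × ZMod 2 => y.2
    have h2 : ∑ y : Fin 3 × ZMod 2, y.2 = 1 := by decide
    rw [← h2, ← h1]
    rfl
  have hval : ∀ a s, (litMap π (var (T i) a, s)).2 = (h (a, s)).2 := by
    intro a s
    rw [litMap_eq (hh (a, s))]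
  have hcon : ∀ p : ZMod 2 × ZMod 2, (h (0, p.1)).2 + (h (1, p.2)).2 +
      (h (2, p.1 + p.2 + b i)).2 = 0 := by
    intro p
    obtain ⟨c, hc⟩ := map_con hhub hi p
    have := sum_litMap hhub hi hc
    rw [Fin.sum_univ_three] at this
    simpa [lits, bits, hval] using this
  rw [Fin.sum_univ_three, hval, hval, hval]
  have hsum2 : ∀ f : ZMod 2 → ZMod 2, ∑ y, f y = f 0 + f 1 := fun f => Fin.sum_univ_two f
  rw [Fintype.sum_prod_type, Fin.sum_univ_three, hsum2, hsum2, hsum2] at hsum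
  refine parity_aux hsum ?_ ?_
  · intro hb
    have := hcon (0, 0)
    rw [hb] at this
    simpa using this
  · intro hb
    have h1 := hcon (0, 0)
    have h2 := hcon (0, 1)
    have h3 := hcon (1, 0)
    rw [hb] at h1 h2 h3
    have e : (1 : ZMod 2) + 1 = 0 := by decide
    simp only [add_zero, zero_add, e] at h1 h2 h3
    exact ⟨h1, h2, h3⟩

/-- A greedy choice of a matching in the graph of a function with small fibres. -/
theorem exists_matching {m : ℕ} (S : Finset (Fin m)) (F : Fin m → Fin m)
    (hF : ∀ i ∈ S, F i ≠ i) (hfib : ∀ j, (S.filter fun i => F i = j).card ≤ 4) (k : ℕ)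
    (hk : 10 * k ≤ S.card) :
    ∃ P ⊆ S, P.card = k ∧ Set.InjOn F P ∧ ∀ i ∈ P, ∀ i' ∈ P, F i ≠ i' := by
  induction k with
  | zero => exact ⟨∅, by simp⟩
  | succ k ih =>
    obtain ⟨P, hPS, hP, hinj, hne⟩ := ih (by omega)
    let Q := P ∪ P.image F
    let X := Q ∪ Q.biUnion fun j => S.filter fun i => F i = j
    have hQ : Q.card ≤ 2 * k := by
      have h1 : Q.card ≤ _ := Finset.card_union_le P (P.image F)
      have h2 : (P.image F).card ≤ P.card := Finset.card_image_le
      omega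
    have hX : X.card ≤ 10 * k := by
      have h1 : X.card ≤ _ := Finset.card_union_le Q (Q.biUnion fun j => S.filter fun i => F i = j)
      have h2 := Finset.card_biUnion_le_card_mul Q (fun j => S.filter fun i => F i = j) 4
        fun j _ => hfib j
      omega
    obtain ⟨i, hiS, hiX⟩ := Finset.exists_mem_notMem_of_card_lt_card
      (show X.card < S.card by omega)
    have hiQ : i ∉ Q := fun h => hiX (Finset.mem_union_left _ h)
    have hFiQ : F i ∉ Q := fun h => hiX (Finset.mem_union_right _
      (Finset.mem_biUnion.2 ⟨F i, h, Finset.mem_filter.2 ⟨hiS, rfl⟩⟩))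
    have hiP : i ∉ P := fun h => hiQ (Finset.mem_union_left _ h)
    have hFiP : F i ∉ P := fun h => hFiQ (Finset.mem_union_left _ h)
    have hiF : ∀ j ∈ P, F j ≠ i := fun j hj h =>
      hiQ (Finset.mem_union_right _ (Finset.mem_image.2 ⟨j, hj, h⟩))
    have hFiF : ∀ j ∈ P, F j ≠ F i := fun j hj h =>
      hFiQ (Finset.mem_union_right _ (Finset.mem_image.2 ⟨j, hj, h⟩))
    refine ⟨insert i P, Finset.insert_subset hiS hPS, by rw [Finset.card_insert_of_notMem hiP, hP],
      ?_, ?_⟩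
    · rw [Finset.coe_insert]
      refine (Set.injOn_insert (by simpa using hiP)).2 ⟨hinj, ?_⟩
      rintro ⟨j, hj, h⟩
      exact hFiF j hj h
    · intro j hj j' hj'
      rcases Finset.mem_insert.1 hj with rfl | hjP <;> rcases Finset.mem_insert.1 hj' with rfl | hjP'
      · exact hF _ hiS
      · rintro rfl
        exact hFiP hjP'
      · exact hiF j hjP
      · exact hne j hjP j' hjP'

/-- A bijection that respects fifteen out of sixteen constraints yields an assignment satisfying many
constraints, or else many constraints whose variables come from those of other constraints through a
single map on the literals. -/
theorem exists_sat_or_hasOverlap (C : XorInstance n (300 * n))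
    (π : Vtx n (300 * n) ≃ Vtx n (300 * n)) {D : Finset (Fin (300 * n))}
    (hD : ∀ i ∈ D, Respects (fun i => (C i).1) (fun i => (C i).2) π i)
    (hcard : 15 * (300 * n) ≤ 16 * D.card) :
    (∃ τ, 240 * n ≤ {i | Sat τ (C i)}.ncard) ∨ HasOverlap (3 * n) C := by
  classical
  have hn : 0 < n := Nat.pos_of_ne_zero (NeZero.ne n)
  have hhub := map_hub hD (by omega)
  have hcon : ∀ i ∈ D, ∀ p, ∃ c, π (.inr (.inl (i, p))) = .inr (.inl c) := fun i hi p =>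
    map_con hhub (hD i hi) p
  let S := D.filter fun i => ∃ p c, π (.inr (.inl (i, p))) = .inr (.inl c) ∧ c.1 ≠ i
  rcases le_or_gt (30 * n) S.card with hS | hS
  · right
    have hmem : ∀ i : Fin (300 * n), ∃ p c, i ∈ S →
        π (.inr (.inl (i, p))) = .inr (.inl c) ∧ c.1 ≠ i := by
      intro i
      by_cases hi : i ∈ S
      · obtain ⟨p, c, h⟩ := (Finset.mem_filter.1 hi).2
        exact ⟨p, c, fun _ => h⟩
      · exact ⟨0, (i, 0), fun h => absurd h hi⟩
    choose p c hpc using hmem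
    obtain ⟨P, hPS, hP, hinj, hne⟩ := exists_matching S (fun i => (c i).1)
      (fun i hi => (hpc i hi).2) (by
        intro j
        have h4 : (Finset.univ : Finset (ZMod 2 × ZMod 2)).card = 4 := by decide
        rw [← h4]
        refine Finset.card_le_card_of_injOn (fun i => (c i).2) (by simp [Set.MapsTo]) ?_
        intro i hi i' hi' h
        simp only [Finset.coe_filter, Set.mem_ofPred_eq] at hi hi'
        have e : c i = c i' := Prod.ext (hi.2.trans hi'.2.symm) h
        have h1 := (hpc i hi.1).1
        rw [e, ← (hpc i' hi'.1).1, π.injective.eq_iff] at h1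
        simp only [Sum.inr.injEq, Sum.inl.injEq, Prod.mk.injEq] at h1
        exact h1.1) (3 * n) (by omega)
    let e := (P.equivFinOfCardEq hP).symm
    refine ⟨fun l => (litMap π l).1, fun l => (e l : Fin (300 * n)),
      fun l => (c (e l)).1, fun l a => bits (C (e l)).2 (p (e l)) a, ?_, ?_, ?_⟩
    · intro l l' h
      exact e.injective (Subtype.ext (hinj (e l).2 (e l').2 h))
    · intro l l'
      exact hne _ (e l).2 _ (e l').2
    · intro l
      have hl := hPS (e l).2
      exact image_litMap hhub (hD _ (Finset.mem_filter.1 hl).1) (hpc _ hl).1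
  · left
    refine ⟨fun x => (litMap π (x, 0)).2, ?_⟩
    have h1 : (D \ S).card ≤ {i | Sat (fun x => (litMap π (x, 0)).2) (C i)}.ncard := by
      rw [← Set.ncard_coe_finset]
      refine Set.ncard_le_ncard ?_ (Set.toFinite _)
      intro i hi
      simp only [Finset.coe_sdiff, Set.mem_sdiff, Finset.mem_coe] at hi
      have hself : ∀ p c, π (.inr (.inl (i, p))) = .inr (.inl c) → c.1 = i := by
        intro p c hc
        by_contra hne
        exact hi.2 (Finset.mem_filter.2 ⟨hi.1, p, c, hc, hne⟩)
      have := sum_litMap_eq_rhs hhub (hD i hi.1) hself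
      change ∑ x ∈ (C i).1.1, _ = _
      rw [sum_eq_sum_var]
      exact this
    have h2 := Finset.le_card_sdiff S D
    omega

/-! ### Completeness -/

theorem respects_shift {τ : Fin n → ZMod 2} {i : Fin m} (h : Sat τ (T i, b i)) :
    Respects T b (shift_involutive T τ).toPerm i := by
  intro p o
  have hb : b i = τ (var (T i) 0) + τ (var (T i) 1) + τ (var (T i) 2) := by
    rw [← Fin.sum_univ_three fun a => τ (var (T i) a), ← sum_eq_sum_var]
    exact h.symm
  refine ⟨(i, (p.1 + τ (var (T i) 0), p.2 + τ (var (T i) 1))), o, .inl ⟨rfl, ?_⟩⟩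
  rcases o with _ | a
  · rfl
  · simp only [Function.Involutive.coe_toPerm, nb, lits, shift, Sum.inl.injEq, Prod.mk.injEq,
      true_and]
    fin_cases a
    · rfl
    · rfl
    · simp only [bits, hb]
      generalize τ (var (T i) 0) = x
      generalize τ (var (T i) 1) = y
      simp only [Fin.reduceFinMk, Matrix.cons_val, Pi.zero_apply]
      generalize τ (var (T i) 2) = z
      obtain ⟨p, q⟩ := p
      revert p q x y z
      decide

end Gadget

/-! ### The graphs on initial segments of the natural numbers -/

section Coding

variable {n m N : ℕ}

/-- The number of a vertex. The literals come first, and the hub comes after the vertices of the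
constraints, so that every edge leads from a literal to a vertex of a constraint, or from there to the
hub. -/
def code : Vtx n m → ℕ
  | .inl (x, s) => 2 * x + s.val
  | .inr (.inl (i, p)) => 2 * n + 4 * i + 2 * p.1.val + p.2.val
  | .inr (.inr k) => 2 * n + 4 * m + k

theorem code_lt (v : Vtx n m) : code v < 3 * n + 4 * m := by
  rcases v with ⟨x, s⟩ | ⟨i, p, q⟩ | k
  · have := ZMod.val_lt s
    simp only [code]
    omega
  · have := ZMod.val_lt p
    have := ZMod.val_lt q
    simp only [code]
    omega
  · simp only [code]
    omega

theorem code_injective : Function.Injective (code : Vtx n m → ℕ) := by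
  rintro (⟨x, s⟩ | ⟨i, p, q⟩ | k) (⟨x', s'⟩ | ⟨i', p', q'⟩ | k') h <;> simp only [code] at h
  · have := ZMod.val_lt s
    have := ZMod.val_lt s'
    obtain rfl : x = x' := by omega
    obtain rfl : s = s' := ZMod.val_injective 2 (by omega)
    rfl
  · have := ZMod.val_lt s
    omega
  · have := ZMod.val_lt s
    omega
  · have := ZMod.val_lt s'
    omega
  · have := ZMod.val_lt p
    have := ZMod.val_lt q
    have := ZMod.val_lt p'
    have := ZMod.val_lt q'
    obtain rfl : i = i' := by omega
    obtain rfl : p = p' := ZMod.val_injective 2 (by omega)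
    obtain rfl : q = q' := ZMod.val_injective 2 (by omega)
    rfl
  · have := ZMod.val_lt p
    have := ZMod.val_lt q
    omega
  · have := ZMod.val_lt s'
    omega
  · have := ZMod.val_lt p'
    have := ZMod.val_lt q'
    omega
  · obtain rfl : k = k' := by omega
    rfl

/-- The numbering of the vertices as a bijection. -/
noncomputable def codeEquiv (hN : 3 * n + 4 * m = N) : Vtx n m ≃ Fin N :=
  Equiv.ofBijective (fun v => ⟨code v, hN ▸ code_lt v⟩) <| by
    rw [Fintype.bijective_iff_injective_and_card]
    refine ⟨fun v w h => code_injective (Fin.ext_iff.1 h), ?_⟩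
    have : Fintype.card (ZMod 2) = 2 := rfl
    simp only [Fintype.card_sum, Fintype.card_prod, Fintype.card_fin, this]
    omega

theorem codeEquiv_val (hN : 3 * n + 4 * m = N) (v : Vtx n m) : (codeEquiv hN v : ℕ) = code v :=
  rfl

/-- The edges of the graph are indexed by a constraint, one of its four vertices, and one of the four
neighbours of that vertex. -/
abbrev EdgeIdx (m : ℕ) : Type := Fin m × ((ZMod 2 × ZMod 2) × Option (Fin 3))

/-- All indices of edges, in the order of the edge list. -/
def edgeIdxs (m : ℕ) : List (EdgeIdx m) :=
  List.finRange m ×ˢ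
    (([(0, 0), (0, 1), (1, 0), (1, 1)] : List (ZMod 2 × ZMod 2)) ×ˢ
      ([some 0, some 1, some 2, none] : List (Option (Fin 3))))

theorem nodup_edgeIdxs (m : ℕ) : (edgeIdxs m).Nodup :=
  (List.nodup_finRange m).product (by decide)

theorem mem_edgeIdxs (e : EdgeIdx m) : e ∈ edgeIdxs m := by
  obtain ⟨i, e⟩ := e
  refine List.mem_product.2 ⟨List.mem_finRange i, ?_⟩
  revert e
  decide

theorem length_edgeIdxs (m : ℕ) : (edgeIdxs m).length = 16 * m := by
  rw [edgeIdxs, List.length_product, List.length_finRange, mul_comm]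
  rfl

variable [NeZero n]

/-- The edge with a given index, with the end of smaller number first. -/
def edge (T : Fin m → Tri n) (b : Fin m → ZMod 2) (e : EdgeIdx m) : Vtx n m × Vtx n m :=
  match e with
  | (i, p, some a) => (nb T b (i, p) (some a), .inr (.inl (i, p)))
  | (i, p, none) => (.inr (.inl (i, p)), nb T b (i, p) none)

theorem edge_injective (T : Fin m → Tri n) (b : Fin m → ZMod 2) :
    Function.Injective (edge T b) := by
  rintro ⟨i, p, _ | a⟩ ⟨i', p', _ | a'⟩ h
  · simp only [edge, Prod.mk.injEq, Sum.inr.injEq, Sum.inl.injEq] at h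
    obtain ⟨⟨rfl, rfl⟩, -⟩ := h
    rfl
  · simp [edge, nb] at h
  · simp [edge, nb] at h
  · simp only [edge, Prod.mk.injEq, Sum.inr.injEq, Sum.inl.injEq] at h
    obtain ⟨h, rfl, rfl⟩ := h
    rw [Option.some_inj.1 (nb_injective T b _ h)]

theorem code_edge_lt (T : Fin m → Tri n) (b : Fin m → ZMod 2) (e : EdgeIdx m) :
    code (edge T b e).1 < code (edge T b e).2 := by
  rcases e with ⟨i, ⟨p, q⟩, _ | a⟩
  · have := ZMod.val_lt p
    have := ZMod.val_lt q
    simp only [edge, nb, code]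
    omega
  · have := ZMod.val_lt (lits T b (i, p, q) a).2
    have := (lits T b (i, p, q) a).1.isLt
    simp only [edge, nb, code]
    omega

/-- `π` preserves the edge with index `e` if and only if it preserves the edge from `c(i, p)` to the
neighbour in question. -/
theorem adj_edge_iff (G : SimpleGraph (Vtx n m)) (T : Fin m → Tri n) (b : Fin m → ZMod 2)
    (π : Vtx n m → Vtx n m) (e : EdgeIdx m) :
    G.Adj (π (edge T b e).1) (π (edge T b e).2) ↔
      G.Adj (π (.inr (.inl (e.1, e.2.1)))) (π (nb T b (e.1, e.2.1) e.2.2)) := by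
  rcases e with ⟨i, p, _ | a⟩
  · rfl
  · exact G.adj_comm _ _

/-- The graph of the system of equations, on the vertex set `Fin N`. -/
noncomputable def finGraph (hN : 3 * n + 4 * m = N) (T : Fin m → Tri n) (b : Fin m → ZMod 2) :
    SimpleGraph (Fin N) :=
  (sysGraph T b).comap (codeEquiv hN).symm

/-- The edge list of `finGraph`. -/
noncomputable def edgeList (hN : 3 * n + 4 * m = N) (T : Fin m → Tri n) (b : Fin m → ZMod 2) :
    List (Fin N × Fin N) :=
  (edgeIdxs m).map fun e => (codeEquiv hN (edge T b e).1, codeEquiv hN (edge T b e).2)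

theorem length_edgeList (hN : 3 * n + 4 * m = N) (T : Fin m → Tri n) (b : Fin m → ZMod 2) :
    (edgeList hN T b).length = 16 * m := by
  rw [edgeList, List.length_map, length_edgeIdxs]

theorem codeEdge_injective (hN : 3 * n + 4 * m = N) (T : Fin m → Tri n) (b : Fin m → ZMod 2) :
    Function.Injective
      fun e => (codeEquiv hN (edge T b e).1, codeEquiv hN (edge T b e).2) := by
  intro e e' h
  simp only [Prod.mk.injEq, EmbeddingLike.apply_eq_iff_eq] at h
  exact edge_injective T b (Prod.ext h.1 h.2)

theorem isEdgeList_edgeList (hN : 3 * n + 4 * m = N) (T : Fin m → Tri n) (b : Fin m → ZMod 2) :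
    IsEdgeList (edgeList hN T b) (finGraph hN T b) := by
  refine ⟨(nodup_edgeIdxs m).map (codeEdge_injective hN T b), fun u v => ?_⟩
  obtain ⟨u, rfl⟩ := (codeEquiv hN).surjective u
  obtain ⟨v, rfl⟩ := (codeEquiv hN).surjective v
  simp only [edgeList, List.mem_map, Prod.mk.injEq, EmbeddingLike.apply_eq_iff_eq, finGraph,
    SimpleGraph.comap_adj, Equiv.symm_apply_apply, Fin.lt_def, codeEquiv_val]
  constructor
  · rintro ⟨e, -, rfl, rfl⟩
    exact ⟨(adj_edge_iff (sysGraph T b) T b id e).2 (adj_nb T b _ _), code_edge_lt T b e⟩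
  · rintro ⟨⟨⟨i, p⟩, o, h⟩, hlt⟩
    have h1 := code_edge_lt T b (i, p, o)
    refine ⟨(i, p, o), mem_edgeIdxs _, ?_⟩
    rcases o with _ | a <;> rcases h with ⟨rfl, rfl⟩ | ⟨rfl, rfl⟩ <;> simp only [edge] at h1 ⊢
    · simp
    · exact absurd hlt (lt_asymm h1)
    · exact absurd hlt (lt_asymm h1)
    · simp

theorem preserved_edgeList (hN : 3 * n + 4 * m = N) (T : Fin m → Tri n) (b : Fin m → ZMod 2)
    (π : Vtx n m ≃ Vtx n m) :
    preserved (edgeList hN T b) (finGraph hN T 0) ((codeEquiv hN).permCongr π) =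
      {e : EdgeIdx m | (sysGraph T 0).Adj (π (.inr (.inl (e.1, e.2.1))))
        (π (nb T b (e.1, e.2.1) e.2.2))}.ncard := by
  rw [preserved, ← Set.ncard_image_of_injective _ (codeEdge_injective hN T b)]
  congr 1
  ext p
  simp only [edgeList, List.mem_map, finGraph, SimpleGraph.comap_adj, Set.mem_ofPred_eq,
    Set.mem_image]
  constructor
  · rintro ⟨⟨e, -, rfl⟩, h⟩
    refine ⟨e, ?_, rfl⟩
    rw [← adj_edge_iff]
    simpa using h
  · rintro ⟨e, h, rfl⟩
    rw [← adj_edge_iff] at h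
    exact ⟨⟨e, mem_edgeIdxs e, rfl⟩, by simpa using h⟩

/-- An assignment satisfying most constraints yields an approximate isomorphism to the graph of the
homogeneous system. -/
theorem approxIsomorphic_of_xorSatisfiable (hN : 3 * n + 4 * m = N) (hm : 0 < m)
    (C : XorInstance n m) {ε : ℝ} (h : XorSatisfiable (1 - ε) C) :
    ApproxIsomorphic (1 - ε) (finGraph hN (fun i => (C i).1) fun i => (C i).2)
      (finGraph hN (fun i => (C i).1) 0) := by
  obtain ⟨τ, hτ⟩ := h
  obtain ⟨π, hπ⟩ : ∃ π : Vtx n m ≃ Vtx n m, ∀ i, Sat τ (C i) →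
      Respects (fun i => (C i).1) (fun i => (C i).2) π i :=
    ⟨_, fun i hi => respects_shift hi⟩
  refine ⟨(codeEquiv hN).permCongr π, ?_⟩
  rw [isApproxIso_iff (isEdgeList_edgeList hN _ _) (isEdgeList_edgeList hN _ _)
    (by rw [length_edgeList, length_edgeList]) (by rw [length_edgeList]; omega),
    preserved_edgeList, length_edgeList]
  set A : Set (Fin m) := {i | ∑ x ∈ (C i).1.1, τ x = (C i).2} with hA
  have h1 : (A ×ˢ (Set.univ : Set ((ZMod 2 × ZMod 2) × Option (Fin 3)))).ncard = A.ncard * 16 := by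
    rw [Set.ncard_prod, Set.ncard_univ, Nat.card_eq_fintype_card]
    rfl
  have h2 := Set.ncard_le_ncard (s := A ×ˢ (Set.univ : Set ((ZMod 2 × ZMod 2) × Option (Fin 3))))
    (t := {e : EdgeIdx m | (sysGraph (fun i => (C i).1) 0).Adj (π (.inr (.inl (e.1, e.2.1))))
      (π (nb (fun i => (C i).1) (fun i => (C i).2) (e.1, e.2.1) e.2.2))})
    (by
      rintro ⟨i, p, o⟩ hi
      simp only [Set.mem_prod, Set.mem_univ, and_true] at hi
      exact hπ i hi p o) (Set.toFinite _)
  rw [h1] at h2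
  refine le_trans ?_ (Nat.cast_le.2 h2)
  push_cast
  linarith

/-- If few edges are lost, then most constraints are respected, because every edge belongs to one
constraint only. -/
theorem not_approxIsomorphic (hN : 3 * n + 4 * (300 * n) = N) (C : XorInstance n (300 * n))
    (hsat : ¬ ∃ τ, 240 * n ≤ {i | Sat τ (C i)}.ncard) (hover : ¬ HasOverlap (3 * n) C) :
    ¬ ApproxIsomorphic (1 - 1 / 256) (finGraph hN (fun i => (C i).1) fun i => (C i).2)
      (finGraph hN (fun i => (C i).1) 0) := by
  classical
  rintro ⟨π', hπ⟩
  have hn : 0 < n := Nat.pos_of_ne_zero (NeZero.ne n)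
  obtain ⟨π, rfl⟩ := (codeEquiv hN).permCongr.surjective π'
  rw [isApproxIso_iff (isEdgeList_edgeList hN _ _) (isEdgeList_edgeList hN _ _)
    (by rw [length_edgeList, length_edgeList]) (by rw [length_edgeList]; omega),
    preserved_edgeList, length_edgeList] at hπ
  set A := {e : EdgeIdx (300 * n) | (sysGraph (fun i => (C i).1) 0).Adj
    (π (.inr (.inl (e.1, e.2.1))))
    (π (nb (fun i => (C i).1) (fun i => (C i).2) (e.1, e.2.1) e.2.2))} with hA
  have h1 : A.ncard + Aᶜ.ncard = 300 * n * 16 := by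
    rw [Set.ncard_add_ncard_compl, Nat.card_prod, Nat.card_eq_fintype_card, Fintype.card_fin,
      Nat.card_eq_fintype_card]
    rfl
  have h2 : Aᶜ.ncard * 16 ≤ 300 * n := by
    have h1' : (A.ncard : ℝ) + (Aᶜ.ncard : ℝ) = 300 * n * 16 := by exact_mod_cast h1
    push_cast at hπ
    have : (Aᶜ.ncard : ℝ) * 16 ≤ 300 * n := by linarith
    exact_mod_cast this
  let D : Finset (Fin (300 * n)) := Finset.univ.filter fun i =>
    Respects (fun i => (C i).1) (fun i => (C i).2) π i
  have h3 : Dᶜ.card ≤ Aᶜ.ncard := by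
    rw [← Set.ncard_coe_finset]
    refine (Set.ncard_le_ncard (t := Prod.fst '' Aᶜ) ?_ (Set.toFinite _)).trans
      (Set.ncard_image_le (Set.toFinite _))
    intro i hi
    have hi' : ¬ Respects (fun i => (C i).1) (fun i => (C i).2) π i := fun h =>
      Finset.mem_compl.1 (Finset.mem_coe.1 hi) (Finset.mem_filter.2 ⟨Finset.mem_univ _, h⟩)
    simp only [Respects, not_forall] at hi'
    obtain ⟨p, o, h⟩ := hi'
    exact ⟨(i, p, o), h, rfl⟩
  have h4 : D.card + Dᶜ.card = 300 * n := by
    rw [Finset.card_add_card_compl, Fintype.card_fin]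
  rcases exists_sat_or_hasOverlap C π (D := D)
    (fun i hi => (Finset.mem_filter.1 hi).2) (by omega) with h | h
  · exact hsat h
  · exact hover h

end Coding

/-! ### The words of the encodings -/

theorem length_flatMap_const {α β : Type*} (l : List α) (f : α → List β) {k : ℕ}
    (hf : ∀ a, (f a).length = k) : (l.flatMap f).length = k * l.length := by
  induction l with
  | nil => simp
  | cons a l ih => rw [List.flatMap_cons, List.length_append, ih, hf, List.length_cons]; ring

theorem getD_flatMap_const {α β : Type*} (l : List α) (f : α → List β) {k : ℕ}
    (hf : ∀ a, (f a).length = k) (d : β) {j r : ℕ} (hj : j < l.length) (hr : r < k) :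
    (l.flatMap f).getD (k * j + r) d = (f l[j]).getD r d := by
  induction l generalizing j with
  | nil => simp at hj
  | cons a l ih =>
    rw [List.flatMap_cons]
    cases j with
    | zero =>
      rw [List.getD_append _ _ _ _ (by rw [hf]; omega)]
      simp
    | succ j =>
      rw [List.getD_append_right _ _ _ _ (by rw [hf, Nat.mul_succ]; omega), hf,
        show k * (j + 1) + r - k = k * j + r by rw [Nat.mul_succ]; omega,
        ih (by simpa using hj)]
      simp

/-- The words describing the sixteen edges of a constraint, where `x₀, x₁, y₀, y₁` are the numbers of
the literals of the first two variables, `z₀` and `z₁` those of the literals of the third variable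
adjacent to `c(i, 0, 0)` and to `c(i, 0, 1)`, `c` is the number of `c(i, 0, 0)`, and `h` is the
hub. -/
def blockWords (x₀ x₁ y₀ y₁ z₀ z₁ c h : ℕ) : List ℕ :=
  [x₀, c, y₀, c, z₀, c, c, h,
    x₀, c + 1, y₁, c + 1, z₁, c + 1, c + 1, h,
    x₁, c + 2, y₀, c + 2, z₁, c + 2, c + 2, h,
    x₁, c + 3, y₁, c + 3, z₀, c + 3, c + 3, h]

section Words

variable {n m N : ℕ}

theorem sort_eq (T : Tri n) : T.1.sort (· ≤ ·) = [var T 0, var T 1, var T 2] := by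
  have hl : (T.1.sort (· ≤ ·)).length = 3 := by rw [Finset.length_sort, T.2]
  refine List.ext_getElem (by simp [hl]) fun i h1 h2 => ?_
  have key : ∀ a : Fin 3, var T a = (T.1.sort (· ≤ ·))[(a : ℕ)]'(by omega) := fun a =>
    Finset.orderEmbOfFin_apply _ _ _
  have h3 : i < 3 := by omega
  interval_cases i
  · exact (key 0).symm
  · exact (key 1).symm
  · exact (key 2).symm

theorem encodeXor_eq (C : XorInstance n m) :
    encodeXor C = n :: m :: (List.finRange m).flatMap fun i =>
      [(var (C i).1 0 : ℕ), (var (C i).1 1 : ℕ), (var (C i).1 2 : ℕ), (C i).2.val] := by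
  rw [encodeXor, List.ofFn_eq_map, List.flatMap_map]
  simp [sort_eq]

theorem length_encodeXor (C : XorInstance n m) : (encodeXor C).length = 2 + 4 * m := by
  rw [encodeXor_eq, List.length_cons, List.length_cons, length_flatMap_const (k := 4) _ _ (by simp),
    List.length_finRange]
  ring

theorem getD_encodeXor (C : XorInstance n m) (i : Fin m) {r : ℕ} (hr : r < 4) :
    (encodeXor C).getD (2 + 4 * i + r) 0 =
      [(var (C i).1 0 : ℕ), (var (C i).1 1 : ℕ), (var (C i).1 2 : ℕ), (C i).2.val].getD r 0 := by
  rw [encodeXor_eq, show 2 + 4 * (i : ℕ) + r = 4 * i + r + 1 + 1 by ring, List.getD_cons_succ,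
    List.getD_cons_succ, getD_flatMap_const (k := 4) _ _ (by simp) _ (by simp) hr]
  simp

/-- The block of words of the `i`-th constraint. -/
def conWords (T : Fin m → Tri n) (b : Fin m → ZMod 2) (i : Fin m) : List ℕ :=
  blockWords (2 * (var (T i) 0 : ℕ)) (2 * (var (T i) 0 : ℕ) + 1) (2 * (var (T i) 1 : ℕ))
    (2 * (var (T i) 1 : ℕ) + 1) (2 * (var (T i) 2 : ℕ) + (b i).val)
    (2 * (var (T i) 2 : ℕ) + 1 - (b i).val) (2 * n + 4 * i) (2 * n + 4 * m)

theorem length_conWords (T : Fin m → Tri n) (b : Fin m → ZMod 2) (i : Fin m) :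
    (conWords T b i).length = 32 := rfl

variable [NeZero n]

theorem flatMap_edgeList (hN : 3 * n + 4 * m = N) (T : Fin m → Tri n) (b : Fin m → ZMod 2) :
    (edgeList hN T b).flatMap (fun e => [(e.1 : ℕ), (e.2 : ℕ)]) =
      (List.finRange m).flatMap (conWords T b) := by
  have hdef : edgeIdxs m = (List.finRange m).flatMap fun i =>
      ((([(0, 0), (0, 1), (1, 0), (1, 1)] : List (ZMod 2 × ZMod 2)) ×ˢ
        ([some 0, some 1, some 2, none] : List (Option (Fin 3)))).map (Prod.mk i)) := rfl
  rw [edgeList, List.flatMap_map, hdef, List.flatMap_assoc]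
  congr 1
  funext i
  have hb : ∀ b : ZMod 2, b = 0 ∨ b = 1 := by decide
  have e : (1 : ZMod 2) + 1 = 0 := by decide
  have v0 : (0 : ZMod 2).val = 0 := rfl
  have v1 : (1 : ZMod 2).val = 1 := rfl
  rcases hb (b i) with h | h <;>
  simp [List.product, SProd.sprod, edge, nb, lits, bits, codeEquiv_val, code, conWords, blockWords,
    h, e, v0, v1, add_assoc]

theorem encodePair_eq (hN : 3 * n + 4 * m = N) (T : Fin m → Tri n) (b : Fin m → ZMod 2) :
    encodePair (edgeList hN T b) (edgeList hN T 0) =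
      N :: (16 * m) :: (16 * m) :: ((List.finRange m).flatMap (conWords T b) ++
        (List.finRange m).flatMap (conWords T 0)) := by
  rw [encodePair, flatMap_edgeList, flatMap_edgeList, length_edgeList, length_edgeList]
  simp

theorem length_encodePair_edgeList (hN : 3 * n + 4 * m = N) (T : Fin m → Tri n)
    (b : Fin m → ZMod 2) :
    (encodePair (edgeList hN T b) (edgeList hN T 0)).length = 3 + 64 * m := by
  rw [encodePair_eq]
  simp only [List.length_cons, List.length_append,
    length_flatMap_const _ _ (length_conWords T _), List.length_finRange]
  ring

theorem getD_encodePair_left (hN : 3 * n + 4 * m = N) (T : Fin m → Tri n)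
    (b : Fin m → ZMod 2) (i : Fin m) {r : ℕ} (hr : r < 32) :
    (encodePair (edgeList hN T b) (edgeList hN T 0)).getD (3 + 32 * i + r) 0 =
      (conWords T b i).getD r 0 := by
  rw [encodePair_eq, show 3 + 32 * (i : ℕ) + r = 32 * i + r + 1 + 1 + 1 by ring,
    List.getD_cons_succ, List.getD_cons_succ, List.getD_cons_succ, List.getD_append,
    getD_flatMap_const _ _ (length_conWords T b) _ (by simp) hr]
  · simp
  · rw [length_flatMap_const _ _ (length_conWords T b), List.length_finRange]
    omega

theorem getD_encodePair_right (hN : 3 * n + 4 * m = N) (T : Fin m → Tri n)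
    (b : Fin m → ZMod 2) (i : Fin m) {r : ℕ} (hr : r < 32) :
    (encodePair (edgeList hN T b) (edgeList hN T 0)).getD (3 + 32 * m + 32 * i + r) 0 =
      (conWords T 0 i).getD r 0 := by
  rw [encodePair_eq, show 3 + 32 * m + 32 * (i : ℕ) + r = 32 * m + (32 * i + r) + 1 + 1 + 1 by ring,
    List.getD_cons_succ, List.getD_cons_succ, List.getD_cons_succ, List.getD_append_right]
  · rw [length_flatMap_const _ _ (length_conWords T b), List.length_finRange,
      Nat.add_sub_cancel_left, getD_flatMap_const _ _ (length_conWords T 0) _ (by simp) hr]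
    simp
  · rw [length_flatMap_const _ _ (length_conWords T b), List.length_finRange]
    omega

end Words

/-! ### The reduction program -/

/-- Set the registers in the list to zero. -/
def clear (l : List ℕ) : Prog := seqs (l.map fun d => .const d 0)

theorem loopFree_clear (l : List ℕ) : LoopFree (clear l) := by
  induction l with
  | nil => trivial
  | cons r l ih => exact ⟨trivial, ih⟩

theorem ev_clear (l : List ℕ) (s : Store) :
    (ev (clear l) s).mem = s.mem ∧ ∀ i, (ev (clear l) s).reg i = if i ∈ l then 0 else s.reg i := by
  induction l generalizing s with
  | nil => simp [clear, seqs, ev_copy_self]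
  | cons d l ih =>
    obtain ⟨h1, h2⟩ := ih (ev (.const d 0) s)
    simp only [clear, List.map_cons, seqs] at h1 h2 ⊢
    refine ⟨by rw [ev, h1]; rfl, fun i => ?_⟩
    rw [ev, h2]
    simp only [ev, Store.setReg, Function.update_apply, List.mem_cons]
    split_ifs <;> simp_all

/-- Compute the parameters of the graphs: `2 + 4 m` and `3 + 32 m` and `3 + 64 m` (ends of areas of the
memory), the hub `2 n + 4 m`, the number `3 n + 4 m` of vertices, and the number `16 m` of edges. -/
def setup : Prog :=
  seqs [.const 1 1, .const 23 0, .load 2 23, .load 3 1,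
    .add 24 3 3, .add 24 24 24, .add 26 2 2, .add 7 26 24, .add 25 7 2, .copy 8 7,
    .const 4 2, .add 4 4 24, .add 24 24 24, .add 24 24 24, .add 26 24 24, .const 5 3,
    .add 5 5 26, .add 6 5 26, .copy 27 6, .const 21 4, .const 22 32]

/-- Move the pointers to the preceding constraint, and read it. -/
def readConstraint : Prog :=
  seqs [.sub 4 4 21, .sub 5 5 22, .sub 6 6 22, .sub 8 8 21, .add 9 8 1, .add 10 9 1, .add 11 10 1,
    .copy 20 4, .load 12 20, .add 20 20 1, .load 14 20, .add 20 20 1, .load 18 20,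
    .add 20 20 1, .load 23 20]

/-- Compute the numbers of the literals. -/
def computeLiterals : Prog :=
  seqs [.add 12 12 12, .add 13 12 1, .add 14 14 14, .add 15 14 1, .add 18 18 18, .add 19 18 1,
    .add 16 18 23, .sub 17 19 23, .copy 20 5]

/-- The registers containing the words of a block, when `z₀` and `z₁` are in the registers `u`
and `v`. -/
def blockRegs (u v : ℕ) : List ℕ :=
  [12, 8, 14, 8, u, 8, 8, 7, 12, 9, 15, 9, v, 9, 9, 7,
    13, 10, 14, 10, v, 10, 10, 7, 13, 11, 15, 11, u, 11, 11, 7]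

/-- Process one constraint: write its block in the edge list of either graph. -/
def writeConstraint : Prog :=
  seqs [readConstraint, computeLiterals, writeRegs 20 (blockRegs 16 17), .copy 20 6,
    writeRegs 20 (blockRegs 18 19), .sub 3 3 1]

/-- Write the header of the encoding of the pair of graphs, and reset the registers. -/
def finish : Prog :=
  seqs [.const 23 0, .store 23 25, .store 1 24, .const 23 2, .store 23 24, .copy 0 27,
    clear ((List.range 27).map (· + 1))]

/-- Replace the encoding of an instance by that of the pair of graphs. The constraints are processed
from the last to the first, because the blocks written are longer than the words read, so that no
constraint is overwritten before it has been read. -/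
def reduction : Prog := .seq setup (.seq (.loop 3 writeConstraint) finish)

theorem loopFree_writeConstraint : LoopFree writeConstraint := by
  simp [writeConstraint, readConstraint, computeLiterals, seqs, LoopFree, loopFree_writeRegs]

theorem loopFree_finish : LoopFree finish := by
  simp [finish, seqs, LoopFree, loopFree_clear]

theorem loopFree_setup : LoopFree setup := by
  simp [setup, seqs, LoopFree]

/-- The registers while the constraints `i, i + 1, …` have been processed. -/
structure RegsOK (n m i : ℕ) (s : Store) : Prop where
  r1 : s.reg 1 = 1
  r3 : s.reg 3 = i
  r4 : s.reg 4 = 2 + 4 * i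
  r5 : s.reg 5 = 3 + 32 * i
  r6 : s.reg 6 = 3 + 32 * m + 32 * i
  r7 : s.reg 7 = 2 * n + 4 * m
  r8 : s.reg 8 = 2 * n + 4 * i
  r21 : s.reg 21 = 4
  r22 : s.reg 22 = 32
  r24 : s.reg 24 = 16 * m
  r25 : s.reg 25 = 3 * n + 4 * m
  r27 : s.reg 27 = 3 + 64 * m
  high : ∀ a ≥ 28, s.reg a = 0

/-- The words of the `i`-th constraint of an instance stored in the memory `w`, for the first
graph. -/
def memBlock (n m : ℕ) (w : ℕ → ℕ) (i : ℕ) : List ℕ :=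
  blockWords (2 * w (2 + 4 * i)) (2 * w (2 + 4 * i) + 1) (2 * w (2 + 4 * i + 1))
    (2 * w (2 + 4 * i + 1) + 1) (2 * w (2 + 4 * i + 2) + w (2 + 4 * i + 3))
    (2 * w (2 + 4 * i + 2) + 1 - w (2 + 4 * i + 3)) (2 * n + 4 * i) (2 * n + 4 * m)

/-- The same words for the second graph, which belongs to the homogeneous system. -/
def memBlock₀ (n m : ℕ) (w : ℕ → ℕ) (i : ℕ) : List ℕ :=
  blockWords (2 * w (2 + 4 * i)) (2 * w (2 + 4 * i) + 1) (2 * w (2 + 4 * i + 1))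
    (2 * w (2 + 4 * i + 1) + 1) (2 * w (2 + 4 * i + 2))
    (2 * w (2 + 4 * i + 2) + 1) (2 * n + 4 * i) (2 * n + 4 * m)

/-- The memory when the constraints `i, i + 1, …` have been processed. -/
structure MemOK (n m : ℕ) (w : ℕ → ℕ) (i : ℕ) (s : Store) : Prop where
  low : ∀ a < 2 + 4 * i, s.mem a = w a
  fst : ∀ j, i ≤ j → j < m → ∀ r < 32, s.mem (3 + 32 * j + r) = (memBlock n m w j).getD r 0
  snd : ∀ j, i ≤ j → j < m → ∀ r < 32,
    s.mem (3 + 32 * m + 32 * j + r) = (memBlock₀ n m w j).getD r 0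
  high : ∀ a ≥ 3 + 64 * m, s.mem a = 0

theorem ev_setup {n m : ℕ} {s : Store} (h0 : s.mem 0 = n) (h1 : s.mem 1 = m)
    (hreg : ∀ a ≥ 28, s.reg a = 0) : RegsOK n m m (ev setup s) ∧ (ev setup s).mem = s.mem := by
  constructor
  · constructor
    case high =>
      intro a ha
      simp only [setup, seqs, ev, Store.setReg, Function.update_apply]
      repeat rw [if_neg (by omega)]
      exact hreg a ha
    all_goals simp [setup, seqs, ev, Store.setReg, h0, h1]
    all_goals omega
  · simp [setup, seqs, ev, Store.setReg]

/-- The registers after reading the constraint `i` and computing its literals. -/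
structure LitRegs (n m : ℕ) (w : ℕ → ℕ) (i : ℕ) (s : Store) : Prop where
  r1 : s.reg 1 = 1
  r3 : s.reg 3 = i + 1
  r4 : s.reg 4 = 2 + 4 * i
  r5 : s.reg 5 = 3 + 32 * i
  r6 : s.reg 6 = 3 + 32 * m + 32 * i
  r7 : s.reg 7 = 2 * n + 4 * m
  r8 : s.reg 8 = 2 * n + 4 * i
  r9 : s.reg 9 = 2 * n + 4 * i + 1
  r10 : s.reg 10 = 2 * n + 4 * i + 2
  r11 : s.reg 11 = 2 * n + 4 * i + 3
  r12 : s.reg 12 = 2 * w (2 + 4 * i)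
  r13 : s.reg 13 = 2 * w (2 + 4 * i) + 1
  r14 : s.reg 14 = 2 * w (2 + 4 * i + 1)
  r15 : s.reg 15 = 2 * w (2 + 4 * i + 1) + 1
  r16 : s.reg 16 = 2 * w (2 + 4 * i + 2) + w (2 + 4 * i + 3)
  r17 : s.reg 17 = 2 * w (2 + 4 * i + 2) + 1 - w (2 + 4 * i + 3)
  r18 : s.reg 18 = 2 * w (2 + 4 * i + 2)
  r19 : s.reg 19 = 2 * w (2 + 4 * i + 2) + 1
  r20 : s.reg 20 = 3 + 32 * i
  r21 : s.reg 21 = 4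
  r22 : s.reg 22 = 32
  r24 : s.reg 24 = 16 * m
  r25 : s.reg 25 = 3 * n + 4 * m
  r27 : s.reg 27 = 3 + 64 * m
  high : ∀ a ≥ 28, s.reg a = 0

theorem ev_readConstraint_mem (s : Store) : (ev readConstraint s).mem = s.mem := by
  simp [readConstraint, seqs, ev, Store.setReg]

theorem ev_computeLiterals_mem (s : Store) : (ev computeLiterals s).mem = s.mem := by
  simp [computeLiterals, seqs, ev, Store.setReg]

theorem litRegs {n m i : ℕ} {w : ℕ → ℕ} {s : Store} (hs : RegsOK n m (i + 1) s)
    (hw : ∀ a < 2 + 4 * (i + 1), s.mem a = w a) :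
    LitRegs n m w i (ev computeLiterals (ev readConstraint s)) := by
  obtain ⟨h1, h3, h4, h5, h6, h7, h8, h21, h22, h24, h25, h27, hh⟩ := hs
  have a1 : 2 + 4 * (i + 1) - 4 = 2 + 4 * i := by omega
  have w0 := hw (2 + 4 * i) (by omega)
  have w1 := hw (2 + 4 * i + 1) (by omega)
  have w2 := hw (2 + 4 * i + 2) (by omega)
  have w3 := hw (2 + 4 * i + 3) (by omega)
  constructor
  case high =>
    intro a ha
    simp only [computeLiterals, readConstraint, seqs, ev, Store.setReg, Function.update_apply]
    repeat rw [if_neg (by omega)]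
    exact hh a ha
  all_goals simp [computeLiterals, readConstraint, seqs, ev, Store.setReg, *]
  all_goals omega

/-- Writing the registers of `blockRegs` puts the block `blockWords` at the address in register `20`,
and changes nothing else but that register. -/
theorem writeRegs_block {u v X₀ X₁ Y₀ Y₁ Z₀ Z₁ c h A : ℕ} {s : Store} (h1 : s.reg 1 = 1)
    (h20 : s.reg 20 = A) (h7 : s.reg 7 = h) (h8 : s.reg 8 = c) (h9 : s.reg 9 = c + 1)
    (h10 : s.reg 10 = c + 2) (h11 : s.reg 11 = c + 3) (h12 : s.reg 12 = X₀)
    (h13 : s.reg 13 = X₁) (h14 : s.reg 14 = Y₀) (h15 : s.reg 15 = Y₁) (hu : s.reg u = Z₀)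
    (hv : s.reg v = Z₁) (hu' : 20 ≠ u) (hv' : 20 ≠ v) :
    (∀ a, a ≠ 20 → (ev (writeRegs 20 (blockRegs u v)) s).reg a = s.reg a) ∧
    (∀ r < 32, (ev (writeRegs 20 (blockRegs u v)) s).mem (A + r) =
      (blockWords X₀ X₁ Y₀ Y₁ Z₀ Z₁ c h).getD r 0) ∧
    ∀ a, (a < A ∨ A + 32 ≤ a) → (ev (writeRegs 20 (blockRegs u v)) s).mem a = s.mem a := by
  have hnot : 20 ∉ blockRegs u v := by simp [blockRegs, hu', hv']
  have hlen : (blockRegs u v).length = 32 := rfl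
  refine ⟨fun a ha => ?_, fun r hr => ?_, fun a ha => ?_⟩
  · rw [ev_writeRegs_reg (by norm_num) _ _ h1, Function.update_of_ne ha]
  · rw [ev_writeRegs_mem (by norm_num) _ hnot _ h1, h20, hlen, if_pos (by omega),
      Nat.add_sub_cancel_left]
    interval_cases r <;> simp [blockRegs, blockWords, *]
  · rw [ev_writeRegs_mem (by norm_num) _ hnot _ h1, h20, hlen, if_neg (by omega)]

theorem ev_writeBlocks {n m i : ℕ} {w : ℕ → ℕ} {s s₁ s₄ : Store} (him : i < m)
    (hm : MemOK n m w (i + 1) s) (hl : LitRegs n m w i s₁) (hmem₁ : s₁.mem = s.mem)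
    (hs₄ : s₄ = ev (writeRegs 20 (blockRegs 18 19))
      (ev (.copy 20 6) (ev (writeRegs 20 (blockRegs 16 17)) s₁))) :
    RegsOK n m i (ev (.sub 3 3 1) s₄) ∧ MemOK n m w i (ev (.sub 3 3 1) s₄) := by
  obtain ⟨e1, e2, e3⟩ := writeRegs_block (u := 16) (v := 17) hl.r1 hl.r20 hl.r7 hl.r8 hl.r9 hl.r10
    hl.r11 hl.r12 hl.r13 hl.r14 hl.r15 hl.r16 hl.r17 (by norm_num) (by norm_num)
  obtain ⟨s₂, hs₂⟩ : ∃ s₂, s₂ = ev (writeRegs 20 (blockRegs 16 17)) s₁ := ⟨_, rfl⟩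
  rw [← hs₂] at e1 e2 e3 hs₄
  obtain ⟨s₃, hs₃⟩ : ∃ s₃, s₃ = ev (.copy 20 6) s₂ := ⟨_, rfl⟩
  rw [← hs₃] at hs₄
  have f0 : s₃.reg 20 = 3 + 32 * m + 32 * i := by
    simp only [hs₃, ev, Store.setReg, Function.update_self]
    rw [e1 _ (by norm_num), hl.r6]
  have f1 : ∀ a, a ≠ 20 → s₃.reg a = s₁.reg a := by
    intro a ha
    simp only [hs₃, ev, Store.setReg]
    rw [Function.update_of_ne ha, e1 _ ha]
  have f2 : s₃.mem = s₂.mem := by rw [hs₃]; rfl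
  obtain ⟨g1, g2, g3⟩ := writeRegs_block (u := 18) (v := 19) (s := s₃)
    ((f1 1 (by norm_num)).trans hl.r1) f0 ((f1 7 (by norm_num)).trans hl.r7)
    ((f1 8 (by norm_num)).trans hl.r8) ((f1 9 (by norm_num)).trans hl.r9)
    ((f1 10 (by norm_num)).trans hl.r10) ((f1 11 (by norm_num)).trans hl.r11)
    ((f1 12 (by norm_num)).trans hl.r12) ((f1 13 (by norm_num)).trans hl.r13)
    ((f1 14 (by norm_num)).trans hl.r14) ((f1 15 (by norm_num)).trans hl.r15)
    ((f1 18 (by norm_num)).trans hl.r18) ((f1 19 (by norm_num)).trans hl.r19)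
    (by norm_num) (by norm_num)
  rw [← hs₄] at g1 g2 g3
  obtain ⟨s₅, hs₅⟩ : ∃ s₅, s₅ = ev (.sub 3 3 1) s₄ := ⟨_, rfl⟩
  rw [← hs₅]
  have k1 : ∀ a, a ≠ 20 → a ≠ 3 → s₅.reg a = s₁.reg a := by
    intro a ha ha'
    rw [hs₅]
    simp only [ev, Store.setReg]
    rw [Function.update_of_ne ha', g1 a ha, f1 a ha]
  have k3 : s₅.reg 3 = i := by
    rw [hs₅]
    simp only [ev, Store.setReg, Function.update_self]
    rw [g1 _ (by norm_num), f1 _ (by norm_num), hl.r3, g1 _ (by norm_num), f1 _ (by norm_num),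
      hl.r1]
    rfl
  have kmem : s₅.mem = s₄.mem := by rw [hs₅]; rfl
  constructor
  · exact ⟨(k1 1 (by norm_num) (by norm_num)).trans hl.r1, k3,
      (k1 4 (by norm_num) (by norm_num)).trans hl.r4,
      (k1 5 (by norm_num) (by norm_num)).trans hl.r5,
      (k1 6 (by norm_num) (by norm_num)).trans hl.r6,
      (k1 7 (by norm_num) (by norm_num)).trans hl.r7,
      (k1 8 (by norm_num) (by norm_num)).trans hl.r8,
      (k1 21 (by norm_num) (by norm_num)).trans hl.r21,
      (k1 22 (by norm_num) (by norm_num)).trans hl.r22,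
      (k1 24 (by norm_num) (by norm_num)).trans hl.r24,
      (k1 25 (by norm_num) (by norm_num)).trans hl.r25,
      (k1 27 (by norm_num) (by norm_num)).trans hl.r27,
      fun a ha => (k1 a (by omega) (by omega)).trans (hl.high a ha)⟩
  · have hsame : ∀ a, (a < 3 + 32 * i ∨ 3 + 32 * i + 32 ≤ a) →
        (a < 3 + 32 * m + 32 * i ∨ 3 + 32 * m + 32 * i + 32 ≤ a) →
        s₅.mem a = s.mem a := by
      intro a ha ha'
      rw [kmem, g3 a ha', f2, e3 a ha, hmem₁]
    constructor
    · intro a ha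
      rw [hsame a (by omega) (by omega)]
      exact hm.low a (by omega)
    · intro j hj hjm r hr
      rcases hj.eq_or_lt with rfl | hj
      · rw [kmem, g3 _ (by omega), f2]
        exact e2 r hr
      · rw [hsame _ (by omega) (by omega)]
        exact hm.fst j hj hjm r hr
    · intro j hj hjm r hr
      rcases hj.eq_or_lt with rfl | hj
      · rw [kmem]
        exact g2 r hr
      · rw [hsame _ (by omega) (by omega)]
        exact hm.snd j hj hjm r hr
    · intro a ha
      rw [hsame a (by omega) (by omega)]
      exact hm.high a ha

theorem ev_writeConstraint {n m i : ℕ} {w : ℕ → ℕ} {s : Store} (him : i < m)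
    (hs : RegsOK n m (i + 1) s) (hm : MemOK n m w (i + 1) s) :
    RegsOK n m i (ev writeConstraint s) ∧ MemOK n m w i (ev writeConstraint s) := by
  have hfin : ev writeConstraint s = ev (.sub 3 3 1) (ev (writeRegs 20 (blockRegs 18 19))
      (ev (.copy 20 6) (ev (writeRegs 20 (blockRegs 16 17))
        (ev computeLiterals (ev readConstraint s))))) := by
    rw [writeConstraint]
    simp only [ev_seqs_cons, ev_seqs_nil]
  rw [hfin]
  exact ev_writeBlocks him hm (litRegs hs hm.low)
    (by rw [ev_computeLiterals_mem, ev_readConstraint_mem]) rfl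

theorem ev_finish {n m : ℕ} {s : Store} (hs : RegsOK n m 0 s) :
    (ev finish s).reg 0 = 3 + 64 * m ∧ (∀ a ≠ 0, (ev finish s).reg a = 0) ∧
      (ev finish s).mem 0 = 3 * n + 4 * m ∧ (ev finish s).mem 1 = 16 * m ∧
      (ev finish s).mem 2 = 16 * m ∧ ∀ a ≥ 3, (ev finish s).mem a = s.mem a := by
  obtain ⟨h1, h3, h4, h5, h6, h7, h8, h21, h22, h24, h25, h27, hh⟩ := hs
  obtain ⟨s₁, hs₁⟩ : ∃ s₁, s₁ = ev (.copy 0 27) (ev (.store 23 24) (ev (.const 23 2)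
    (ev (.store 1 24) (ev (.store 23 25) (ev (.const 23 0) s))))) := ⟨_, rfl⟩
  have hfin : ev finish s = ev (clear ((List.range 27).map (· + 1))) s₁ := by
    rw [finish]
    simp only [ev_seqs_cons, ev_seqs_nil, hs₁]
  obtain ⟨c1, c2⟩ := ev_clear ((List.range 27).map (· + 1)) s₁
  rw [← hfin] at c1 c2
  have hin : ∀ a, a ∈ (List.range 27).map (· + 1) ↔ 1 ≤ a ∧ a ≤ 27 := by
    intro a
    simp only [List.mem_map, List.mem_range]
    constructor
    · rintro ⟨k, hk, rfl⟩
      omega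
    · rintro ⟨h, h'⟩
      exact ⟨a - 1, by omega, by omega⟩
  refine ⟨?_, ?_, ?_, ?_, ?_, ?_⟩
  · rw [c2, if_neg (by rw [hin]; omega)]
    simp [hs₁, ev, Store.setReg, Store.setMem, h27]
  · intro a ha
    rw [c2]
    split_ifs with h
    · rfl
    · rw [hin] at h
      simp only [hs₁, ev, Store.setReg, Store.setMem]
      rw [Function.update_of_ne ha, Function.update_of_ne (by omega),
        Function.update_of_ne (by omega)]
      exact hh a (by omega)
  · rw [c1]
    simp [hs₁, ev, Store.setReg, Store.setMem, h1, h25]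
  · rw [c1]
    simp [hs₁, ev, Store.setReg, Store.setMem, h1, h24]
  · rw [c1]
    simp [hs₁, ev, Store.setReg, Store.setMem, h24]
  · intro a ha
    rw [c1]
    simp only [hs₁, ev, Store.setReg, Store.setMem, Function.update_self,
      Function.update_of_ne (show (1 : ℕ) ≠ 23 by norm_num), h1]
    rw [Function.update_of_ne (by omega), Function.update_of_ne (by omega),
      Function.update_of_ne (by omega)]

theorem memBlock_encodeXor {n m : ℕ} [NeZero n] (C : XorInstance n m) (i : Fin m) :
    memBlock n m (fun a => (encodeXor C).getD a 0) i =
      conWords (fun i => (C i).1) (fun i => (C i).2) i ∧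
    memBlock₀ n m (fun a => (encodeXor C).getD a 0) i = conWords (fun i => (C i).1) 0 i := by
  have h0 := getD_encodeXor C i (r := 0) (by norm_num)
  have h1 := getD_encodeXor C i (r := 1) (by norm_num)
  have h2 := getD_encodeXor C i (r := 2) (by norm_num)
  have h3 := getD_encodeXor C i (r := 3) (by norm_num)
  rw [add_zero] at h0
  simp only [memBlock, memBlock₀, h0, h1, h2, h3, conWords]
  exact ⟨rfl, rfl⟩

/-- The running time of the reduction on `m` constraints. -/
def reductionTime (m : ℕ) : ℕ :=
  size setup + ((m * (size writeConstraint + 1) + 1) + size finish)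

/-- The final store is the initial store for the constructed pair of graphs, so that the program for
such pairs can be run next. -/
theorem triple_reduction {n m N : ℕ} [NeZero n] (hN : 3 * n + 4 * m = N) (C : XorInstance n m) :
    Triple (fun s => s.mem = (inputStore (encodeXor C)).mem ∧ ∀ a ≥ 28, s.reg a = 0) reduction
      (reductionTime m)
      (fun s => s = inputStore (encodePair (edgeList hN (fun i => (C i).1) fun i => (C i).2)
        (edgeList hN (fun i => (C i).1) 0))) := by
  set w : ℕ → ℕ := fun a => (encodeXor C).getD a 0 with hw
  have hw0 : w 0 = n := by simp [hw, encodeXor_eq]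
  have hw1 : w 1 = m := by simp [hw, encodeXor_eq]
  have hwhigh : ∀ a ≥ 2 + 4 * m, w a = 0 := by
    intro a ha
    rw [hw]
    exact List.getD_eq_default _ _ (by rw [length_encodeXor]; omega)
  let I : ℕ → Store → Prop := fun j s => RegsOK n m (m - j) s ∧ MemOK n m w (m - j) s
  have hsetup : Triple (fun s => s.mem = (inputStore (encodeXor C)).mem ∧ ∀ a ≥ 28, s.reg a = 0)
      setup (size setup) (I 0) := by
    refine Triple.of_ev loopFree_setup fun s hs => ?_
    have hmem : s.mem = w := hs.1
    obtain ⟨h1, h2⟩ := ev_setup (s := s) (n := n) (m := m) (by rw [hmem, hw0]) (by rw [hmem, hw1])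
      hs.2
    refine ⟨h1, ⟨?_, ?_, ?_, ?_⟩⟩
    · intro a _
      rw [h2, hmem]
    · intro j hj hj'
      omega
    · intro j hj hj'
      omega
    · intro a ha
      rw [h2, hmem]
      exact hwhigh a (by omega)
  have hloop : Triple (I 0) (.loop 3 writeConstraint) (m * (size writeConstraint + 1) + 1) (I m) := by
    refine Triple.loop I m ?_ ?_
    · rintro j hj s ⟨hs, -⟩
      rw [hs.r3]
      omega
    · intro j hj
      refine Triple.of_ev loopFree_writeConstraint fun s hs => ?_
      have e : m - j = m - (j + 1) + 1 := by omega
      simp only [I, e] at hs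
      exact ev_writeConstraint (by omega) hs.1 hs.2
  refine hsetup.seq (hloop.seq (Triple.of_ev loopFree_finish fun s hs => ?_))
  simp only [I, Nat.sub_self] at hs
  obtain ⟨hr, hm⟩ := hs
  obtain ⟨f1, f2, f3, f4, f5, f6⟩ := ev_finish hr
  have hlen := length_encodePair_edgeList hN (fun i => (C i).1) fun i => (C i).2
  refine Store.ext' (fun a => ?_) fun a => ?_
  · by_cases ha : a = 0
    · subst ha
      simp only [inputStore, if_true, hlen, f1]
    · simp only [inputStore, if_neg ha, f2 a ha]
  · simp only [inputStore]
    rcases lt_or_ge a 3 with h | h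
    · rw [encodePair_eq]
      interval_cases a
      · rw [f3, ← hN]
        simp
      · rw [f4]
        simp
      · rw [f5]
        simp
    rw [f6 a h]
    rcases lt_or_ge a (3 + 32 * m) with h' | h'
    · obtain ⟨j, r, hr, rfl⟩ : ∃ j r, r < 32 ∧ a = 3 + 32 * j + r :=
        ⟨(a - 3) / 32, (a - 3) % 32, by omega, by omega⟩
      rw [hm.fst j (Nat.zero_le _) (by omega) r hr,
        (memBlock_encodeXor C ⟨j, by omega⟩).1]
      exact (getD_encodePair_left hN _ _ ⟨j, by omega⟩ hr).symm
    rcases lt_or_ge a (3 + 64 * m) with h'' | h''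
    · obtain ⟨j, r, hr, rfl⟩ : ∃ j r, r < 32 ∧ a = 3 + 32 * m + 32 * j + r :=
        ⟨(a - 3 - 32 * m) / 32, (a - 3 - 32 * m) % 32, by omega, by omega⟩
      rw [hm.snd j (Nat.zero_le _) (by omega) r hr,
        (memBlock_encodeXor C ⟨j, by omega⟩).2]
      exact (getD_encodePair_right hN _ _ ⟨j, by omega⟩ hr).symm
    · rw [hm.high a h'', List.getD_eq_default _ _ (by rw [hlen]; omega)]

/-! ### Certifying random instances -/

/-- Replace the answer in register `0` by `1` if it is different from `1`, and by `0` otherwise. -/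
def negate : Prog :=
  seqs [.const 1 1, .sub 2 0 1, .sub 3 1 0, .add 2 2 3, .cond 2 (.const 0 1) (.const 0 0)]

theorem ev_negate (s : Store) : (ev negate s).reg 0 = if s.reg 0 = 1 then 0 else 1 := by
  obtain h | h | ⟨k, h⟩ : s.reg 0 = 0 ∨ s.reg 0 = 1 ∨ ∃ k, s.reg 0 = k + 2 := by
    rcases h : s.reg 0 with _ | _ | k <;> simp
  all_goals simp [negate, ev_seqs_cons, ev_seqs_nil, ev, Store.setReg, h]

/-- The algorithm for 3XOR obtained from an algorithm `A` for pairs of graphs. Instances without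
constraints are treated separately. -/
def certifier (A : Prog) : Prog :=
  .seq (.seq (.const 1 1) (.load 3 1))
    (.cond 3 (.seq reduction (.seq A negate)) (.const 0 0))

theorem run_certifier {n m N : ℕ} [NeZero n] (hm : 0 < m) (hN : 3 * n + 4 * m = N)
    (C : XorInstance n m) {A : Prog} {k : ℕ} {s : Store}
    (hA : Run A (inputStore (encodePair (edgeList hN (fun i => (C i).1) fun i => (C i).2)
        (edgeList hN (fun i => (C i).1) 0))) k s) :
    ∃ K ≤ k + reductionTime m + size negate + 3, ∃ s', Run (certifier A) (inputStore (encodeXor C)) K s' ∧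
      s'.reg 0 = if s.reg 0 = 1 then 0 else 1 := by
  have hpre : LoopFree (.seq (.const 1 1) (.load 3 1)) := ⟨trivial, trivial⟩
  obtain ⟨k₁, hk₁, h₁⟩ := hpre.run (inputStore (encodeXor C))
  set s₁ := ev (.seq (.const 1 1) (.load 3 1)) (inputStore (encodeXor C)) with hs₁
  have h3 : s₁.reg 3 = m := by
    simp [hs₁, ev, Store.setReg, inputStore, encodeXor_eq]
  have hreg : ∀ a ≥ 28, s₁.reg a = 0 := by
    intro a ha
    simp only [hs₁, ev, Store.setReg, inputStore]
    rw [Function.update_of_ne (by omega), Function.update_of_ne (by omega), if_neg (by omega)]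
  obtain ⟨k₂, hk₂, s₂, h₂, rfl⟩ := triple_reduction hN C s₁ ⟨rfl, hreg⟩
  have hneg : LoopFree negate := by simp [negate, seqs, LoopFree]
  obtain ⟨k₃, hk₃, h₃⟩ := hneg.run s
  refine ⟨k₁ + (k₂ + (k + k₃) + 1), ?_, _, .seq h₁ (.condTrue (by omega) (.seq h₂ (.seq hA h₃))),
    ev_negate s⟩
  simp only [size] at hk₁
  omega

theorem run_certifier_zero {m : ℕ} (hm : m = 0) {n : ℕ} (C : XorInstance n m) (A : Prog) :
    ∃ K ≤ 4, ∃ s', Run (certifier A) (inputStore (encodeXor C)) K s' ∧ s'.reg 0 = 0 := by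
  have hpre : LoopFree (.seq (.const 1 1) (.load 3 1)) := ⟨trivial, trivial⟩
  obtain ⟨k₁, hk₁, h₁⟩ := hpre.run (inputStore (encodeXor C))
  refine ⟨k₁ + (1 + 1), ?_, _, .seq h₁ (.condFalse ?_ (.const 0 0 _)), by simp [Store.setReg]⟩
  · simp only [size] at hk₁
    omega
  · simp [ev, Store.setReg, inputStore, encodeXor_eq, hm]

theorem certifier_time_le {a T n : ℕ} (h : n ≤ T) :
    a * (T + 1) + reductionTime (300 * n) + size negate + 3 ≤
      (a + (size setup + 300 * (size writeConstraint + 1) + 1 + size finish + size negate + 4)) *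
        (T + 1) := by
  have aux : ∀ c₁ c₂ c₃ c₄ : ℕ, a * (T + 1) + (c₁ + ((300 * n * (c₂ + 1) + 1) + c₃)) + c₄ + 3 ≤
      (a + (c₁ + 300 * (c₂ + 1) + 1 + c₃ + c₄ + 4)) * (T + 1) := by
    intro c₁ c₂ c₃ c₄
    have h1 : n * (c₂ + 1) ≤ T * (c₂ + 1) := Nat.mul_le_mul_right _ h
    nlinarith [Nat.zero_le (T * c₁), Nat.zero_le (T * c₃), Nat.zero_le (T * c₄)]
  exact aux _ _ _ _

theorem certifiesXor_certifier {A : Prog} {ε : ℝ} {t : ℕ → ℕ} (ht : ∀ n, n ≤ t n)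
    (hA : Distinguishes A 4 ε (1 / 256) t) :
    CertifiesXor (certifier A) 300 (1 * ε) fun n => t (1203 * n) := by
  obtain ⟨a, ha⟩ := hA
  -- The hypothesis on `A`, for the pair of graphs constructed from an instance.
  have key : ∀ (n : ℕ) [NeZero n] (C : XorInstance n (300 * n)),
      ∃ k ≤ a * (t (1203 * n) + 1) + reductionTime (300 * n) + size negate + 3, ∃ s,
        Run (certifier A) (inputStore (encodeXor C)) k s ∧
        (XorSatisfiable (1 - ε) C → s.reg 0 = 0) ∧
        ((¬ ∃ τ, 240 * n ≤ {i | Sat τ (C i)}.ncard) → ¬ HasOverlap (3 * n) C → s.reg 0 = 1) := by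
    intro n _ C
    have hn : 0 < n := Nat.pos_of_ne_zero (NeZero.ne n)
    have hN : 3 * n + 4 * (300 * n) = 1203 * n := by ring
    obtain ⟨⟨k, hk, s, hrun⟩, h1, h2⟩ := ha (1203 * n)
      (finGraph hN (fun i => (C i).1) fun i => (C i).2) (finGraph hN (fun i => (C i).1) 0)
      (edgeList hN (fun i => (C i).1) fun i => (C i).2) (edgeList hN (fun i => (C i).1) 0)
      (isEdgeList_edgeList _ _ _) (isEdgeList_edgeList _ _ _)
      (by rw [length_edgeList]; omega) (by rw [length_edgeList, length_edgeList])
      (by rw [length_edgeList]; omega)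
    obtain ⟨K, hK, s', hrun', hs'⟩ := run_certifier (by omega) hN C hrun
    refine ⟨K, by omega, s', hrun', fun hsat => ?_, fun hsat hover => ?_⟩
    · obtain ⟨k', s'', hr, h⟩ := h1 (approxIsomorphic_of_xorSatisfiable hN (by omega) C hsat)
      obtain ⟨-, rfl⟩ := hr.unique hrun
      rw [hs', if_pos h]
    · rw [hs', if_neg]
      intro h
      exact h2 (not_approxIsomorphic hN C hsat hover) ⟨k, s, hrun, h⟩
  refine ⟨⟨a + (size setup + 300 * (size writeConstraint + 1) + 1 + size finish + size negate + 4),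
    fun n C => ?_⟩, ?_, fun n C hsat => ?_⟩
  · rcases Nat.eq_zero_or_pos n with hn | hn
    · obtain ⟨k, hk, s, hrun, -⟩ := run_certifier_zero (by omega) C A
      refine ⟨k, hk.trans ?_, s, hrun⟩
      nlinarith [Nat.zero_le (t (1203 * n))]
    · have : NeZero n := ⟨by omega⟩
      obtain ⟨k, hk, s, hrun, -⟩ := key n C
      refine ⟨k, hk.trans ?_, s, hrun⟩
      have htn := ht (1203 * n)
      exact certifier_time_le (by omega)
  · refine typicalOnAlmostAll_of_density
      (tendsto_density_union tendsto_density_exists_sat (tendsto_density_hasOverlap 300)) ?_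
    filter_upwards [eventually_gt_atTop 0] with n hn C hC
    have : NeZero n := ⟨by omega⟩
    obtain ⟨k, -, s, hrun, -, h⟩ := key n C
    exact ⟨k, s, hrun, h (fun h' => hC (Or.inl h')) fun h' => hC (Or.inr h')⟩
  · rintro ⟨k, s, hrun, h⟩
    rcases Nat.eq_zero_or_pos n with hn | hn
    · obtain ⟨k', -, s', hrun', h'⟩ := run_certifier_zero (by omega) C A
      obtain ⟨-, rfl⟩ := hrun.unique hrun'
      omega
    · have : NeZero n := ⟨by omega⟩
      obtain ⟨k', -, s', hrun', h', -⟩ := key n C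
      obtain ⟨-, rfl⟩ := hrun.unique hrun'
      rw [h' (by rwa [one_mul] at hsat)] at h
      omega

/-! ### Counting by a double loop -/

/-- For `i = R[t+2] - 1, …, 0` and `j = R[t+3] - 1, …, 0` execute `test`, which leaves a non-zero value
in register `t + 8` if the pair `(i, j)`, given in the registers `t + 5` and `t + 7`, passes; count in
register `t + 4` the `i` for which some `j` passes. Register `t + 1` contains `1`. -/
def countLoop (t : ℕ) (test : Prog) : Prog :=
  .seq (.seq (.const (t + 4) 0) (.copy (t + 5) (t + 2)))
    (.loop (t + 5)
      (.seq (.seq (.sub (t + 5) (t + 5) (t + 1)) (.seq (.const (t + 6) 0) (.copy (t + 7) (t + 3))))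
        (.seq
          (.loop (t + 7) (.seq (.sub (t + 7) (t + 7) (t + 1))
            (.seq test (.cond (t + 8) (.const (t + 6) 1) (.copy (t + 6) (t + 6))))))
          (.add (t + 4) (t + 4) (t + 6)))))

/-- The part of the store that stays fixed during `countLoop`. -/
structure CountBase (t A B : ℕ) (M hi : ℕ → ℕ) (s : Store) : Prop where
  mem : s.mem = M
  r1 : s.reg (t + 1) = 1
  r2 : s.reg (t + 2) = A
  r3 : s.reg (t + 3) = B
  high : ∀ a ≥ t + 31, s.reg a = hi a

theorem CountBase.setReg {t A B : ℕ} {M hi : ℕ → ℕ} {s : Store} (h : CountBase t A B M hi s)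
    {d : ℕ} (hd : t + 4 ≤ d) (hd' : d < t + 31) (v : ℕ) : CountBase t A B M hi (s.setReg d v) := by
  have hne : ∀ a, a ≠ d → (s.setReg d v).reg a = s.reg a := fun a ha =>
    Function.update_of_ne ha _ _
  exact ⟨h.mem, (hne _ (by omega)).trans h.r1, (hne _ (by omega)).trans h.r2,
    (hne _ (by omega)).trans h.r3, fun a ha => (hne _ (by omega)).trans (h.high a ha)⟩

/-- The loop-free program `test` decides the relation `T`, and only uses the registers from `t + 8`
to `t + 30`. -/
structure IsTest (t A B : ℕ) (M hi : ℕ → ℕ) (T : ℕ → ℕ → Prop) (test : Prog) : Prop where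
  loopFree : LoopFree test
  base : ∀ s, CountBase t A B M hi s → CountBase t A B M hi (ev test s)
  same : ∀ s a, t + 4 ≤ a → a < t + 8 → (ev test s).reg a = s.reg a
  result : ∀ s, CountBase t A B M hi s →
    ((ev test s).reg (t + 8) ≠ 0 ↔ T (s.reg (t + 5)) (s.reg (t + 7)))

open Classical in
/-- The number of `i < A` for which some `j < B` satisfies `T i j`. -/
noncomputable def exCount (A B : ℕ) (T : ℕ → ℕ → Prop) : ℕ :=
  ((Finset.range A).filter fun i => ∃ j < B, T i j).card

theorem le_exCount_iff {A B : ℕ} {T : ℕ → ℕ → Prop} :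
    A ≤ exCount A B T ↔ ∀ i < A, ∃ j < B, T i j := by
  classical
  rw [exCount]
  constructor
  · intro h i hi
    have heq := Finset.eq_of_subset_of_card_le
      (Finset.filter_subset (fun i => ∃ j < B, T i j) (Finset.range A)) (by simpa using h)
    rw [← Finset.mem_range, ← heq] at hi
    exact (Finset.mem_filter.1 hi).2
  · intro h
    rw [Finset.filter_true_of_mem fun i hi => h i (Finset.mem_range.1 hi), Finset.card_range]

open Classical in
theorem triple_countLoop {t A B : ℕ} {M hi : ℕ → ℕ} {T : ℕ → ℕ → Prop} {test : Prog}
    (h : IsTest t A B M hi T test) :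
    Triple (CountBase t A B M hi) (countLoop t test)
      (2 + (A * (3 + ((B * (1 + (size test + 3) + 1) + 1) + 1) + 1) + 1))
      (fun s => CountBase t A B M hi s ∧ s.reg (t + 4) = exCount A B T) := by
  let I : ℕ → Store → Prop := fun k s => CountBase t A B M hi s ∧ s.reg (t + 5) = A - k ∧
    s.reg (t + 4) = ((Finset.Ico (A - k) A).filter fun i => ∃ j < B, T i j).card
  let J : ℕ → ℕ → ℕ → Store → Prop := fun i c k s => CountBase t A B M hi s ∧ s.reg (t + 5) = i ∧
    s.reg (t + 4) = c ∧ s.reg (t + 7) = B - k ∧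
    s.reg (t + 6) = if ∃ j, B - k ≤ j ∧ j < B ∧ T i j then 1 else 0
  have hinner : ∀ i c, Triple (J i c 0) (.loop (t + 7) (.seq (.sub (t + 7) (t + 7) (t + 1))
      (.seq test (.cond (t + 8) (.const (t + 6) 1) (.copy (t + 6) (t + 6))))))
      (B * (1 + (size test + 3) + 1) + 1) (J i c B) := by
    intro i c
    refine Triple.loop (J i c) B ?_ ?_
    · rintro k hk s ⟨-, -, -, h7, -⟩
      rw [h7]
      omega
    · intro k hk
      refine Triple.of_ev ⟨trivial, h.loopFree, trivial, trivial⟩ ?_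
      rintro s ⟨hb, h5, h4, h7, h6⟩
      set s₁ := s.setReg (t + 7) (B - (k + 1)) with hs₁
      have e₁ : s.setReg (t + 7) (s.reg (t + 7) - s.reg (t + 1)) = s₁ := by
        rw [h7, hb.r1, hs₁]
        rfl
      have hb₁ : CountBase t A B M hi s₁ := hb.setReg (by omega) (by omega) _
      set s₂ := ev test s₁ with hs₂
      have hb₂ := h.base s₁ hb₁
      have e4 : s₂.reg (t + 4) = c := by
        rw [hs₂, h.same s₁ _ (by omega) (by omega), hs₁]
        simp [Store.setReg, h4]
      have e5 : s₂.reg (t + 5) = i := by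
        rw [hs₂, h.same s₁ _ (by omega) (by omega), hs₁]
        simp [Store.setReg, h5]
      have e6 : s₂.reg (t + 6) = s.reg (t + 6) := by
        rw [hs₂, h.same s₁ _ (by omega) (by omega), hs₁]
        simp [Store.setReg]
      have e7 : s₂.reg (t + 7) = B - (k + 1) := by
        rw [hs₂, h.same s₁ _ (by omega) (by omega), hs₁]
        simp [Store.setReg]
      have e8 : s₂.reg (t + 8) ≠ 0 ↔ T i (B - (k + 1)) := by
        rw [hs₂, h.result s₁ hb₁, hs₁]
        simp [Store.setReg, h5]
      have hex : (∃ j, B - (k + 1) ≤ j ∧ j < B ∧ T i j) ↔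
          T i (B - (k + 1)) ∨ ∃ j, B - k ≤ j ∧ j < B ∧ T i j := by
        constructor
        · rintro ⟨j, hj, hj', hT⟩
          rcases hj.eq_or_lt with rfl | hj
          · exact Or.inl hT
          · exact Or.inr ⟨j, by omega, hj', hT⟩
        · rintro (hT | ⟨j, hj, hj', hT⟩)
          · exact ⟨_, le_rfl, by omega, hT⟩
          · exact ⟨j, by omega, hj', hT⟩
      rw [ev, ev, e₁, ev, ← hs₂]
      simp only [ev]
      split_ifs with h8
      · refine ⟨hb₂.setReg (by omega) (by omega) _, by simp [Store.setReg, e5],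
          by simp [Store.setReg, e4], by simp [Store.setReg, e7], ?_⟩
        have hnot : ¬ T i (B - (k + 1)) := fun hT => e8.2 hT h8
        simp only [Store.setReg, Function.update_self, e6, h6, hex, hnot, false_or]
      · refine ⟨hb₂.setReg (by omega) (by omega) _, by simp [Store.setReg, e5],
          by simp [Store.setReg, e4], by simp [Store.setReg, e7], ?_⟩
        have hT := e8.1 h8
        simp only [Store.setReg, Function.update_self, hex, hT, true_or, if_true]
  have hpre : Triple (CountBase t A B M hi) (.seq (.const (t + 4) 0) (.copy (t + 5) (t + 2))) 2
      (I 0) := by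
    refine Triple.of_ev ⟨trivial, trivial⟩ ?_
    intro s hb
    refine ⟨(hb.setReg (by omega) (by omega) _).setReg (by omega) (by omega) _, ?_, ?_⟩
    · simp [ev, Store.setReg, hb.r2]
    · simp [ev, Store.setReg]
  refine (hpre.seq (Triple.loop I A ?_ ?_)).weaken (fun _ h => h) ?_ le_rfl
  · rintro k hk s ⟨-, h5, -⟩
    rw [h5]
    omega
  · intro k hk
    refine Triple.seq (Q := J (A - (k + 1))
      ((Finset.Ico (A - k) A).filter fun i => ∃ j < B, T i j).card 0) ?_
      ((hinner _ _).seq ?_)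
    · refine Triple.of_ev ⟨trivial, trivial, trivial⟩ ?_
      rintro s ⟨hb, h5, h4⟩
      refine ⟨((hb.setReg (by omega) (by omega) _).setReg (by omega) (by omega) _).setReg
        (by omega) (by omega) _, ?_, ?_, ?_, ?_⟩
      · simp [ev, Store.setReg, hb.r1, h5]
        omega
      · simp [ev, Store.setReg, h4]
      · simp [ev, Store.setReg, hb.r3]
      · rw [if_neg (by rintro ⟨j, h1, h2, -⟩; omega)]
        simp [ev, Store.setReg]
    · refine Triple.of_ev (p := .add (t + 4) (t + 4) (t + 6)) trivial ?_
      rintro s ⟨hb, h5, h4, h7, h6⟩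
      refine ⟨hb.setReg (by omega) (by omega) _, by simp [ev, Store.setReg, h5], ?_⟩
      have hIco : Finset.Ico (A - (k + 1)) A = insert (A - (k + 1)) (Finset.Ico (A - k) A) := by
        ext x
        simp only [Finset.mem_Ico, Finset.mem_insert]
        omega
      rw [hIco, Finset.filter_insert]
      simp only [ev, Store.setReg, Function.update_self, h4, h6, Nat.sub_self, Nat.zero_le,
        true_and]
      split_ifs with hT
      · rw [Finset.card_insert_of_notMem]
        simp only [Finset.mem_filter, Finset.mem_Ico]
        omega
      · rfl
  · rintro s ⟨hb, -, h4⟩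
    refine ⟨hb, ?_⟩
    rw [h4, Nat.sub_self, Nat.Ico_zero_eq_range, exCount]

/-- The test whether `M[2 j] = i`. -/
def imageTest (t : ℕ) : Prog :=
  seqs [.add (t + 9) (t + 7) (t + 7), .load (t + 9) (t + 9), .sub (t + 10) (t + 9) (t + 5),
    .sub (t + 11) (t + 5) (t + 9), .add (t + 10) (t + 10) (t + 11), .const (t + 8) 1,
    .sub (t + 8) (t + 8) (t + 10), .copy (t + 9) (t + 9)]

theorem isTest_imageTest (t A B : ℕ) (M hi : ℕ → ℕ) :
    IsTest t A B M hi (fun i j => M (2 * j) = i) (imageTest t) := by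
  refine ⟨by simp [imageTest, seqs, LoopFree], fun s hs => ?_, fun s a ha ha' => ?_, fun s hs => ?_⟩
  · simp only [imageTest, ev_seqs_cons, ev_seqs_nil, ev]
    repeat refine CountBase.setReg ?_ (by omega) (by omega) _
    exact hs
  · simp only [imageTest, ev_seqs_cons, ev_seqs_nil, ev, Store.setReg]
    repeat rw [Function.update_of_ne (by omega)]
  · simp [imageTest, ev_seqs_cons, ev_seqs_nil, ev, Store.setReg, hs.mem,
      ← two_mul]
    omega

/-- The test whether the image of the `i`-th edge of the first list under `u ↦ M[2 u]` is the `j`-th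
edge of the second list, in either orientation; the words of the lists are at odd addresses. -/
def edgeTest (t : ℕ) : Prog :=
  seqs [.const (t + 9) 2, .const (t + 10) 7,
    .add (t + 11) (t + 5) (t + 5), .add (t + 11) (t + 11) (t + 11), .add (t + 11) (t + 11) (t + 10),
    .load (t + 12) (t + 11), .add (t + 12) (t + 12) (t + 12), .load (t + 12) (t + 12),
    .add (t + 11) (t + 11) (t + 9),
    .load (t + 13) (t + 11), .add (t + 13) (t + 13) (t + 13), .load (t + 13) (t + 13),
    .add (t + 11) (t + 7) (t + 2), .add (t + 11) (t + 11) (t + 11),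
    .add (t + 11) (t + 11) (t + 11), .add (t + 11) (t + 11) (t + 10),
    .load (t + 14) (t + 11), .add (t + 11) (t + 11) (t + 9), .load (t + 15) (t + 11)]

/-- Set register `t + 8` to a non-zero value if the contents of the registers `t + 12` and `t + 13`
are, up to the order, those of the registers `t + 14` and `t + 15`. -/
def pairTest (t : ℕ) : Prog :=
  seqs [.sub (t + 16) (t + 12) (t + 14), .sub (t + 17) (t + 14) (t + 12),
    .add (t + 16) (t + 16) (t + 17), .sub (t + 17) (t + 13) (t + 15),
    .add (t + 16) (t + 16) (t + 17), .sub (t + 17) (t + 15) (t + 13),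
    .add (t + 16) (t + 16) (t + 17),
    .sub (t + 18) (t + 12) (t + 15), .sub (t + 17) (t + 15) (t + 12),
    .add (t + 18) (t + 18) (t + 17), .sub (t + 17) (t + 13) (t + 14),
    .add (t + 18) (t + 18) (t + 17), .sub (t + 17) (t + 14) (t + 13),
    .add (t + 18) (t + 18) (t + 17),
    .const (t + 17) 1, .sub (t + 16) (t + 17) (t + 16), .sub (t + 18) (t + 17) (t + 18),
    .add (t + 8) (t + 16) (t + 18)]

theorem ev_pairTest_result (t : ℕ) (s : Store) : (ev (pairTest t) s).reg (t + 8) ≠ 0 ↔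
    (s.reg (t + 12) = s.reg (t + 14) ∧ s.reg (t + 13) = s.reg (t + 15)) ∨
      (s.reg (t + 12) = s.reg (t + 15) ∧ s.reg (t + 13) = s.reg (t + 14)) := by
  simp [pairTest, ev_seqs_cons, ev_seqs_nil, ev, Store.setReg]
  omega

theorem ev_edgeTest (t : ℕ) (s : Store) :
    (ev (edgeTest t) s).reg (t + 12) = s.mem (2 * s.mem (7 + 4 * s.reg (t + 5))) ∧
    (ev (edgeTest t) s).reg (t + 13) = s.mem (2 * s.mem (9 + 4 * s.reg (t + 5))) ∧
    (ev (edgeTest t) s).reg (t + 14) = s.mem (7 + 4 * s.reg (t + 2) + 4 * s.reg (t + 7)) ∧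
    (ev (edgeTest t) s).reg (t + 15) = s.mem (9 + 4 * s.reg (t + 2) + 4 * s.reg (t + 7)) := by
  simp [edgeTest, ev_seqs_cons, ev_seqs_nil, ev, Store.setReg]
  refine ⟨?_, ?_, ?_, ?_⟩ <;> ring_nf

/-- The `i`-th edge of the first list is mapped to the `j`-th edge of the second one; the lists have
length `m`. -/
def EdgeMatch (M : ℕ → ℕ) (m i j : ℕ) : Prop :=
  (M (2 * M (7 + 4 * i)) = M (7 + 4 * m + 4 * j) ∧ M (2 * M (9 + 4 * i)) = M (9 + 4 * m + 4 * j)) ∨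
  (M (2 * M (7 + 4 * i)) = M (9 + 4 * m + 4 * j) ∧ M (2 * M (9 + 4 * i)) = M (7 + 4 * m + 4 * j))

theorem isTest_edgeTest (t A B : ℕ) (M hi : ℕ → ℕ) :
    IsTest t A B M hi (EdgeMatch M A) (.seq (edgeTest t) (pairTest t)) := by
  refine ⟨by simp [edgeTest, pairTest, seqs, LoopFree], fun s hs => ?_, fun s a ha ha' => ?_,
    fun s hs => ?_⟩
  · simp only [edgeTest, pairTest, ev_seqs_cons, ev_seqs_nil, ev]
    repeat refine CountBase.setReg ?_ (by omega) (by omega) _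
    exact hs
  · simp only [edgeTest, pairTest, ev_seqs_cons, ev_seqs_nil, ev, Store.setReg]
    repeat rw [Function.update_of_ne (by omega)]
  · obtain ⟨h1, h2, h3, h4⟩ := ev_edgeTest t s
    rw [ev, ev_pairTest_result, h1, h2, h3, h4, hs.mem, hs.r2]
    rfl

/-! ### From robust isomorphism to distinguishing -/

/-- Duplicate the input: the word `y` goes to the cells `2 y` and `2 y + 1`. The input is read from its
end, so that no word is overwritten before it has been read. -/
def spread (t : ℕ) : Prog :=
  .seq (.seq (.const (t + 1) 1) (.copy (t + 2) 0))
    (.loop (t + 2) (seqs [.sub (t + 2) (t + 2) (t + 1), .load (t + 3) (t + 2),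
      .add (t + 4) (t + 2) (t + 2), .store (t + 4) (t + 3), .add (t + 4) (t + 4) (t + 1),
      .store (t + 4) (t + 3)]))

theorem triple_spread {t : ℕ} (ht : 0 < t) (x : List ℕ) :
    Triple (fun s => s = inputStore x) (spread t) (2 + (x.length * (7 + 1) + 1))
      (fun s => Simulates t (inputStore x) s ∧ (∀ y, s.mem (2 * y + 1) = x.getD y 0) ∧
        s.reg (t + 1) = 1) := by
  let I : ℕ → Store → Prop := fun k s => (∀ a < t, s.reg a = (inputStore x).reg a) ∧
    s.reg (t + 1) = 1 ∧ s.reg (t + 2) = x.length - k ∧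
    (∀ a < x.length - k, s.mem a = x.getD a 0) ∧
    ∀ y, x.length - k ≤ y → s.mem (2 * y) = x.getD y 0 ∧ s.mem (2 * y + 1) = x.getD y 0
  have hpre : Triple (fun s => s = inputStore x)
      (.seq (.const (t + 1) 1) (.copy (t + 2) 0)) 2 (I 0) := by
    refine Triple.of_ev ⟨trivial, trivial⟩ ?_
    rintro s rfl
    refine ⟨fun a ha => ?_, ?_, ?_, fun a _ => rfl, fun y hy => ?_⟩
    · simp only [ev, Store.setReg]
      rw [Function.update_of_ne (by omega), Function.update_of_ne (by omega)]
    · simp [ev, Store.setReg]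
    · simp only [ev, Store.setReg, Function.update_self, Nat.sub_zero]
      rw [Function.update_of_ne (by omega)]
      rfl
    · constructor
      · change x.getD (2 * y) 0 = x.getD y 0
        rw [List.getD_eq_default _ _ (by omega), List.getD_eq_default _ _ (by omega)]
      · change x.getD (2 * y + 1) 0 = x.getD y 0
        rw [List.getD_eq_default _ _ (by omega), List.getD_eq_default _ _ (by omega)]
  refine (hpre.seq (Triple.loop I x.length ?_ ?_)).weaken (fun _ h => h) ?_ le_rfl
  · rintro k hk s ⟨-, -, h2, -⟩
    rw [h2]
    omega
  · intro k hk
    refine Triple.of_ev ⟨trivial, trivial, trivial, trivial, trivial, trivial, trivial⟩ ?_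
    rintro s ⟨h0, h1, h2, h3, h4⟩
    have e : x.length - k - 1 = x.length - (k + 1) := by omega
    have h5 := h3 (x.length - (k + 1)) (by omega)
    simp only [ev_seqs_cons, ev_seqs_nil]
    refine ⟨fun a ha => ?_, ?_, ?_, fun a ha => ?_, fun y hy => ?_⟩
    · simp only [ev, Store.setReg, Store.setMem]
      repeat rw [Function.update_of_ne (by omega)]
      exact h0 a ha
    · simp [ev, Store.setReg, Store.setMem, h1]
    · simp [ev, Store.setReg, Store.setMem, h1, h2, e]
    · simp [ev, Store.setReg, Store.setMem, h1, h2, e, h5]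
      rw [Function.update_of_ne (by omega), Function.update_of_ne (by omega)]
      exact h3 a (by omega)
    · rcases hy.eq_or_lt with rfl | hy
      · constructor
        · simp [ev, Store.setReg, Store.setMem, h1, h2, e, h5]
          rw [Function.update_of_ne (by omega), ← two_mul, Function.update_self]
        · simp [ev, Store.setReg, Store.setMem, h1, h2, e, h5, ← two_mul]
      · have h6 := h4 y (by omega)
        constructor
        · simp [ev, Store.setReg, Store.setMem, h1, h2, e, h5]
          rw [Function.update_of_ne (by omega), Function.update_of_ne (by omega)]
          exact h6.1
        · simp [ev, Store.setReg, Store.setMem, h1, h2, e, h5]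
          rw [Function.update_of_ne (by omega), Function.update_of_ne (by omega)]
          exact h6.2
  · rintro s ⟨h0, h1, -, -, h4⟩
    exact ⟨⟨h0, fun y => (h4 y (by omega)).1⟩, fun y => (h4 y (by omega)).2, h1⟩

/-- Check that the cells `M[2 j]`, `j < n`, contain a permutation of the vertices which preserves all
but a fraction `1 / 256` of the edges, and answer `1` in this case. The numbers `n` of vertices and
`m` of edges are in the cells `1` and `3`. -/
def verify (t : ℕ) : Prog :=
  .seq (seqs [.const (t + 9) 1, .load (t + 2) (t + 9), .copy (t + 3) (t + 2),
      .copy (t + 31) (t + 2)])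
    (.seq (countLoop t (imageTest t))
      (.seq (seqs [.copy (t + 32) (t + 4), .const (t + 9) 3, .load (t + 2) (t + 9),
          .copy (t + 3) (t + 2)])
        (.seq (countLoop t (.seq (edgeTest t) (pairTest t)))
          (seqs [.sub (t + 9) (t + 2) (t + 4), .add (t + 9) (t + 9) (t + 9),
            .add (t + 9) (t + 9) (t + 9), .add (t + 9) (t + 9) (t + 9),
            .add (t + 9) (t + 9) (t + 9), .add (t + 9) (t + 9) (t + 9),
            .add (t + 9) (t + 9) (t + 9), .add (t + 9) (t + 9) (t + 9),
            .add (t + 9) (t + 9) (t + 9), .sub (t + 9) (t + 9) (t + 2),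
            .sub (t + 10) (t + 31) (t + 32), .add (t + 9) (t + 9) (t + 10),
            .sub 0 (t + 1) (t + 9)]))))

/-- The time needed for counting with a loop-free test of size `c` in an area of size `A × A`. -/
def countTime (c A : ℕ) : ℕ :=
  2 + (A * (3 + ((A * (1 + (c + 3) + 1) + 1) + 1) + 1) + 1)

theorem triple_verify (t : ℕ) (M : ℕ → ℕ) {n m : ℕ} (hn : M 1 = n) (hm : M 3 = m) :
    Triple (fun s => s.mem = M ∧ s.reg (t + 1) = 1) (verify t)
      (5 + (countTime (size (imageTest t)) n + (5 +
        (countTime (size (.seq (edgeTest t) (pairTest t))) m + 14))))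
      (fun s => s.reg 0 = 1 ↔
        n ≤ exCount n n (fun i j => M (2 * j) = i) ∧
        256 * (m - exCount m m (EdgeMatch M m)) ≤ m) := by
  rintro s ⟨hs, h1⟩
  have hp₁ : LoopFree (seqs [.const (t + 9) 1, .load (t + 2) (t + 9), .copy (t + 3) (t + 2),
      .copy (t + 31) (t + 2)]) := ⟨trivial, trivial, trivial, trivial, trivial⟩
  obtain ⟨k₁, hk₁, r₁⟩ := hp₁.run s
  obtain ⟨s₁, hs₁⟩ : ∃ s₁, s₁ = ev (seqs [.const (t + 9) 1, .load (t + 2) (t + 9),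
    .copy (t + 3) (t + 2), .copy (t + 31) (t + 2)]) s := ⟨_, rfl⟩
  rw [← hs₁] at r₁
  have hb₁ : CountBase t n n M s₁.reg s₁ := by
    refine ⟨?_, ?_, ?_, ?_, fun _ _ => rfl⟩ <;>
    simp [hs₁, ev_seqs_cons, ev_seqs_nil, ev, Store.setReg, hs, h1, hn]
  have h31 : s₁.reg (t + 31) = n := by
    simp [hs₁, ev_seqs_cons, ev_seqs_nil, ev, Store.setReg, hs, hn]
  obtain ⟨k₂, hk₂, s₂, r₂, hb₂, hc₂⟩ := triple_countLoop (isTest_imageTest t n n M s₁.reg) s₁ hb₁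
  have hp₃ : LoopFree (seqs [.copy (t + 32) (t + 4), .const (t + 9) 3, .load (t + 2) (t + 9),
      .copy (t + 3) (t + 2)]) := ⟨trivial, trivial, trivial, trivial, trivial⟩
  obtain ⟨k₃, hk₃, r₃⟩ := hp₃.run s₂
  obtain ⟨s₃, hs₃⟩ : ∃ s₃, s₃ = ev (seqs [.copy (t + 32) (t + 4), .const (t + 9) 3,
    .load (t + 2) (t + 9), .copy (t + 3) (t + 2)]) s₂ := ⟨_, rfl⟩
  rw [← hs₃] at r₃
  have hb₃ : CountBase t m m M s₃.reg s₃ := by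
    refine ⟨?_, ?_, ?_, ?_, fun _ _ => rfl⟩ <;>
    simp [hs₃, ev_seqs_cons, ev_seqs_nil, ev, Store.setReg, hb₂.mem, hb₂.r1, hm]
  have h31' : s₃.reg (t + 31) = n := by
    simp [hs₃, ev_seqs_cons, ev_seqs_nil, ev, Store.setReg, hb₂.high, h31]
  have h32 : s₃.reg (t + 32) = s₂.reg (t + 4) := by
    simp [hs₃, ev_seqs_cons, ev_seqs_nil, ev, Store.setReg]
  obtain ⟨k₄, hk₄, s₄, r₄, hb₄, hc₄⟩ := triple_countLoop (isTest_edgeTest t m m M s₃.reg) s₃ hb₃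
  have hp₅ : LoopFree (seqs [.sub (t + 9) (t + 2) (t + 4), .add (t + 9) (t + 9) (t + 9),
      .add (t + 9) (t + 9) (t + 9), .add (t + 9) (t + 9) (t + 9), .add (t + 9) (t + 9) (t + 9),
      .add (t + 9) (t + 9) (t + 9), .add (t + 9) (t + 9) (t + 9), .add (t + 9) (t + 9) (t + 9),
      .add (t + 9) (t + 9) (t + 9), .sub (t + 9) (t + 9) (t + 2), .sub (t + 10) (t + 31) (t + 32),
      .add (t + 9) (t + 9) (t + 10), .sub 0 (t + 1) (t + 9)]) := by
    simp [seqs, LoopFree]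
  obtain ⟨k₅, hk₅, r₅⟩ := hp₅.run s₄
  refine ⟨k₁ + (k₂ + (k₃ + (k₄ + k₅))), ?_, _, .seq r₁ (.seq r₂ (.seq r₃ (.seq r₄ r₅))), ?_⟩
  · simp only [seqs, size] at hk₁ hk₃ hk₅
    simp only [countTime]
    omega
  · rw [← hc₂, ← hc₄, ← h32, ← hb₄.high (t + 32) (by omega)]
    have e31 : s₄.reg (t + 31) = n := by rw [hb₄.high _ (by omega), h31']
    simp [ev_seqs_cons, ev_seqs_nil, ev, Store.setReg, hb₄.r1, hb₄.r2, e31]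
    omega

section Words

variable {n : ℕ} (lG lH : List (Fin n × Fin n))

theorem length_encodePair :
    (encodePair lG lH).length = 3 + 2 * lG.length + 2 * lH.length := by
  have h : ∀ l : List (Fin n × Fin n),
      (l.flatMap fun e => [(e.1 : ℕ), (e.2 : ℕ)]).length = 2 * l.length := fun l =>
    length_flatMap_const l _ fun _ => rfl
  simp only [encodePair, List.length_append, h]
  rfl

theorem encodePair_cons :
    encodePair lG lH = n :: lG.length :: lH.length ::
      (lG.flatMap (fun e => [(e.1 : ℕ), (e.2 : ℕ)]) ++
        lH.flatMap (fun e => [(e.1 : ℕ), (e.2 : ℕ)])) := by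
  simp [encodePair]

theorem getD_encodePair_fst {a r : ℕ} (ha : a < lG.length) (hr : r < 2) :
    (encodePair lG lH).getD (3 + 2 * a + r) 0 = [(lG[a].1 : ℕ), (lG[a].2 : ℕ)].getD r 0 := by
  rw [encodePair_cons, show 3 + 2 * a + r = 2 * a + r + 1 + 1 + 1 by ring, List.getD_cons_succ,
    List.getD_cons_succ, List.getD_cons_succ, List.getD_append,
    getD_flatMap_const (k := 2) _ _ (by simp) _ ha hr]
  rw [length_flatMap_const (k := 2) _ _ (by simp)]
  omega

theorem getD_encodePair_snd {a r : ℕ} (ha : a < lH.length) (hr : r < 2) :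
    (encodePair lG lH).getD (3 + 2 * lG.length + 2 * a + r) 0 =
      [(lH[a].1 : ℕ), (lH[a].2 : ℕ)].getD r 0 := by
  rw [encodePair_cons, show 3 + 2 * lG.length + 2 * a + r =
    2 * lG.length + (2 * a + r) + 1 + 1 + 1 by ring, List.getD_cons_succ,
    List.getD_cons_succ, List.getD_cons_succ, List.getD_append_right,
    length_flatMap_const (k := 2) _ _ (by simp), Nat.add_sub_cancel_left,
    getD_flatMap_const (k := 2) _ _ (by simp) _ ha hr]
  rw [length_flatMap_const (k := 2) _ _ (by simp)]
  omega

variable {lG lH}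

theorem exCount_edgeMatch {G H : SimpleGraph (Fin n)} (hG : IsEdgeList lG G) (hH : IsEdgeList lH H)
    (hlen : lG.length = lH.length) {M : ℕ → ℕ} {π : Fin n → Fin n}
    (hM : ∀ y, M (2 * y + 1) = (encodePair lG lH).getD y 0) (hπ : ∀ i : Fin n, M (2 * i) = π i) :
    exCount lG.length lG.length (EdgeMatch M lG.length) = preserved lG H π := by
  classical
  have hset : {p | p ∈ lG ∧ H.Adj (π p.1) (π p.2)} =
      ((lG.toFinset.filter fun p => H.Adj (π p.1) (π p.2) : Finset _) : Set (Fin n × Fin n)) := by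
    ext p
    simp
  rw [preserved, hset, Set.ncard_coe_finset, exCount]
  have hmatch : ∀ i (hi : i < lG.length), (∃ j < lG.length, EdgeMatch M lG.length i j) ↔
      H.Adj (π lG[i].1) (π lG[i].2) := by
    intro i hi
    have g1 : M (7 + 4 * i) = lG[i].1 := by
      rw [show 7 + 4 * i = 2 * (3 + 2 * i + 0) + 1 by ring, hM,
        getD_encodePair_fst lG lH hi (by norm_num)]
      rfl
    have g2 : M (9 + 4 * i) = lG[i].2 := by
      rw [show 9 + 4 * i = 2 * (3 + 2 * i + 1) + 1 by ring, hM,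
        getD_encodePair_fst lG lH hi (by norm_num)]
      rfl
    have e1 : ∀ j (hj : j < lH.length), M (7 + 4 * lG.length + 4 * j) = lH[j].1 := by
      intro j hj
      rw [show 7 + 4 * lG.length + 4 * j = 2 * (3 + 2 * lG.length + 2 * j + 0) + 1 by ring, hM,
        getD_encodePair_snd lG lH hj (by norm_num)]
      rfl
    have e2 : ∀ j (hj : j < lH.length), M (9 + 4 * lG.length + 4 * j) = lH[j].2 := by
      intro j hj
      rw [show 9 + 4 * lG.length + 4 * j = 2 * (3 + 2 * lG.length + 2 * j + 1) + 1 by ring, hM,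
        getD_encodePair_snd lG lH hj (by norm_num)]
      rfl
    constructor
    · rintro ⟨j, hj, h⟩
      have hj' : j < lH.length := by omega
      have hadj := ((hH.2 lH[j].1 lH[j].2).1 (List.getElem_mem hj')).1
      rw [EdgeMatch, g1, g2, hπ, hπ, e1 j hj', e2 j hj'] at h
      rcases h with ⟨h1, h2⟩ | ⟨h1, h2⟩
      · rwa [Fin.ext h1, Fin.ext h2]
      · rw [Fin.ext h1, Fin.ext h2]
        exact hadj.symm
    · intro hadj
      rcases lt_or_gt_of_ne hadj.ne with hlt | hlt
      · obtain ⟨j, hj, hjeq⟩ := List.mem_iff_getElem.1 ((hH.2 _ _).2 ⟨hadj, hlt⟩)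
        refine ⟨j, by omega, Or.inl ?_⟩
        rw [g1, g2, hπ, hπ, e1 j hj, e2 j hj, hjeq]
        exact ⟨rfl, rfl⟩
      · obtain ⟨j, hj, hjeq⟩ := List.mem_iff_getElem.1 ((hH.2 _ _).2 ⟨hadj.symm, hlt⟩)
        refine ⟨j, by omega, Or.inr ?_⟩
        rw [g1, g2, hπ, hπ, e1 j hj, e2 j hj, hjeq]
        exact ⟨rfl, rfl⟩
  refine Finset.card_bij (fun i hi => lG[i]'(Finset.mem_range.1 (Finset.mem_filter.1 hi).1))
    ?_ ?_ ?_
  · intro i hi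
    obtain ⟨h1, h2⟩ := Finset.mem_filter.1 hi
    exact Finset.mem_filter.2 ⟨by simp, (hmatch i (Finset.mem_range.1 h1)).1 h2⟩
  · intro i hi j hj h
    exact (List.Nodup.getElem_inj_iff hG.1).1 h
  · intro p hp
    obtain ⟨h1, h2⟩ := Finset.mem_filter.1 hp
    obtain ⟨i, hi, rfl⟩ := List.mem_iff_getElem.1 (List.mem_toFinset.1 h1)
    exact ⟨i, Finset.mem_filter.2 ⟨Finset.mem_range.2 hi, (hmatch i hi).2 h2⟩, rfl⟩

/-- The first count reaches `n` exactly if the cells contain a permutation. -/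
theorem le_exCount_image_iff {f : ℕ → ℕ} :
    n ≤ exCount n n (fun i j => f j = i) ↔
      ∃ π : Fin n ≃ Fin n, ∀ i : Fin n, f i = π i := by
  rw [le_exCount_iff]
  constructor
  · intro h
    have hex : ∀ i : Fin n, ∃ j : Fin n, f j = i := by
      intro i
      obtain ⟨j, hj, h⟩ := h i i.2
      exact ⟨⟨j, hj⟩, h⟩
    choose g hg using hex
    have hinj : Function.Injective g := by
      intro i i' h
      apply Fin.ext
      rw [← hg i, h, hg i']
    refine ⟨(Equiv.ofBijective g (Finite.injective_iff_bijective.1 hinj)).symm, fun i => ?_⟩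
    obtain ⟨j, rfl⟩ := (Equiv.ofBijective g (Finite.injective_iff_bijective.1 hinj)).surjective i
    rw [Equiv.symm_apply_apply]
    exact hg j
  · rintro ⟨π, hπ⟩ i hi
    refine ⟨π.symm ⟨i, hi⟩, Fin.isLt _, ?_⟩
    rw [hπ, Equiv.apply_symm_apply]

end Words

/-- The distinguishing algorithm obtained from an algorithm `A` for robust isomorphism: run `A` on a
copy of the input, and verify its output. -/
def distinguisher (A : Prog) : Prog :=
  .seq (spread (regBound A + 1)) (.seq (dbl (regBound A + 1) A) (verify (regBound A + 1)))

/-- The distinguisher accepts exactly if the output of `A`, in the memory of its final store `s`, is a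
`(1 - 1 / 256)`-isomorphism. -/
theorem run_distinguisher {A : Prog} {n : ℕ} {G H : SimpleGraph (Fin n)}
    {lG lH : List (Fin n × Fin n)} (hG : IsEdgeList lG G) (hH : IsEdgeList lH H)
    (hpos : 0 < lG.length) (hlen : lG.length = lH.length) {k : ℕ} {s : Store}
    (hrun : Run A (inputStore (encodePair lG lH)) k s) :
    ∃ K ≤ 2 * k + (35 + 32 * lG.length) +
        (countTime (size (imageTest (regBound A + 1))) n +
          countTime (size (.seq (edgeTest (regBound A + 1)) (pairTest (regBound A + 1))))
            lG.length + 24),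
      ∃ s', Run (distinguisher A) (inputStore (encodePair lG lH)) K s' ∧
        (s'.reg 0 = 1 ↔
          ∃ π : Fin n ≃ Fin n, IsApproxIso (1 - 1 / 256) G H π ∧ ∀ i : Fin n, s.mem i = π i) := by
  classical
  set t := regBound A + 1 with ht
  obtain ⟨k₁, hk₁, s₁, r₁, hsim, hodd, h1⟩ := triple_spread (t := t) (by omega) (encodePair lG lH)
    _ rfl
  obtain ⟨k₂, hk₂, s₂, r₂, hsim₂, hrest⟩ := hrun.dbl (t := t) (by omega) hsim
  have hodd₂ : ∀ y, s₂.mem (2 * y + 1) = (encodePair lG lH).getD y 0 := fun y =>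
    (hrest.2 y).trans (hodd y)
  have hn : s₂.mem 1 = n := by
    have := hodd₂ 0
    rw [encodePair_cons] at this
    simpa using this
  have hm : s₂.mem 3 = lG.length := by
    have := hodd₂ 1
    rw [encodePair_cons] at this
    simpa using this
  obtain ⟨k₃, hk₃, s₃, r₃, h₃⟩ := triple_verify t s₂.mem hn hm s₂
    ⟨rfl, (hrest.1 _ (by omega)).trans h1⟩
  refine ⟨k₁ + (k₂ + k₃), ?_, s₃, .seq r₁ (.seq r₂ r₃), h₃.trans ?_⟩
  · rw [length_encodePair] at hk₁
    omega
  · have hmem : ∀ i : ℕ, s₂.mem (2 * i) = s.mem i := hsim₂.2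
    simp only [hmem]
    rw [le_exCount_image_iff]
    have key : ∀ π : Fin n ≃ Fin n, (∀ i : Fin n, s.mem i = π i) →
        (256 * (lG.length - exCount lG.length lG.length (EdgeMatch s₂.mem lG.length)) ≤
            lG.length ↔
          IsApproxIso (1 - 1 / 256) G H π) := by
      intro π hπ
      rw [exCount_edgeMatch hG hH hlen hodd₂ fun i => (hmem i).trans (hπ i),
        isApproxIso_iff hG hH hlen hpos]
      have h1 : (256 * (lG.length - preserved lG H π) ≤ lG.length) ↔
          255 * lG.length ≤ 256 * preserved lG H π := by omega
      rw [h1, ← @Nat.cast_le ℝ]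
      push_cast
      constructor <;> intro h <;> linarith
    constructor
    · rintro ⟨⟨π, hπ⟩, h⟩
      exact ⟨π, (key π hπ).1 h, hπ⟩
    · rintro ⟨π, h, hπ⟩
      exact ⟨⟨π, hπ⟩, (key π hπ).2 h⟩

theorem countTime_le {c A n d : ℕ} (hA : A ≤ 4 * n) :
    countTime c A ≤ (16 * (c + 5) + 27) * (n ^ (d + 2) + 1) := by
  have h1 : A * A ≤ 16 * n ^ 2 := by nlinarith
  rcases Nat.eq_zero_or_pos n with rfl | hn
  · obtain rfl : A = 0 := by omega
    simp [countTime]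
  · have h2 : n ^ 2 ≤ n ^ (d + 2) := Nat.pow_le_pow_right hn (by omega)
    have h3 : n ≤ n ^ 2 := by nlinarith
    have h4 : countTime c A = A * A * (c + 5) + 6 * A + 3 := by
      unfold countTime
      ring
    rw [h4]
    have h5 : A * A * (c + 5) ≤ 16 * n ^ (d + 2) * (c + 5) :=
      Nat.mul_le_mul_right _ (h1.trans (by omega))
    nlinarith

theorem distinguishes_distinguisher {A : Prog} (hA : SolvesRobustGiso A)
    (hpoly : PolyTimeOnPairs A) :
    ∃ ε : ℝ, 0 < ε ∧ ∃ d, Distinguishes (distinguisher A) 4 ε (1 / 256) fun n => n ^ d := by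
  obtain ⟨r, -, hr, hsol⟩ := hA
  obtain ⟨a, d, ha⟩ := hpoly
  -- Some `ε` for which `A` loses less than a fraction `1 / 256` of the edges.
  obtain ⟨ε, ⟨hε0, hε1⟩, hε⟩ : ∃ ε : ℝ, (0 < ε ∧ ε ≤ 1) ∧ r ε < 1 / 256 := by
    have h1 : ∀ᶠ ε in 𝓝[>] (0 : ℝ), r ε < 1 / 256 := hr.eventually_lt_const (by norm_num)
    have h2 : ∀ᶠ ε in 𝓝[>] (0 : ℝ), ε ∈ Set.Ioc (0 : ℝ) 1 := Ioc_mem_nhdsGT one_pos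
    obtain ⟨ε, h1, h2⟩ := (h1.and h2).exists
    exact ⟨ε, h2, h1⟩
  refine ⟨ε, hε0, d + 2, ?_⟩
  obtain ⟨c₁, hc₁⟩ : ∃ c, c = size (imageTest (regBound A + 1)) := ⟨_, rfl⟩
  obtain ⟨c₂, hc₂⟩ : ∃ c, c = size (.seq (edgeTest (regBound A + 1)) (pairTest (regBound A + 1))) :=
    ⟨_, rfl⟩
  refine ⟨2 * a + (35 + 128) + ((16 * (c₁ + 5) + 27) + (16 * (c₂ + 5) + 27)) + 24,
    fun n G H lG lH hG hH hpos hlen hle => ?_⟩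
  obtain ⟨k, hk, s, hrun⟩ := ha n G H lG lH hG hH hpos (hlen ▸ hpos)
  obtain ⟨K, hK, s', hrun', hs'⟩ := run_distinguisher hG hH hpos hlen hrun
  rw [← hc₁, ← hc₂] at hK
  refine ⟨⟨K, hK.trans ?_, s', hrun'⟩, fun hiso => ?_, fun hiso => ?_⟩
  · have hn : 0 < n := by omega
    have h1 : n ^ d ≤ n ^ (d + 2) := Nat.pow_le_pow_right hn (by omega)
    have h2 : n ≤ n ^ (d + 2) := Nat.le_self_pow (by omega) n
    have h3 := countTime_le (c := c₁) (A := n) (n := n) (d := d) (by omega)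
    have h4 := countTime_le (c := c₂) (A := lG.length) (n := n) (d := d) hle
    have h5 : a * (n ^ d + 1) ≤ a * (n ^ (d + 2) + 1) := Nat.mul_le_mul_left _ (by omega)
    have h6 : k ≤ a * (n ^ (d + 2) + 1) := hk.trans h5
    have h7 : 1 ≤ n ^ (d + 2) + 1 := by omega
    have h8 : lG.length ≤ 4 * (n ^ (d + 2) + 1) := by omega
    change _ ≤ _ * (n ^ (d + 2) + 1)
    generalize n ^ (d + 2) + 1 = P at h3 h4 h6 h7 h8 ⊢
    generalize 16 * (c₁ + 5) + 27 = α at h3 ⊢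
    generalize 16 * (c₂ + 5) + 27 = β at h4 ⊢
    rw [Nat.add_mul, Nat.add_mul, Nat.add_mul, Nat.add_mul α, mul_assoc 2 a P]
    omega
  · obtain ⟨k', s'', hrun'', π, hπ, hmem⟩ := hsol ε ⟨hε0.le, hε1⟩ n G H lG lH hG hH hpos
      (hlen ▸ hpos) hiso
    obtain ⟨-, rfl⟩ := hrun''.unique hrun
    refine ⟨K, s', hrun', hs'.2 ⟨π, ?_, hmem⟩⟩
    exact le_trans (by linarith) hπ
  · rintro ⟨k', s'', hrun'', h⟩
    obtain ⟨-, rfl⟩ := hrun''.unique hrun'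
    obtain ⟨π, hπ, -⟩ := hs'.1 h
    exact hiso ⟨π, hπ⟩

theorem not_distinguishes (hyp : R3XORHypothesis) {ε : ℝ} (hε : 0 < ε) :
    ¬ ∃ (A : Prog) (d : ℕ), Distinguishes A 4 ε (1 / 256) fun n => n ^ d := by
  rintro ⟨A, d, a, ha⟩
  -- The exponent is increased by one, because the reduction needs a time bound of at least `n`.
  have hA : Distinguishes A 4 ε (1 / 256) fun n => n ^ (d + 1) := by
    refine ⟨a, fun n G H lG lH hG hH hpos hlen hle => ?_⟩
    obtain ⟨⟨k, hk, h⟩, h'⟩ := ha n G H lG lH hG hH hpos hlen hle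
    refine ⟨⟨k, hk.trans (Nat.mul_le_mul_left _ ?_), h⟩, h'⟩
    have : n ^ d ≤ n ^ (d + 1) := Nat.pow_le_pow_right (by omega) (by omega)
    exact Nat.succ_le_succ this
  obtain ⟨⟨a', ha'⟩, h1, h2⟩ := certifiesXor_certifier
    (fun n => Nat.le_self_pow (Nat.succ_ne_zero d) n) hA
  refine hyp (1 * ε) (by linarith) 300 (by norm_num) ⟨certifier A, d + 1, ⟨a' * 1203 ^ (d + 1),
    fun n C => ?_⟩, h1, h2⟩
  obtain ⟨k, hk, h⟩ := ha' n C
  refine ⟨k, hk.trans ?_, h⟩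
  change a' * ((1203 * n) ^ (d + 1) + 1) ≤ a' * 1203 ^ (d + 1) * (n ^ (d + 1) + 1)
  rw [mul_assoc, mul_pow]
  refine Nat.mul_le_mul_left _ ?_
  have : 1 ≤ 1203 ^ (d + 1) := Nat.one_le_pow _ _ (by norm_num)
  rw [mul_add, mul_one]
  omega

end RobustGI

theorem theorem2 :
    (∃ ε₀ : ℝ, 0 < ε₀ ∧ ∃ Δ : ℕ, 0 < Δ ∧ ∃ c : ℝ, 0 < c ∧ ∃ K b : ℕ,
      (∀ ε : ℝ, 0 < ε → ∀ t : ℕ → ℕ, (∀ n, n ≤ t n) →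
        (∃ A : RobustGI.Prog, RobustGI.Distinguishes A K ε ε₀ t) →
          ∃ B : RobustGI.Prog, RobustGI.CertifiesXor B Δ (c * ε) (fun n => t (b * n))) ∧
      (RobustGI.R3XORHypothesis → ∀ ε : ℝ, 0 < ε →
        ¬ ∃ (A : RobustGI.Prog) (d : ℕ), RobustGI.Distinguishes A K ε ε₀ (fun n => n ^ d))) ∧
    (RobustGI.R3XORHypothesis →
      ¬ ∃ A : RobustGI.Prog, RobustGI.SolvesRobustGiso A ∧ RobustGI.PolyTimeOnPairs A) := by
  refine ⟨⟨1 / 256, by norm_num, 300, by norm_num, 1, one_pos, 4, 1203, ?_, ?_⟩, ?_⟩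
  · rintro ε - t ht ⟨A, hA⟩
    exact ⟨_, RobustGI.certifiesXor_certifier ht hA⟩
  · intro hyp ε hε
    exact RobustGI.not_distinguishes hyp hε
  · rintro hyp ⟨A, hA, hpoly⟩
    obtain ⟨ε, hε, d, h⟩ := RobustGI.distinguishes_distinguisher hA hpoly
    exact RobustGI.not_distinguishes hyp hε ⟨_, d, h⟩
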